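/- Let $M$ be a smooth manifold of dimension $n\ge 2$ with a projective structure $\boldsymbol p$: an equivalence class of torsion-free affine connections, where $\bar\nabla\sim\nabla$ if $\bar\nabla_aY^b=\nabla_aY^b+\Upsilon_aY^b+\Upsilon_cY^c\delta_a^b$ for some one-form $\Upsilon$. Let $\mathcal E(w)$ be the $w$-th power of the $(2n+2)$-nd root of $(\Lambda^nTM)^2$, and $\mathcal B(w)=\mathcal B\otimes\mathcal E(w)$. Let $R_{ab}{}^c{}_d$ be the curvature of $\nabla$, $(\nabla_a\nabla_b-\nabla_b\nabla_a)v^c=R_{ab}{}^c{}_dv^d$, put $\mathrm{Ric}_{bd}=R_{ab}{}^a{}_d$, and let $P_{ab}=\frac{1}{n^2-1}(n\,\mathrm{Ric}_{ab}+\mathrm{Ric}_{ba})$ be the projective Schouten tensor. The cotractor bundle is $\mathcal E_A=J^1(\mathcal E(1))$, and the standard tractor bundle $\mathcal E^A$ is its dual. A choice of $\nabla\in\boldsymbol p$ identifies $\mathcal E^A$ with $\mathcal E^a(-1)\oplus\mathcal E(-1)$, $V^A=(\nu^a,\rho)$, with $(\nu^a,\rho)\mapsto(\nu^a,\rho-\Upsilon_b\nu^b)$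 under a change of $\nabla$, and the normal tractor connection is $\nabla_a(\nu^b,\rho)=(\nabla_a\nu^b+\rho\,\delta_a^b,\ \nabla_a\rho-P_{ab}\nu^b)$. Accordingly a section of $\mathcal E^{(AB)}$ has slots $(\zeta^{ab},\lambda^a,\rho)$ in $\mathcal E^{(ab)}(-2)$, $\mathcal E^a(-2)$, $\mathcal E(-2)$, and a section of $\mathcal E_{(AB)}$ has slots $(\tau,\lambda_a,\zeta_{ab})$ in $\mathcal E(2)$, $\mathcal E_a(2)$, $\mathcal E_{(ab)}(2)$ (in both cases the components of the symmetric matrix representing it). For $\mathcal V=\mathcal E^{(AB)}$ or $\mathcal E_{(AB)}$ let $\partial^*$ be the Kostant codifferential on $\mathcal V$-valued forms (contraction of a form index with the action of $X^BZ_A{}^c$, the image of a one-form $\alpha_c$ in $\mathrm{End}(\mathcal E^A)$ being $X^BZ_A{}^c\alpha_c$, i.e. $(\nu^a,\rho)\mapsto(0,\alpha_c\nu^c)$), let $H_k(M,\mathcal V)=\ker\partial^*/\operatorname{im}\partial^*$ in degree $k$, with projection $\Pi_k:\ker\partial^*\to H_k(M,\mathcal V)$. For a smooth section $\sigma$ of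 $H_0(M,\mathcal V)$ let $L(\sigma)$ be the unique smooth section of $\mathcal V$ with $\Pi_0(L(\sigma))=\sigma$ and $\partial^*(d^\nabla L(\sigma))=0$ (the splitting operator), and let $\Theta_0(\sigma)=\Pi_1(d^\nabla L(\sigma))$ (the first BGG operator). Then the following hold. (1) Taking the top slot induces isomorphisms $H_0(M,\mathcal E^{(AB)})\cong\mathcal E^{(ab)}(-2)$, $H_0(M,\mathcal E_{(AB)})\cong\mathcal E(2)$, and $H_1(M,\mathcal E^{(AB)})\cong\mathring{\mathcal E}_c{}^{(ab)}(-2)$, the trace-free part of $\mathcal E_c{}^{(ab)}(-2)$. (2) For both bundles, $L(\sigma)$ exists and is unique for every smooth section $\sigma$ of $H_0$. For $\zeta\in\Gamma(\mathcal E^{(ab)}(-2))$, $\tau\in\Gamma(\mathcal E(2))$ and every $\nabla\in\boldsymbol p$, $$L(\zeta)=\begin{pmatrix}\zeta^{ab}\\[2pt]-\frac1{n+1}\nabla_b\zeta^{ab}\\[2pt]\frac1nP_{ba}\zeta^{ab}+\frac1{n(n+1)}\nabla_a\nabla_b\zeta^{ab}\end{pmatrix},\qquad L(\tau)=\begin{pmatrix}\tau\\[2pt]\frac12\nabla_a\tau\\[2pt]\frac12\nabla_a\nabla_b\tau+P_{ab}\tau\end{pmatrix}.$$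 (3) For $\zeta\in\Gamma(\mathcal E^{(ab)}(-2))$, $d^\nabla L(\zeta)$ lies in $\ker\partial^*$, and under (1) and for every $\nabla\in\boldsymbol p$, $$\Theta_0(\zeta)=\operatorname{trace-free}(\nabla_c\zeta^{ab})=\nabla_c\zeta^{ab}-\tfrac1{n+1}\delta_c^a\nabla_d\zeta^{db}-\tfrac1{n+1}\delta_c^b\nabla_d\zeta^{ad}.$$ In particular $\Theta_0(\zeta)=0$ is the metrizability equation $\operatorname{trace-free}(\nabla_c\zeta^{ab})=0$. This operator and this equation are projectively invariant: they do not depend on the choice of $\nabla\in\boldsymbol p$. -/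

import Mathlib

open Bundle Module VectorField
open scoped Manifold ContDiff

noncomputable section

namespace ProjTractor

section Geometry

variable (n : ℕ) {M : Type*} [TopologicalSpace M] [ChartedSpace (EuclideanSpace ℝ (Fin n)) M]
  [IsManifold (𝓡 n) ∞ M]

/-! ### Affine connections and projective structures -/

variable (M) in
/-- A smooth torsion-free affine connection on `M`. In Mathlib's convention
`toCov Y x v` is `∇_v Y` at the point `x`. -/
structure AffineConnection where
  toCov : CovariantDerivative (𝓡 n) (EuclideanSpace ℝ (Fin n)) (TangentSpace (𝓡 n) : M → Type _)
  smooth : toCov.ContMDiffCovariantDerivative ∞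
  torsionFree : toCov.torsion = 0

variable {n}

/-- `Υ` is a smooth one-form. -/
def IsSmoothOneForm (Υ : ∀ x : M, TangentSpace (𝓡 n) x →L[ℝ] ℝ) : Prop :=
  ∀ Y : (∀ x : M, TangentSpace (𝓡 n) x),
    ContMDiff (𝓡 n) (𝓡 n).tangent ∞ (T% Y) → ContMDiff (𝓡 n) 𝓘(ℝ, ℝ) ∞ (fun x => Υ x (Y x))

/-- `∇' = ∇ + Υ` in the projective sense: `∇'_v Y = ∇_v Y + Υ(v) Y + Υ(Y) v`. -/
def IsProjectiveChange (D D' : AffineConnection n M)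
    (Υ : ∀ x : M, TangentSpace (𝓡 n) x →L[ℝ] ℝ) : Prop :=
  IsSmoothOneForm Υ ∧
  ∀ (Y : ∀ x : M, TangentSpace (𝓡 n) x) (x : M),
    MDifferentiableAt (𝓡 n) (𝓡 n).tangent (T% Y) x →
    ∀ v : TangentSpace (𝓡 n) x,
      D'.toCov Y x v = D.toCov Y x v + Υ x v • Y x + Υ x (Y x) • v

variable (n M) in
/-- A projective structure: an equivalence class of torsion-free affine connections
under projective equivalence. -/
structure ProjectiveStructure where
  conns : Set (AffineConnection n M)
  nonempty : conns.Nonempty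
  mem_iff : ∀ D ∈ conns, ∀ D' : AffineConnection n M,
    D' ∈ conns ↔ ∃ Υ, IsProjectiveChange D D' Υ

/-! ### Frames -/

variable (n) in
/-- A linear frame of `T_x M`. -/
abbrev Frame (x : M) := Basis (Fin n) ℝ (TangentSpace (𝓡 n) x)

open scoped Classical in
/-- The local extension of a frame `b` at `x` to a frame of the tangent bundle over the domain of
the preferred chart at `x`: the vector fields with constant coefficients in that chart.
(Off the chart domain the value is irrelevant.) -/
def frameExt {x : M} (b : Frame n x) (y : M) : Frame n y :=
  let t := trivializationAt (EuclideanSpace ℝ (Fin n)) (TangentSpace (𝓡 n) : M → Type _) x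
  if hy : y ∈ t.baseSet then
    b.map ((t.linearEquivAt ℝ x (FiberBundle.mem_baseSet_trivializationAt' x)).trans
      (t.linearEquivAt ℝ y hy).symm)
  else
    b.map ((VectorBundle.continuousLinearEquivAt ℝ (EuclideanSpace ℝ (Fin n))
        (TangentSpace (𝓡 n) : M → Type _) x).toLinearEquiv.trans
      (VectorBundle.continuousLinearEquivAt ℝ (EuclideanSpace ℝ (Fin n))
        (TangentSpace (𝓡 n) : M → Type _) y).toLinearEquiv.symm)

/-- The connection coefficients `Γ^i_{cj}`, i.e. the `i`-th component of `∇_{e_c} e_j` at `x`, for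
the local frame `e` extending `b`. -/
def connCoeff (D : AffineConnection n M) {x : M} (b : Frame n x) (c i j : Fin n) : ℝ :=
  b.repr (D.toCov (fun y => frameExt b y j) x (b c)) i

/-! ### Weighted tensors

Sections of associated bundles of the frame bundle are described by their components in all
frames. -/

variable (n) in
/-- Components `F^{I}_{J}` of a tensor with `k` upper and `l` lower indices. -/
abbrev Comp (k l : ℕ) := (Fin k → Fin n) → (Fin l → Fin n) → ℝ

/-- The fibre at `x` of `E^{a_1 … a_k}_{b_1 … b_l}(w)`. A frame change `b' = b A` acts on tensor
indices in the usual way and by `|det A|^{-w/(n+1)}` on the weight, since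
`E(w)` is the power `w/(n+1)` of the bundle `|Λ^n TM|`. -/
def wTensor (k l : ℕ) (w : ℝ) (x : M) : Submodule ℝ (Frame n x → Comp n k l) where
  carrier := {F | ∀ (b b' : Frame n x) (I : Fin k → Fin n) (J : Fin l → Fin n),
    F b' I J = |(b.toMatrix b').det| ^ (-w / (n + 1)) *
      ∑ K : Fin k → Fin n, ∑ L : Fin l → Fin n,
        (∏ r, b'.toMatrix b (I r) (K r)) * (∏ s, b.toMatrix b' (L s) (J s)) * F b K L}
  add_mem' := by
    intro F G hF hG b b' I J
    simp only [Pi.add_apply, mul_add, Finset.sum_add_distrib]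
    rw [hF b b' I J, hG b b' I J]
  zero_mem' := by intro b b' I J; simp
  smul_mem' := by
    intro r F hF b b' I J
    simp only [Pi.smul_apply, smul_eq_mul]
    rw [hF b b' I J]
    simp only [Finset.mul_sum]
    refine Finset.sum_congr rfl fun K _ => Finset.sum_congr rfl fun L _ => ?_
    ring

/-- A field of components is smooth if its components in the local chart frames are smooth. -/
def SmoothField {k l : ℕ} (F : ∀ x : M, Frame n x → Comp n k l) : Prop :=
  ∀ (x : M) (b : Frame n x) (I : Fin k → Fin n) (J : Fin l → Fin n),
    ContMDiffOn (𝓡 n) 𝓘(ℝ, ℝ) ∞ (fun y => F y (frameExt b y) I J)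
      (chartAt (EuclideanSpace ℝ (Fin n)) x).source

variable (n) in
/-- The fibre of `E^{(ab)}(-2)`. -/
def symBivector (x : M) : Submodule ℝ (Frame n x → Comp n 2 0) where
  carrier := {F | F ∈ wTensor 2 0 (-2) x ∧ ∀ b a c, F b ![a, c] ![] = F b ![c, a] ![]}
  add_mem' := fun hF hG => ⟨add_mem hF.1 hG.1, fun b a c => by simp [hF.2 b a c, hG.2 b a c]⟩
  zero_mem' := ⟨zero_mem _, fun _ _ _ => rfl⟩
  smul_mem' := fun r _ hF => ⟨Submodule.smul_mem _ r hF.1, fun b a c => by simp [hF.2 b a c]⟩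

variable (n) in
/-- The fibre of the bundle of trace-free elements of `E_c^{(ab)}(-2)`. -/
def tfSymBivectorForm (x : M) : Submodule ℝ (Frame n x → Comp n 2 1) where
  carrier := {F | F ∈ wTensor 2 1 (-2) x ∧ (∀ b a d c, F b ![a, d] ![c] = F b ![d, a] ![c]) ∧
    ∀ b a, ∑ c, F b ![a, c] ![c] = 0}
  add_mem' := fun hF hG => ⟨add_mem hF.1 hG.1,
    fun b a d c => by simp [hF.2.1 b a d c, hG.2.1 b a d c],
    fun b a => by simp [Finset.sum_add_distrib, hF.2.2 b a, hG.2.2 b a]⟩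
  zero_mem' := ⟨zero_mem _, fun _ _ _ _ => rfl, fun _ _ => by simp⟩
  smul_mem' := fun r _ hF => ⟨Submodule.smul_mem _ r hF.1,
    fun b a d c => by simp [hF.2.1 b a d c],
    fun b a => by simp [← Finset.mul_sum, hF.2.2 b a]⟩

/-- The covariant derivative `∇ : E^{a…}_{b…}(w) → E^{a…}_{cb…}(w)` in components; the new index `c`
is the first lower index of the result. On `E(w)` it is the connection induced from
`|Λ^n TM|^{w/(n+1)}`. -/
def covD (D : AffineConnection n M) {k l : ℕ} (w : ℝ) (F : ∀ x : M, Frame n x → Comp n k l) :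
    ∀ x : M, Frame n x → Comp n k (l + 1) :=
  fun x b I J =>
    let c := J 0
    let J' : Fin l → Fin n := Fin.tail J
    mvfderiv (𝓡 n) (fun y => F y (frameExt b y) I J') x (b c)
      + ∑ r, ∑ d, connCoeff D b c (I r) d * F x b (Function.update I r d) J'
      - ∑ s, ∑ d, connCoeff D b c d (J' s) * F x b I (Function.update J' s d)
      + w / (n + 1) * (∑ d, connCoeff D b c d d) * F x b I J'

/-! ### Curvature -/

/-- The component `R_{ab}{}^c{}_d` of the curvature
`R(X,Y)Z = ∇_X ∇_Y Z - ∇_Y ∇_X Z - ∇_{[X,Y]} Z`. -/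
def curvature (D : AffineConnection n M) {x : M} (b : Frame n x) (i j k l : Fin n) : ℝ :=
  let e : Fin n → ∀ y : M, TangentSpace (𝓡 n) y := fun r y => frameExt b y r
  b.repr (D.toCov (fun y => D.toCov (e l) y (e j y)) x (e i x)
    - D.toCov (fun y => D.toCov (e l) y (e i y)) x (e j x)
    - D.toCov (e l) x (mlieBracket (𝓡 n) (e i) (e j) x)) k

/-- The Ricci tensor `Ric_{bd} = R_{ab}{}^a{}_d`. -/
def ricci (D : AffineConnection n M) {x : M} (b : Frame n x) (j l : Fin n) : ℝ :=
  ∑ i, curvature D b i j i l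

/-- The projective Schouten tensor `P_{ab} = (n Ric_{ab} + Ric_{ba}) / (n² - 1)`, which is
`Ric_{ab} / (n - 1)` when the Ricci tensor is symmetric, i.e. when the connection locally
preserves a volume density. -/
def schouten (D : AffineConnection n M) {x : M} (b : Frame n x) (i j : Fin n) : ℝ :=
  (n * ricci D b i j + ricci D b j i) / ((n : ℝ) ^ 2 - 1)

/-! ### Tractors

A choice of connection in the projective class and of a frame of `T_x M` identifies the fibre of the
standard tractor bundle `𝒯 = J¹(E(1))*` with `ℝⁿ ⊕ ℝ`, the components of `V = (ν^a, ρ)` with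
`ν ∈ E^a(-1)` and `ρ ∈ E(-1)`, and that of the cotractor bundle `J¹(E(1))` with `ℝ ⊕ ℝⁿ`, where the
1-jet of `σ` has slots `(σ, ∇_a σ)`. Tractors are described by their components in all these
identifications. The index `Sum.inl a` stands for `W_a` and `Sum.inr ()` for `X`. -/

/-- Indices of tractor components. -/
abbrev TIdx (n : ℕ) := Fin n ⊕ Unit

/-- Square matrices of tractor components. -/
abbrev TMat (n : ℕ) := Matrix (TIdx n) (TIdx n) ℝ

/-- The tractor frames at `x`: a connection in the projective class and a linear frame at `x`. -/
abbrev TFrame (p : ProjectiveStructure n M) (x : M) := p.conns × Frame n x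

/-- The matrix of the change of the components of a standard tractor when passing from `(∇, b)` to
`(∇ + Υ, b')`: `ν'` is `ν` in the new frame and `ρ' = ρ - Υ_a ν^a`, all in weight `-1`. -/
def tractorTransition {x : M} (b b' : Frame n x) (u : TangentSpace (𝓡 n) x →L[ℝ] ℝ) : TMat n :=
  |(b.toMatrix b').det| ^ ((1 : ℝ) / (n + 1)) •
    Matrix.fromBlocks (b'.toMatrix b) 0 (Matrix.of fun _ j => -u (b j)) 1

/-- The two tractor bundles considered: `S²𝒯 = E^{(AB)}` and `S²𝒯* = E_{(AB)}`. -/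
inductive Kind
  | up
  | down

/-- The action of a tractor frame change on components in `S²𝒯`, resp. `S²𝒯*`. -/
def Kind.act : Kind → TMat n → TMat n →ₗ[ℝ] TMat n
  | .up, G => LinearMap.mulLeft ℝ G ∘ₗ LinearMap.mulRight ℝ G.transpose
  | .down, G => LinearMap.mulLeft ℝ (G⁻¹).transpose ∘ₗ LinearMap.mulRight ℝ G⁻¹

/-- The action of an endomorphism of `𝒯` as a derivation on `S²𝒯`, resp. `S²𝒯*`. -/
def Kind.dact : Kind → TMat n → TMat n →ₗ[ℝ] TMat n
  | .up, A => LinearMap.mulLeft ℝ A + LinearMap.mulRight ℝ A.transpose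
  | .down, A => -(LinearMap.mulLeft ℝ A.transpose + LinearMap.mulRight ℝ A)

/-- Components of a `k`-form at `x` with values in matrices of tractor components. -/
abbrev FormComp (p : ProjectiveStructure n M) (k : ℕ) (x : M) :=
  TFrame p x → (Fin k → Fin n) → TMat n

/-- The fibre at `x` of the bundle of `k`-forms with values in `S²𝒯`, resp. `S²𝒯*`. -/
def form (p : ProjectiveStructure n M) (κ : Kind) (k : ℕ) (x : M) :
    Submodule ℝ (FormComp p k x) where
  carrier := {φ |
    (∀ f J, (φ f J).IsSymm) ∧
    (∀ f J (σ : Equiv.Perm (Fin k)), φ f (J ∘ σ) = ((Equiv.Perm.sign σ : ℤ) : ℝ) • φ f J) ∧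
    ∀ (f f' : TFrame p x) (Υ : ∀ y : M, TangentSpace (𝓡 n) y →L[ℝ] ℝ),
      IsProjectiveChange f.1.1 f'.1.1 Υ → ∀ J : Fin k → Fin n,
        φ f' J = ∑ L : Fin k → Fin n, (∏ s, f.2.toMatrix f'.2 (L s) (J s)) •
          κ.act (tractorTransition f.2 f'.2 (Υ x)) (φ f L)}
  add_mem' := by
    rintro φ ψ ⟨h1, h2, h3⟩ ⟨g1, g2, g3⟩
    refine ⟨fun f J => (h1 f J).add (g1 f J), fun f J σ => ?_, fun f f' Υ h J => ?_⟩
    · simp only [Pi.add_apply, smul_add, h2 f J σ, g2 f J σ]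
    · simp only [Pi.add_apply, map_add, smul_add, Finset.sum_add_distrib]
      rw [h3 f f' Υ h J, g3 f f' Υ h J]
  zero_mem' := ⟨fun _ _ => Matrix.isSymm_zero, fun _ _ _ => by simp, fun _ _ _ _ _ => by simp⟩
  smul_mem' := by
    rintro r φ ⟨h1, h2, h3⟩
    refine ⟨fun f J => (h1 f J).smul r, fun f J σ => ?_, fun f f' Υ h J => ?_⟩
    · simp only [Pi.smul_apply, h2 f J σ]
      rw [smul_comm]
    · simp only [Pi.smul_apply, map_smul]
      rw [h3 f f' Υ h J, Finset.smul_sum]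
      exact Finset.sum_congr rfl fun L _ => smul_comm _ _ _

/-- A smooth section of the bundle of `k`-forms with values in `S²𝒯`, resp. `S²𝒯*`. -/
def IsSmoothFormSection (p : ProjectiveStructure n M) (κ : Kind) (k : ℕ)
    (φ : ∀ x : M, FormComp p k x) : Prop :=
  (∀ x, φ x ∈ form p κ k x) ∧
  ∀ (x : M) (D : p.conns) (b : Frame n x) (J : Fin k → Fin n) (A B : TIdx n),
    ContMDiffOn (𝓡 n) 𝓘(ℝ, ℝ) ∞ (fun y => φ y (D, frameExt b y) J A B)
      (chartAt (EuclideanSpace ℝ (Fin n)) x).source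

/-- The connection matrix of the normal tractor connection: in direction `e_c`,
`(ν^b, ρ) ↦ (∇_c ν^b + ρ δ_c^b, ∇_c ρ - P_{cb} ν^b)`, where `ν` and `ρ` have weight `-1`. -/
def tractorConnMatrix (D : AffineConnection n M) {x : M} (b : Frame n x) (c : Fin n) : TMat n :=
  Matrix.fromBlocks (Matrix.of fun i j => connCoeff D b c i j)
      (Matrix.of fun i _ => if i = c then 1 else 0)
      (Matrix.of fun _ j => -schouten D b c j) 0
    - ((1 : ℝ) / (n + 1) * ∑ d, connCoeff D b c d d) • (1 : TMat n)

/-- The exterior covariant derivative `d^∇` on sections of `S²𝒯`, resp. `S²𝒯*`, that is, the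
tractor connection. -/
def tractorD (p : ProjectiveStructure n M) (κ : Kind) (H : ∀ x : M, FormComp p 0 x) :
    ∀ x : M, FormComp p 1 x :=
  fun x f J =>
    (Matrix.of fun A B =>
      mvfderiv (𝓡 n) (fun y => H y (f.1, frameExt f.2 y) ![] A B) x (f.2 (J 0)))
    + κ.dact (tractorConnMatrix f.1.1 f.2 (J 0)) (H x f ![])

/-! ### The Kostant codifferential, BGG homology, and the BGG operators -/

/-- The endomorphism `X^B Z_A^c` of the standard tractor bundle. -/
def tractorNil (c : Fin n) : TMat n := Matrix.single (Sum.inr ()) (Sum.inl c) 1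

/-- The Kostant codifferential `∂*` from `(k+1)`-forms to `k`-forms: contraction of the first form
index with the action of `X^B Z_A^c`. -/
def codiff (p : ProjectiveStructure n M) (κ : Kind) (k : ℕ) (x : M) :
    FormComp p (k + 1) x →ₗ[ℝ] FormComp p k x where
  toFun φ := fun f J => ∑ c, κ.dact (tractorNil c) (φ f (Fin.cons c J))
  map_add' φ ψ := by
    funext f J
    simp [Finset.sum_add_distrib]
  map_smul' r φ := by
    funext f J
    simp [Finset.smul_sum]

/-- The kernel of `∂*` on `k`-forms. -/
def codiffKer (p : ProjectiveStructure n M) (κ : Kind) (k : ℕ) (x : M) :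
    Submodule ℝ (FormComp p k x) :=
  match k with
  | 0 => form p κ 0 x
  | k + 1 => form p κ (k + 1) x ⊓ LinearMap.ker (codiff p κ k x)

/-- The image of `∂*` in `k`-forms. -/
def codiffIm (p : ProjectiveStructure n M) (κ : Kind) (k : ℕ) (x : M) :
    Submodule ℝ (FormComp p k x) :=
  (form p κ (k + 1) x).map (codiff p κ k x)

/-- The fibre at `x` of the BGG homology bundle `H_k = ker ∂* / im ∂*`. -/
abbrev Homology (p : ProjectiveStructure n M) (κ : Kind) (k : ℕ) (x : M) :=
  codiffKer p κ k x ⧸ (codiffIm p κ k x).submoduleOf (codiffKer p κ k x)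

/-- The projection `Π_k : ker ∂* → H_k`. -/
def proj (p : ProjectiveStructure n M) (κ : Kind) (k : ℕ) (x : M) :
    codiffKer p κ k x →ₗ[ℝ] Homology p κ k x :=
  Submodule.mkQ _

/-- The characterization of `H = L(ρ)`, for a section `ρ` of `H_0`: `H` is a smooth section of `S²𝒯`,
resp. `S²𝒯*`, with `Π_0(H) = ρ` and `∂*(d^∇ H) = 0`. -/
def IsSplitting (p : ProjectiveStructure n M) (κ : Kind) (ρ : ∀ x : M, Homology p κ 0 x)
    (H : ∀ x : M, FormComp p 0 x) : Prop :=
  IsSmoothFormSection p κ 0 H ∧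
  (∀ x, ∃ h : H x ∈ codiffKer p κ 0 x, proj p κ 0 x ⟨H x, h⟩ = ρ x) ∧
  ∀ x, codiff p κ 0 x (tractorD p κ H x) = 0

open scoped Classical in
/-- The BGG splitting operator `L = L_0` (with value `0` where no `H` as above exists). -/
def splittingOp (p : ProjectiveStructure n M) (κ : Kind) (ρ : ∀ x : M, Homology p κ 0 x) :
    ∀ x : M, FormComp p 0 x :=
  if h : ∃ H, IsSplitting p κ ρ H then h.choose else 0

open scoped Classical in
/-- The first BGG operator `Θ_0(ρ) = Π_1(d^∇ L(ρ))` (with value `0` where `d^∇ L(ρ)` is not in the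
kernel of `∂*`). -/
def bggOp (p : ProjectiveStructure n M) (κ : Kind) (ρ : ∀ x : M, Homology p κ 0 x) :
    ∀ x : M, Homology p κ 1 x :=
  fun x => if h : tractorD p κ (splittingOp p κ ρ) x ∈ codiffKer p κ 1 x then
    proj p κ 1 x ⟨_, h⟩ else 0

/-- The left-hand side of the metrizability equation, i.e. the trace-free part of `∇_c ζ^{ab}`:
`∇_c ζ^{ab} - (1/(n+1)) δ_c^a ∇_d ζ^{db} - (1/(n+1)) δ_c^b ∇_d ζ^{ad}`. -/
def metrizabilityOp (D : AffineConnection n M) (ζ : ∀ x : M, Frame n x → Comp n 2 0)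
    (x : M) (b : Frame n x) : Comp n 2 1 :=
  fun I J =>
    covD D (-2) ζ x b I J
      - 1 / (n + 1) * (if J 0 = I 0 then ∑ d, covD D (-2) ζ x b ![d, I 1] ![d] else 0)
      - 1 / (n + 1) * (if J 0 = I 1 then ∑ d, covD D (-2) ζ x b ![I 0, d] ![d] else 0)

end Geometry

end ProjTractor

end

open Bundle Module VectorField
open scoped Manifold ContDiff

noncomputable section

set_option linter.unusedSectionVars false

namespace ProjTractor

/-! Everything rests on one grading argument. The endomorphism `X^B Z_A^c` lowers the slots of a
tractor by one step, so `∂*` shifts slots downwards and its image has zero top slot. In the degrees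
considered, explicit preimages show that an element of `ker ∂*` with zero top slot lies in `im ∂*`.
Hence the homology is read off from the top slot; in degree one the equation `∂*φ = 0` forces the
top slot to be trace-free (`exists_homology_zero_up`, `exists_homology_zero_down`,
`exists_homology_one_up`).

The operator `∂* d^∇` on sections is therefore triangular in the slots. Its diagonal consists of the
constants `0, n+1, 2n` for `E^{(AB)}` and `0, 2, 2` for `E_{(AB)}`, while derivatives and the
Schouten tensor occur only below the diagonal. With the top slot prescribed, `∂* d^∇ H = 0` can be
solved uniquely, slot by slot. Uniqueness is `eq_of_codiff_up` and `eq_of_codiff_down`. Existence is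
`exists_codiff_up` and `exists_codiff_down`, where an arbitrary lift is corrected twice by a
multiple of `∂* d^∇ H`.

This scheme needs `d^∇ H` to be a genuine form, independent of frames and of the connection in the
class (`tractorD_mem`). The connection matrices transform by a gauge rule (`dact_gauge`). Invariance
under `∇ ↦ ∇ + Υ` reduces to `P' = P - ∇Υ + Υ ⊗ Υ` (`schouten_projectiveChange`), obtained from the
change of the curvature.

Solving the triangular system gives the formulas for `L`. For `E_{(AB)}` it yields only the
symmetrization of `½∇∇τ + Pτ`. The skew part vanishes, because the commutator of derivatives on
densities (`covD_comm`) cancels the skew part of `P`, which the first Bianchi identity computes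
(`schouten_skew`). Finally the top slot of `d^∇ L(ζ)` is `∇ζ` corrected by `-1/(n+1)` times its
divergence, that is, its trace-free part. As it represents a class defined without a choice of `∇`,
it is projectively invariant. -/

open Filter Topology

/-! ### Local frames and the calculus of locally smooth functions and vector fields. -/

section Frames

variable {n : ℕ} {M : Type*} [TopologicalSpace M] [ChartedSpace (EuclideanSpace ℝ (Fin n)) M]
  [IsManifold (𝓡 n) ∞ M]

/-- The vector field `Y` is smooth near `x`. -/
def SmV (Y : ∀ x : M, TangentSpace (𝓡 n) x) (x : M) : Prop :=
  ∀ᶠ z in 𝓝 x, ContMDiffAt (𝓡 n) (𝓡 n).tangent ∞ (T% Y) z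

variable (n) in
/-- The function `f` is smooth near `x`. -/
def SmF (f : M → ℝ) (x : M) : Prop :=
  ∀ᶠ z in 𝓝 x, ContMDiffAt (𝓡 n) 𝓘(ℝ, ℝ) ∞ f z

/-- `frameExt b y` is the image of `b` under a linear isomorphism that does not depend on `b`. -/
theorem exists_frameExt_eq_map (x y : M) :
    ∃ L : TangentSpace (𝓡 n) x ≃ₗ[ℝ] TangentSpace (𝓡 n) y, ∀ b : Frame n x,
      frameExt b y = b.map L := by
  classical
  by_cases hy : y ∈ (trivializationAt (EuclideanSpace ℝ (Fin n))
      (TangentSpace (𝓡 n) : M → Type _) x).baseSet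
  · exact ⟨_, fun b => dif_pos hy⟩
  · exact ⟨_, fun b => dif_neg hy⟩

@[simp] theorem frameExt_self {x : M} (b : Frame n x) : frameExt b x = b := by
  classical
  have hx := FiberBundle.mem_baseSet_trivializationAt' (F := EuclideanSpace ℝ (Fin n))
    (E := (TangentSpace (𝓡 n) : M → Type _)) x
  simp only [frameExt, hx, dif_pos]
  ext i
  simp

/-- Both extensions use the chart at the same point `x`, so the transition matrix is constant. A
change of frame at `x` therefore produces no derivative terms there. -/
theorem frameExt_toMatrix {x : M} (b b' : Frame n x) (y : M) :
    (frameExt b y).toMatrix (frameExt b' y) = b.toMatrix b' := by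
  obtain ⟨L, hL⟩ := exists_frameExt_eq_map (n := n) x y
  rw [hL, hL]
  ext i j
  simp [Basis.toMatrix_apply]

theorem basis_apply_eq_sum {x : M} (b b' : Frame n x) (j : Fin n) :
    b' j = ∑ i, b.toMatrix b' i j • b i := by
  simp

/-- The basis of the model space which induces the local frame `frameExt b`. -/
def modelBasis {x : M} (b : Frame n x) : Basis (Fin n) ℝ (EuclideanSpace ℝ (Fin n)) :=
  b.map ((trivializationAt (EuclideanSpace ℝ (Fin n))
    (TangentSpace (𝓡 n) : M → Type _) x).linearEquivAt ℝ x
      (FiberBundle.mem_baseSet_trivializationAt' x))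

/-- On the chart domain the frame is the local frame induced by a trivialization, so the smoothness
statements for such frames and their coefficients apply. -/
theorem frameExt_eq_basisAt {x : M} (b : Frame n x) {y : M}
    (hy : y ∈ (trivializationAt (EuclideanSpace ℝ (Fin n))
      (TangentSpace (𝓡 n) : M → Type _) x).baseSet) :
    frameExt b y = (trivializationAt (EuclideanSpace ℝ (Fin n))
      (TangentSpace (𝓡 n) : M → Type _) x).basisAt (modelBasis b) hy := by
  classical
  simp only [frameExt, hy, dif_pos]
  ext i
  simp [Bundle.Trivialization.basisAt, modelBasis]

theorem frameExt_contMDiffAt {x : M} (b : Frame n x) {y : M}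
    (hy : y ∈ (chartAt (EuclideanSpace ℝ (Fin n)) x).source) (j : Fin n) :
    ContMDiffAt (𝓡 n) (𝓡 n).tangent ∞ (T% fun z => frameExt b z j) y := by
  have h := contMDiffAt_localFrame_of_mem (I := 𝓡 n) ∞ (trivializationAt (EuclideanSpace ℝ (Fin n))
      (TangentSpace (𝓡 n) : M → Type _) x) (modelBasis b) j hy
  refine h.congr_of_eventuallyEq ?_
  filter_upwards [(chartAt (EuclideanSpace ℝ (Fin n)) x).open_source.mem_nhds hy] with z hz
  have hz' : z ∈ (trivializationAt (EuclideanSpace ℝ (Fin n))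
      (TangentSpace (𝓡 n) : M → Type _) x).baseSet := hz
  simp only [frameExt_eq_basisAt b hz']
  exact congrArg _ (Bundle.Trivialization.localFrame_apply_of_mem_baseSet _ _ hz').symm

theorem chart_source_mem {x y : M} (hy : y ∈ (chartAt (EuclideanSpace ℝ (Fin n)) x).source) :
    ∀ᶠ z in 𝓝 y, z ∈ (chartAt (EuclideanSpace ℝ (Fin n)) x).source :=
  (chartAt (EuclideanSpace ℝ (Fin n)) x).open_source.mem_nhds hy

theorem smV_frameExt {x : M} (b : Frame n x) {y : M}
    (hy : y ∈ (chartAt (EuclideanSpace ℝ (Fin n)) x).source) (j : Fin n) :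
    SmV (fun z => frameExt b z j) y :=
  (chart_source_mem hy).mono fun _ hz => frameExt_contMDiffAt b hz j

variable {x y : M} {X Y Z : ∀ x : M, TangentSpace (𝓡 n) x} {f g : M → ℝ}

/-- Smoothness on a neighbourhood, rather than at the point alone, lets an identity of fields be
proved near `x` and then differentiated again. -/
theorem SmV.eventually (h : SmV Y x) : ∀ᶠ z in 𝓝 x, SmV Y z := h.eventually_nhds
theorem SmF.eventually (h : SmF n f x) : ∀ᶠ z in 𝓝 x, SmF n f z := h.eventually_nhds
theorem SmV.contMDiffAt (h : SmV Y x) : ContMDiffAt (𝓡 n) (𝓡 n).tangent ∞ (T% Y) x :=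
  h.self_of_nhds
theorem SmF.contMDiffAt (h : SmF n f x) : ContMDiffAt (𝓡 n) 𝓘(ℝ, ℝ) ∞ f x :=
  h.self_of_nhds
theorem SmV.mdiff (h : SmV Y x) : MDifferentiableAt (𝓡 n) (𝓡 n).tangent (T% Y) x :=
  h.self_of_nhds.mdifferentiableAt (by simp)
theorem SmF.mdiff (h : SmF n f x) : MDifferentiableAt (𝓡 n) 𝓘(ℝ, ℝ) f x :=
  h.self_of_nhds.mdifferentiableAt (by simp)

theorem SmF.congr (h : SmF n f x) (hg : g =ᶠ[𝓝 x] f) : SmF n g x := by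
  filter_upwards [h, hg.eventuallyEq_nhds] with z hz hz'
  exact hz.congr_of_eventuallyEq hz'

theorem SmV.congr (h : SmV X x) (hg : ∀ᶠ z in 𝓝 x, Y z = X z) : SmV Y x := by
  filter_upwards [h, hg.eventually_nhds] with z hz hz'
  exact hz.congr_of_eventuallyEq (hz'.mono fun w hw => by simp [hw])

theorem smF_const (c : ℝ) : SmF n (fun _ : M => c) x :=
  Eventually.of_forall fun _ => contMDiffAt_const

theorem SmF.add (hf : SmF n f x) (hg : SmF n g x) :
    SmF n (fun z => f z + g z) x := by
  filter_upwards [hf, hg] with z h1 h2 using h1.add h2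

theorem SmF.sub (hf : SmF n f x) (hg : SmF n g x) :
    SmF n (fun z => f z - g z) x := by
  filter_upwards [hf, hg] with z h1 h2 using h1.sub h2

theorem SmF.neg (hf : SmF n f x) : SmF n (fun z => - f z) x := by
  filter_upwards [hf] with z h1 using h1.neg

theorem SmF.mul (hf : SmF n f x) (hg : SmF n g x) :
    SmF n (fun z => f z * g z) x := by
  filter_upwards [hf, hg] with z h1 h2 using h1.mul h2

theorem SmF.sum {ι : Type*} {s : Finset ι} {f : ι → M → ℝ}
    (hf : ∀ i ∈ s, SmF n (f i) x) : SmF n (fun z => ∑ i ∈ s, f i z) x := by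
  have := (eventually_all_finset s).2 hf
  filter_upwards [this] with z hz
  exact contMDiffAt_finsetSum hz

theorem SmV.add (hX : SmV X x) (hY : SmV Y x) : SmV (fun z => X z + Y z) x := by
  filter_upwards [hX, hY] with z h1 h2 using h1.add_section h2

theorem SmV.sub (hX : SmV X x) (hY : SmV Y x) : SmV (fun z => X z - Y z) x := by
  filter_upwards [hX, hY] with z h1 h2 using h1.sub_section h2

theorem SmV.smul (hf : SmF n f x) (hY : SmV Y x) : SmV (fun z => f z • Y z) x := by
  filter_upwards [hf, hY] with z h1 h2 using h1.smul_section h2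

theorem SmV.sum {ι : Type*} {s : Finset ι} {V : ι → ∀ x : M, TangentSpace (𝓡 n) x}
    (hf : ∀ i ∈ s, SmV (V i) x) : SmV (fun z => ∑ i ∈ s, V i z) x := by
  have := (eventually_all_finset s).2 hf
  filter_upwards [this] with z hz
  exact ContMDiffAt.sum_section hz

theorem SmV.repr (hY : SmV Y y) (b : Frame n x)
    (hy : y ∈ (chartAt (EuclideanSpace ℝ (Fin n)) x).source) (i : Fin n) :
    SmF n (fun z => (frameExt b z).repr (Y z) i) y := by
  filter_upwards [hY, chart_source_mem hy] with z h1 hz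
  have := contMDiffAt_localFrameCoeff (e := trivializationAt (EuclideanSpace ℝ (Fin n))
      (TangentSpace (𝓡 n) : M → Type _) x) (modelBasis b) hz h1 i
  refine this.congr_of_eventuallyEq ?_
  filter_upwards [chart_source_mem hz] with w hw
  have hw' : w ∈ (trivializationAt (EuclideanSpace ℝ (Fin n))
      (TangentSpace (𝓡 n) : M → Type _) x).baseSet := hw
  simp only [frameExt_eq_basisAt b hw']
  exact (Bundle.Trivialization.localFrameCoeff_apply_of_mem_baseSet _ _ hw' Y i).symm

/-- Every tangent vector extends to a vector field that is smooth near its base point. -/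
theorem exists_smV (x : M) (v : TangentSpace (𝓡 n) x) : ∃ X, SmV X x ∧ X x = v := by
  let b : Frame n x := (EuclideanSpace.basisFun (Fin n) ℝ).toBasis
  refine ⟨fun y => ∑ i, b.repr v i • frameExt b y i, ?_, ?_⟩
  · exact SmV.sum fun i _ => SmV.smul (smF_const _) (smV_frameExt b (mem_chart_source _ x) i)
  · simp [Basis.sum_repr]

end Frames

/-! ### Covariant derivatives of locally smooth vector fields. -/

section Cov

variable {n : ℕ} {M : Type*} [TopologicalSpace M] [ChartedSpace (EuclideanSpace ℝ (Fin n)) M]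
  [IsManifold (𝓡 n) ∞ M] {x y : M} {X Y Z : ∀ x : M, TangentSpace (𝓡 n) x} {f g : M → ℝ}
  (D : AffineConnection n M)

/-- Smoothness of a connection is tested on globally smooth fields. The field is cut off by a bump
function equal to one near `z`, and locality of the covariant derivative gives the result for the
original field. -/
theorem SmV.cov [T2Space M] (hY : SmV Y x) (hX : SmV X x) :
    SmV (fun y => D.toCov Y y (X y)) x := by
  suffices h : ∀ z, SmV Y z → SmV X z →
      ContMDiffAt (𝓡 n) (𝓡 n).tangent ∞ (T% fun y => D.toCov Y y (X y)) z by
    filter_upwards [hY.eventually, hX.eventually] with z h1 h2 using h z h1 h2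
  intro z hY hX
  obtain ⟨U, hU, hUo, hzU⟩ := eventually_nhds_iff.1 hY
  obtain ⟨φ, -, hφ⟩ := (SmoothBumpFunction.nhds_basis_tsupport (I := 𝓡 n) z).mem_iff.1
    (hUo.mem_nhds hzU)
  have hs : ContMDiff (𝓡 n) (𝓡 n).tangent ∞ (T% ((φ : M → ℝ) • Y)) := by
    refine ContMDiffOn.smul_section_of_tsupport φ.contMDiff.contMDiffOn hUo hφ ?_
    exact fun w hw => (hU w hw).contMDiffWithinAt
  have hc := D.smooth.contMDiff.contMDiff (σ := (φ : M → ℝ) • Y) hs.contMDiffOn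
  have hc' := (hc.contMDiffAt (x := z) univ_mem).clm_bundle_apply hX.contMDiffAt
  refine hc'.congr_of_eventuallyEq ?_
  filter_upwards [φ.eventuallyEq_one.eventuallyEq_nhds, hUo.mem_nhds hzU] with w hw hwU
  have : D.toCov Y w = D.toCov ((φ : M → ℝ) • Y) w := by
    refine D.toCov.isCovariantDerivativeOnUniv.congr_of_eventuallyEq
      ((hU w hwU).mdifferentiableAt (by simp)) (hs.mdifferentiableAt (by simp)) univ_mem ?_
    filter_upwards [hw] with u hu
    simp [hu]
  simp [this]

theorem cov_congr (hY : SmV Y x) (hZ : SmV Z x) (h : ∀ᶠ z in 𝓝 x, Y z = Z z) :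
    D.toCov Y x = D.toCov Z x :=
  D.toCov.isCovariantDerivativeOnUniv.congr_of_eventuallyEq hY.mdiff hZ.mdiff univ_mem h

theorem cov_add (hY : SmV Y x) (hZ : SmV Z x) :
    D.toCov (fun z => Y z + Z z) x = D.toCov Y x + D.toCov Z x :=
  D.toCov.isCovariantDerivativeOnUniv.add hY.mdiff hZ.mdiff

theorem cov_smul (hf : SmF n f x) (hY : SmV Y x) (v : TangentSpace (𝓡 n) x) :
    D.toCov (fun z => f z • Y z) x v = f x • D.toCov Y x v + mvfderiv (𝓡 n) f x v • Y x := by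
  have := D.toCov.isCovariantDerivativeOnUniv.leibniz hY.mdiff hf.mdiff (hx := trivial)
  exact congrArg (fun T => T v) this

theorem cov_zero : D.toCov (fun z => (0 : TangentSpace (𝓡 n) z)) x = 0 :=
  congrFun D.toCov.zero x

theorem cov_sum {ι : Type*} (s : Finset ι) {V : ι → ∀ x : M, TangentSpace (𝓡 n) x}
    (hV : ∀ i ∈ s, SmV (V i) x) :
    D.toCov (fun z => ∑ i ∈ s, V i z) x = ∑ i ∈ s, D.toCov (V i) x := by
  classical
  induction s using Finset.induction_on with
  | empty => simpa using cov_zero D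
  | insert a s ha ih =>
    simp only [Finset.sum_insert ha]
    rw [cov_add D (hV a (by simp)) (SmV.sum fun i hi => hV i (by simp [hi])),
      ih fun i hi => hV i (by simp [hi])]

theorem cov_sub (hY : SmV Y x) (hZ : SmV Z x) :
    D.toCov (fun z => Y z - Z z) x = D.toCov Y x - D.toCov Z x := by
  have h := cov_add D (hY.sub hZ) hZ
  simp only [sub_add_cancel] at h
  rw [← sub_eq_iff_eq_add] at h
  exact h.symm

theorem mlieBracket_eq (hX : SmV X x) (hY : SmV Y x) :
    mlieBracket (𝓡 n) X Y x = D.toCov Y x (X x) - D.toCov X x (Y x) :=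
  haveI : IsManifold (𝓡 n) 2 M := inferInstance
  (D.toCov.torsion_eq_zero_iff.1 D.torsionFree hX.mdiff hY.mdiff).symm

end Cov

/-! ### Directional derivatives of functions and Lie brackets. -/

section Derivations

variable {n : ℕ} {M : Type*} [TopologicalSpace M] [ChartedSpace (EuclideanSpace ℝ (Fin n)) M]
  [IsManifold (𝓡 n) ∞ M] {x y : M} {X Y Z : ∀ x : M, TangentSpace (𝓡 n) x} {f g : M → ℝ}

theorem mvfderiv_congr (h : f =ᶠ[𝓝 x] g) : mvfderiv (𝓡 n) f x = mvfderiv (𝓡 n) g x := by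
  have := h.mfderiv_eq (I := 𝓡 n) (I' := 𝓘(ℝ, ℝ))
  ext v
  exact congrArg (fun T : TangentSpace (𝓡 n) x →L[ℝ] ℝ => T v) this

theorem mvfderiv_sum_apply {ι : Type*} (s : Finset ι) {f : ι → M → ℝ}
    (hf : ∀ i ∈ s, MDifferentiableAt (𝓡 n) 𝓘(ℝ, ℝ) (f i) x) (v : TangentSpace (𝓡 n) x) :
    mvfderiv (𝓡 n) (fun z => ∑ i ∈ s, f i z) x v = ∑ i ∈ s, mvfderiv (𝓡 n) (f i) x v := by
  classical
  have hd : ∀ t ⊆ s, MDifferentiableAt (𝓡 n) 𝓘(ℝ, ℝ) (fun z => ∑ i ∈ t, f i z) x := by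
    intro t
    induction t using Finset.induction_on with
    | empty => intro _; simpa using mdifferentiableAt_const
    | insert a t ha ih =>
      intro hs
      simp only [Finset.sum_insert ha]
      exact (hf a (hs (by simp))).add (ih fun i hi => hs (by simp [hi]))
  induction s using Finset.induction_on with
  | empty => simp [mvfderiv_const]
  | insert a s ha ih =>
    simp only [Finset.sum_insert ha]
    rw [mvfderiv_fun_add (hf a (by simp)) (hd s (by simp)), _root_.add_apply,
      ih (fun i hi => hf i (by simp [hi])) fun t ht => hd t (ht.trans (by simp))]

theorem mvfderiv_mul_apply (hf : MDifferentiableAt (𝓡 n) 𝓘(ℝ, ℝ) f x)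
    (hg : MDifferentiableAt (𝓡 n) 𝓘(ℝ, ℝ) g x) (v : TangentSpace (𝓡 n) x) :
    mvfderiv (𝓡 n) (fun z => f z * g z) x v
      = mvfderiv (𝓡 n) f x v * g x + f x * mvfderiv (𝓡 n) g x v := by
  rw [mvfderiv_fun_mul hf hg]
  simp
  ring

theorem mvfderiv_add_apply (hf : MDifferentiableAt (𝓡 n) 𝓘(ℝ, ℝ) f x)
    (hg : MDifferentiableAt (𝓡 n) 𝓘(ℝ, ℝ) g x) (v : TangentSpace (𝓡 n) x) :
    mvfderiv (𝓡 n) (fun z => f z + g z) x v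
      = mvfderiv (𝓡 n) f x v + mvfderiv (𝓡 n) g x v := by
  rw [mvfderiv_fun_add hf hg]
  simp

theorem mvfderiv_neg_apply (v : TangentSpace (𝓡 n) x) :
    mvfderiv (𝓡 n) (fun z => - f z) x v = - mvfderiv (𝓡 n) f x v := by
  rw [mvfderiv_fun_neg]
  simp

/-- By the Leibniz rule `(X f) e_j = ∇_X (f e_j) - f ∇_X e_j`, and the right side is smooth by
`SmV.cov`. With no index `j` available the manifold has dimension zero and `X = 0`. -/
theorem SmF.mvfderiv [T2Space M] (D : AffineConnection n M) (hf : SmF n f x) (hX : SmV X x) :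
    SmF n (fun y => mvfderiv (𝓡 n) f y (X y)) x := by
  rcases isEmpty_or_nonempty (Fin n) with h | ⟨⟨j⟩⟩
  · have : ∀ y, X y = 0 := fun y =>
      (Subsingleton.elim (α := EuclideanSpace ℝ (Fin n)) (X y) 0)
    simpa [this] using smF_const 0
  · let b : Frame n x := (EuclideanSpace.basisFun (Fin n) ℝ).toBasis
    have hx := mem_chart_source (EuclideanSpace ℝ (Fin n)) x
    have he := smV_frameExt b hx j
    have h1 := ((((he.smul hf).cov D hX).sub ((he.cov D hX).smul hf)).repr b hx j)
    refine h1.congr ?_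
    filter_upwards [hf.eventually, he.eventually] with z hfz hez
    rw [cov_smul D hfz hez]
    simp

theorem SmV.mlieBracket [T2Space M] (D : AffineConnection n M) (hX : SmV X x) (hY : SmV Y x) :
    SmV (mlieBracket (𝓡 n) X Y) x :=
  ((hY.cov D hX).sub (hX.cov D hY)).congr (by
    filter_upwards [hX.eventually, hY.eventually] with z h1 h2 using mlieBracket_eq D h1 h2)

theorem mlieBracket_jacobi (hX : SmV X x) (hY : SmV Y x) (hZ : SmV Z x) :
    mlieBracket (𝓡 n) X (mlieBracket (𝓡 n) Y Z) x =
      mlieBracket (𝓡 n) (mlieBracket (𝓡 n) X Y) Z x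
        + mlieBracket (𝓡 n) Y (mlieBracket (𝓡 n) X Z) x := by
  have : IsManifold (𝓡 n) (minSmoothness ℝ 3) M := by
    simp only [minSmoothness_of_isRCLikeNormedField]; infer_instance
  have hm : ∀ {W : ∀ x : M, TangentSpace (𝓡 n) x}, SmV W x →
      ContMDiffAt (𝓡 n) (𝓡 n).tangent (minSmoothness ℝ 2) (T% W) x := fun h =>
    h.contMDiffAt.of_le (by
      simp only [minSmoothness_of_isRCLikeNormedField]; exact ENat.LEInfty.out)
  exact leibniz_identity_mlieBracket_apply (hm hX) (hm hY) (hm hZ)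

/-- The Jacobi identity for `X, Y, fZ` minus `f` times the one for `X, Y, Z` leaves exactly the
claimed identity as the coefficient of `Z`. A frame field serves as `Z`, since it does not vanish at
`x`. -/
theorem mvfderiv_comm [T2Space M] (D : AffineConnection n M) (hf : SmF n f x) (hX : SmV X x)
    (hY : SmV Y x) :
    mvfderiv (𝓡 n) (fun y => mvfderiv (𝓡 n) f y (Y y)) x (X x)
      - mvfderiv (𝓡 n) (fun y => mvfderiv (𝓡 n) f y (X y)) x (Y x)
      = mvfderiv (𝓡 n) f x (mlieBracket (𝓡 n) X Y x) := by
  rcases isEmpty_or_nonempty (Fin n) with h | ⟨⟨j⟩⟩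
  · have : ∀ X : ∀ x : M, TangentSpace (𝓡 n) x, ∀ y, X y = 0 := fun X y =>
      (Subsingleton.elim (α := EuclideanSpace ℝ (Fin n)) (X y) 0)
    simp [this X, this Y, this (mlieBracket (𝓡 n) X Y)]
  · let b : Frame n x := (EuclideanSpace.basisFun (Fin n) ℝ).toBasis
    have hx := mem_chart_source (EuclideanSpace ℝ (Fin n)) x
    have hZ := smV_frameExt b hx j
    set Z : ∀ x : M, TangentSpace (𝓡 n) x := fun y => frameExt b y j
    have key : ∀ {V W : ∀ x : M, TangentSpace (𝓡 n) x}, SmV V x → SmV W x →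
        mlieBracket (𝓡 n) V (mlieBracket (𝓡 n) W (f • Z)) x =
          mvfderiv (𝓡 n) f x (W x) • mlieBracket (𝓡 n) V Z x
          + mvfderiv (𝓡 n) (fun y => mvfderiv (𝓡 n) f y (W y)) x (V x) • Z x
          + (mvfderiv (𝓡 n) f x (V x) • mlieBracket (𝓡 n) W Z x
          + f x • mlieBracket (𝓡 n) V (mlieBracket (𝓡 n) W Z) x) := by
      intro V W hV hW
      have h1 : mlieBracket (𝓡 n) W (f • Z) =ᶠ[𝓝 x]
          ((fun y => mvfderiv (𝓡 n) f y (W y)) • Z + f • mlieBracket (𝓡 n) W Z) := by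
        filter_upwards [hf.eventually, hZ.eventually] with z h1 h2
        exact mlieBracket_smul_right h1.mdiff h2.mdiff
      have h2 : mlieBracket (𝓡 n) V ((fun y => mvfderiv (𝓡 n) f y (W y)) • Z
          + f • mlieBracket (𝓡 n) W Z) x = _ :=
        mlieBracket_add_right (hZ.smul (hf.mvfderiv D hW)).mdiff ((hW.mlieBracket D hZ).smul hf).mdiff
      rw [(EventuallyEq.refl _ V).mlieBracket_vectorField_eq h1, h2]
      have h3 : mlieBracket (𝓡 n) V (f • mlieBracket (𝓡 n) W Z) x = _ :=
        mlieBracket_smul_right hf.mdiff (hW.mlieBracket D hZ).mdiff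
      have h4 : mlieBracket (𝓡 n) V ((fun y => mvfderiv (𝓡 n) f y (W y)) • Z) x = _ :=
        mlieBracket_smul_right (hf.mvfderiv D hW).mdiff hZ.mdiff
      rw [h3, h4]
      abel
    have hJ1 := mlieBracket_jacobi hX hY (hZ.smul hf)
    have hJ2 := mlieBracket_jacobi hX hY hZ
    change mlieBracket (𝓡 n) X (mlieBracket (𝓡 n) Y (f • Z)) x =
      mlieBracket (𝓡 n) (mlieBracket (𝓡 n) X Y) (f • Z) x
      + mlieBracket (𝓡 n) Y (mlieBracket (𝓡 n) X (f • Z)) x at hJ1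
    rw [key hX hY, key hY hX, mlieBracket_smul_right hf.mdiff hZ.mdiff, hJ2] at hJ1
    have h2 : (mvfderiv (𝓡 n) (fun y => mvfderiv (𝓡 n) f y (Y y)) x (X x)
      - mvfderiv (𝓡 n) (fun y => mvfderiv (𝓡 n) f y (X y)) x (Y x)
      - mvfderiv (𝓡 n) f x (mlieBracket (𝓡 n) X Y x)) • Z x = 0 := by
      rw [← sub_eq_zero] at hJ1
      rw [← hJ1]
      module
    have h3 : Z x ≠ 0 := (frameExt b x).ne_zero j
    have := (smul_eq_zero.1 h2).resolve_right h3
    linarith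

end Derivations

/-! ### Tensoriality of the curvature and the first Bianchi identity. -/

section Curvature

variable {n : ℕ} {M : Type*} [TopologicalSpace M] [ChartedSpace (EuclideanSpace ℝ (Fin n)) M]
  [IsManifold (𝓡 n) ∞ M] [T2Space M] {x y : M} {X X' Y Y' Z Z' : ∀ x : M, TangentSpace (𝓡 n) x}
  {f g : M → ℝ} (D : AffineConnection n M)

/-- The curvature `R(X,Y)Z` at `x`. -/
def Rm (X Y Z : ∀ x : M, TangentSpace (𝓡 n) x) (x : M) : TangentSpace (𝓡 n) x :=
  D.toCov (fun y => D.toCov Z y (Y y)) x (X x) - D.toCov (fun y => D.toCov Z y (X y)) x (Y x)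
    - D.toCov Z x (mlieBracket (𝓡 n) X Y x)

theorem SmV.Rm (hX : SmV X x) (hY : SmV Y x) (hZ : SmV Z x) : SmV (Rm D X Y Z) x :=
  (((hZ.cov D hY).cov D hX).sub ((hZ.cov D hX).cov D hY)).sub (hZ.cov D (hX.mlieBracket D hY))

theorem Rm_swap : Rm D X Y Z x = - Rm D Y X Z x := by
  simp only [Rm, mlieBracket_swap_apply (V := Y) (W := X), map_neg]
  abel

theorem Rm_add_left (hX : SmV X x) (hX' : SmV X' x) (hZ : SmV Z x) :
    Rm D (fun z => X z + X' z) Y Z x = Rm D X Y Z x + Rm D X' Y Z x := by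
  have h1 : mlieBracket (𝓡 n) (fun z => X z + X' z) Y x = _ :=
    mlieBracket_add_left hX.mdiff hX'.mdiff
  simp only [Rm, h1, map_add]
  rw [cov_add D (hZ.cov D hX) (hZ.cov D hX')]
  simp only [_root_.add_apply]
  abel

theorem Rm_smul_left (hf : SmF n f x) (hX : SmV X x) (hZ : SmV Z x) :
    Rm D (fun z => f z • X z) Y Z x = f x • Rm D X Y Z x := by
  have h1 : mlieBracket (𝓡 n) (fun z => f z • X z) Y x = _ :=
    mlieBracket_smul_left hf.mdiff hX.mdiff
  simp only [Rm, h1, map_add, map_smul]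
  rw [cov_smul D hf (hZ.cov D hX)]
  module

theorem Rm_add_right (hX : SmV X x) (hY : SmV Y x) (hZ : SmV Z x) (hZ' : SmV Z' x) :
    Rm D X Y (fun z => Z z + Z' z) x = Rm D X Y Z x + Rm D X Y Z' x := by
  have h : ∀ {W : ∀ x : M, TangentSpace (𝓡 n) x}, SmV W x →
      D.toCov (fun y => D.toCov (fun z => Z z + Z' z) y (W y)) x =
      D.toCov (fun y => D.toCov Z y (W y)) x + D.toCov (fun y => D.toCov Z' y (W y)) x := by
    intro W hW
    rw [← cov_add D (hZ.cov D hW) (hZ'.cov D hW)]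
    refine cov_congr D ((hZ.add hZ').cov D hW) ((hZ.cov D hW).add (hZ'.cov D hW)) ?_
    filter_upwards [hZ.eventually, hZ'.eventually] with z h1 h2
    rw [cov_add D h1 h2, _root_.add_apply]
  simp only [Rm]
  rw [h hX, h hY, cov_add D hZ hZ']
  simp only [_root_.add_apply]
  abel

/-- The first derivatives of `f` cancel by symmetry in `X, Y`. The second derivatives combine to
`XYf - YXf`, which the bracket term removes by `mvfderiv_comm`. -/
theorem Rm_smul_right (hf : SmF n f x) (hX : SmV X x) (hY : SmV Y x) (hZ : SmV Z x) :
    Rm D X Y (fun z => f z • Z z) x = f x • Rm D X Y Z x := by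
  have h : ∀ {W : ∀ x : M, TangentSpace (𝓡 n) x}, SmV W x → ∀ v,
      D.toCov (fun y => D.toCov (fun z => f z • Z z) y (W y)) x v =
      f x • D.toCov (fun y => D.toCov Z y (W y)) x v + mvfderiv (𝓡 n) f x v • D.toCov Z x (W x)
      + (mvfderiv (𝓡 n) f x (W x) • D.toCov Z x v
        + mvfderiv (𝓡 n) (fun y => mvfderiv (𝓡 n) f y (W y)) x v • Z x) := by
    intro W hW v
    rw [← cov_smul D hf (hZ.cov D hW), ← cov_smul D (hf.mvfderiv D hW) hZ, ← _root_.add_apply,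
      ← cov_add D ((hZ.cov D hW).smul hf) (hZ.smul (hf.mvfderiv D hW))]
    refine congrArg (fun T => T v) (cov_congr D ((hZ.smul hf).cov D hW)
      (((hZ.cov D hW).smul hf).add (hZ.smul (hf.mvfderiv D hW))) ?_)
    filter_upwards [hZ.eventually, hf.eventually] with z h1 h2
    rw [cov_smul D h2 h1]
  simp only [Rm]
  rw [h hX, h hY, cov_smul D hf hZ, ← mvfderiv_comm D hf hX hY]
  module

theorem Rm_sum_left {ι : Type*} (s : Finset ι) {a : ι → M → ℝ}
    {V : ι → ∀ x : M, TangentSpace (𝓡 n) x} (ha : ∀ i, SmF n (a i) x) (hV : ∀ i, SmV (V i) x)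
    (hZ : SmV Z x) :
    Rm D (fun z => ∑ i ∈ s, a i z • V i z) Y Z x = ∑ i ∈ s, a i x • Rm D (V i) Y Z x := by
  classical
  induction s using Finset.induction_on with
  | empty =>
    simp only [Finset.sum_empty]
    have := Rm_smul_left D (Y := Y) (smF_const (n := n) 0) (hZ : SmV Z x) hZ
    simpa using this
  | insert i s hi ih =>
    simp only [Finset.sum_insert hi]
    rw [Rm_add_left D ((hV i).smul (ha i)) (SmV.sum fun i _ => (hV i).smul (ha i)) hZ, ih,
      Rm_smul_left D (ha i) (hV i) hZ]

theorem Rm_sum_middle {ι : Type*} (s : Finset ι) {a : ι → M → ℝ}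
    {V : ι → ∀ x : M, TangentSpace (𝓡 n) x} (ha : ∀ i, SmF n (a i) x) (hV : ∀ i, SmV (V i) x)
    (hZ : SmV Z x) :
    Rm D X (fun z => ∑ i ∈ s, a i z • V i z) Z x = ∑ i ∈ s, a i x • Rm D X (V i) Z x := by
  rw [Rm_swap, Rm_sum_left D s ha hV hZ, ← Finset.sum_neg_distrib]
  exact Finset.sum_congr rfl fun i _ => by rw [Rm_swap D (X := X), smul_neg]

theorem Rm_sum_right {ι : Type*} (s : Finset ι) {a : ι → M → ℝ}
    {V : ι → ∀ x : M, TangentSpace (𝓡 n) x} (ha : ∀ i, SmF n (a i) x) (hV : ∀ i, SmV (V i) x)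
    (hX : SmV X x) (hY : SmV Y x) :
    Rm D X Y (fun z => ∑ i ∈ s, a i z • V i z) x = ∑ i ∈ s, a i x • Rm D X Y (V i) x := by
  classical
  induction s using Finset.induction_on with
  | empty =>
    simp only [Finset.sum_empty]
    have := Rm_smul_right D (smF_const (n := n) 0) hX hY hX
    simpa using this
  | insert i s hi ih =>
    simp only [Finset.sum_insert hi]
    rw [Rm_add_right D hX hY ((hV i).smul (ha i)) (SmV.sum fun i _ => (hV i).smul (ha i)), ih,
      Rm_smul_right D (ha i) hX hY (hV i)]

/-- The first Bianchi identity. -/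
theorem Rm_bianchi (hX : SmV X x) (hY : SmV Y x) (hZ : SmV Z x) :
    Rm D X Y Z x + Rm D Y Z X x + Rm D Z X Y x = 0 := by
  -- Vanishing torsion, used for both brackets, writes a double bracket in second covariant
  -- derivatives. The Jacobi identity then becomes the cyclic sum of curvatures.
  have key : ∀ {X Y Z : ∀ x : M, TangentSpace (𝓡 n) x}, SmV X x → SmV Y x → SmV Z x →
      mlieBracket (𝓡 n) X (mlieBracket (𝓡 n) Y Z) x =
        D.toCov (fun y => D.toCov Z y (Y y)) x (X x) - D.toCov (fun y => D.toCov Y y (Z y)) x (X x)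
        - D.toCov X x (mlieBracket (𝓡 n) Y Z x) := by
    intro X Y Z hX hY hZ
    rw [mlieBracket_eq D hX (hY.mlieBracket D hZ), ← _root_.sub_apply,
      ← cov_sub D (hZ.cov D hY) (hY.cov D hZ)]
    congr 2
    refine cov_congr D (hY.mlieBracket D hZ) ((hZ.cov D hY).sub (hY.cov D hZ)) ?_
    filter_upwards [hY.eventually, hZ.eventually] with z h1 h2 using mlieBracket_eq D h1 h2
  have hJ := mlieBracket_jacobi hX hY hZ
  have h1 := key hX hY hZ
  have h2 := key hY hZ hX
  have h3 := key hZ hX hY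
  have h4 : mlieBracket (𝓡 n) (mlieBracket (𝓡 n) X Y) Z x
      = - mlieBracket (𝓡 n) Z (mlieBracket (𝓡 n) X Y) x := mlieBracket_swap_apply
  have h5 : mlieBracket (𝓡 n) Y (mlieBracket (𝓡 n) X Z) x
      = - mlieBracket (𝓡 n) Y (mlieBracket (𝓡 n) Z X) x := by
    rw [mlieBracket_swap (V := X), ← neg_one_smul ℝ, mlieBracket_const_smul_right
      (hZ.mlieBracket D hX).mdiff, neg_one_smul]
  rw [h4, h5, h1, h2, h3] at hJ
  simp only [Rm]
  rw [← sub_eq_zero] at hJ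
  rw [← hJ]
  abel

end Curvature

/-! ### Projective changes of connection and of curvature. -/

section ProjectiveChange

variable {n : ℕ} {M : Type*} [TopologicalSpace M] [ChartedSpace (EuclideanSpace ℝ (Fin n)) M]
  [IsManifold (𝓡 n) ∞ M] {x y : M} {X X' Y Y' Z Z' : ∀ x : M, TangentSpace (𝓡 n) x}
  {f g : M → ℝ} {D D' D'' : AffineConnection n M}
  {Υ Υ' : ∀ x : M, TangentSpace (𝓡 n) x →L[ℝ] ℝ}

theorem IsProjectiveChange.cov_eq (h : IsProjectiveChange D D' Υ) (hY : SmV Y x)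
    (v : TangentSpace (𝓡 n) x) :
    D'.toCov Y x v = D.toCov Y x v + Υ x v • Y x + Υ x (Y x) • v :=
  h.2 Y x hY.mdiff v

theorem IsProjectiveChange.refl (D : AffineConnection n M) :
    IsProjectiveChange D D (fun _ => 0) :=
  ⟨fun _ _ => by simpa using contMDiff_const, fun Y x _ v => by simp⟩

theorem IsProjectiveChange.trans (h : IsProjectiveChange D D' Υ)
    (h' : IsProjectiveChange D' D'' Υ') : IsProjectiveChange D D'' (fun x => Υ x + Υ' x) := by
  refine ⟨fun Y hY => (h.1 Y hY).add (h'.1 Y hY), fun Y x hY v => ?_⟩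
  rw [h'.2 Y x hY v, h.2 Y x hY v]
  simp only [_root_.add_apply]
  module

/-- On the diagonal `v = Y(x)` the difference of the connections is `2 Υ(v) v`, which determines
`Υ(v)`. The transition matrices between tractor frames are thereby well defined. -/
theorem IsProjectiveChange.unique (h : IsProjectiveChange D D' Υ)
    (h' : IsProjectiveChange D D' Υ') : Υ x = Υ' x := by
  ext v
  rcases eq_or_ne v 0 with rfl | hv
  · simp
  obtain ⟨X, hX, rfl⟩ := exists_smV x v
  have h1 := h.cov_eq hX (X x)
  rw [h'.cov_eq hX (X x)] at h1
  have h2 : (2 * (Υ x (X x) - Υ' x (X x))) • X x = 0 := by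
    rw [← sub_eq_zero] at h1
    rw [← neg_eq_zero, ← h1]
    module
  have := (smul_eq_zero.1 h2).resolve_right hv
  linarith

/-- The `j`-th component of `∇'_{e_j} e_j - ∇_{e_j} e_j` is `2 Υ(e_j)`. This expresses `Υ` on local
frame fields through smooth data, without extending them to global fields. -/
theorem IsProjectiveChange.smF [T2Space M] (h : IsProjectiveChange D D' Υ) (hY : SmV Y x) :
    SmF n (fun y => Υ y (Y y)) x := by
  let b : Frame n x := (EuclideanSpace.basisFun (Fin n) ℝ).toBasis
  have hx := mem_chart_source (EuclideanSpace ℝ (Fin n)) x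
  have hj : ∀ j, SmF n (fun y => Υ y (frameExt b y j)) x := by
    intro j
    have he := smV_frameExt b hx j
    refine ((smF_const (1 / 2)).mul (((he.cov D' he).sub (he.cov D he)).repr b hx j)).congr ?_
    filter_upwards [he.eventually] with z hz
    rw [h.cov_eq hz]
    simp
    ring
  refine (SmF.sum (s := Finset.univ) fun j _ => (hY.repr b hx j).mul (hj j)).congr ?_
  refine Eventually.of_forall fun y => ?_
  change Υ y (Y y) = _
  rw [← congrArg (Υ y) ((frameExt b y).sum_repr (Y y)), map_sum]
  exact Finset.sum_congr rfl fun _ _ => by rw [map_smul, smul_eq_mul]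

/-- The tensor `Q` is `∇Υ - Υ ⊗ Υ`. The remaining first-order terms in `Y` and `X` cancel after `[X,
Y]` is written as `∇_X Y - ∇_Y X`. -/
theorem Rm_projectiveChange [T2Space M] (h : IsProjectiveChange D D' Υ) (hX : SmV X x)
    (hY : SmV Y x) (hZ : SmV Z x) {Q : (∀ x : M, TangentSpace (𝓡 n) x) →
      (∀ x : M, TangentSpace (𝓡 n) x) → ℝ}
    (hQ : ∀ X Z, Q X Z = mvfderiv (𝓡 n) (fun y => Υ y (Z y)) x (X x)
      - Υ x (D.toCov Z x (X x)) - Υ x (X x) * Υ x (Z x)) :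
    Rm D' X Y Z x = Rm D X Y Z x + Q X Z • Y x - Q Y Z • X x + (Q X Y - Q Y X) • Z x := by
  have key : ∀ {X Y : ∀ x : M, TangentSpace (𝓡 n) x}, SmV X x → SmV Y x →
      D'.toCov (fun y => D'.toCov Z y (Y y)) x (X x) =
        D.toCov (fun y => D.toCov Z y (Y y)) x (X x) + Υ x (X x) • D.toCov Z x (Y x)
        + Υ x (D.toCov Z x (Y x)) • X x
        + (Υ x (Y x) • (D.toCov Z x (X x) + Υ x (X x) • Z x + Υ x (Z x) • X x)
          + mvfderiv (𝓡 n) (fun y => Υ y (Y y)) x (X x) • Z x)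
        + (Υ x (Z x) • (D.toCov Y x (X x) + Υ x (X x) • Y x + Υ x (Y x) • X x)
          + mvfderiv (𝓡 n) (fun y => Υ y (Z y)) x (X x) • Y x) := by
    intro X Y hX hY
    have h1 := hZ.smul (h.smF hY)
    have h2 := hY.smul (h.smF hZ)
    rw [← h.cov_eq (hZ.cov D hY), ← h.cov_eq hZ, ← h.cov_eq hY, ← cov_smul D' (h.smF hY) hZ,
      ← cov_smul D' (h.smF hZ) hY, ← _root_.add_apply, ← cov_add D' (hZ.cov D hY) h1,
      ← _root_.add_apply, ← cov_add D' ((hZ.cov D hY).add h1) h2]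
    refine congrArg (fun T => T (X x)) (cov_congr D' (hZ.cov D' hY)
      (((hZ.cov D hY).add h1).add h2) ?_)
    filter_upwards [hZ.eventually] with z hz
    rw [h.cov_eq hz]
  simp only [Rm]
  rw [key hX hY, key hY hX, h.cov_eq hZ, mlieBracket_eq D hX hY]
  simp only [hQ, map_sub]
  module

end ProjectiveChange

/-! ### Curvature, Schouten tensor and connection matrices under changes of frame and connection. -/

section FrameChange

variable {n : ℕ} {M : Type*} [TopologicalSpace M] [ChartedSpace (EuclideanSpace ℝ (Fin n)) M]
  [IsManifold (𝓡 n) ∞ M] {x x' y : M}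

/-- Both frames extend smoothly to a neighbourhood of `y`. -/
theorem smF_toMatrix (b : Frame n x) (b' : Frame n x')
    (hy : y ∈ (chartAt (EuclideanSpace ℝ (Fin n)) x).source)
    (hy' : y ∈ (chartAt (EuclideanSpace ℝ (Fin n)) x').source) (i j : Fin n) :
    SmF n (fun z => (frameExt b z).toMatrix (frameExt b' z) i j) y :=
  (smV_frameExt b' hy' j).repr b hy i

theorem Rm_frame [T2Space M] (D : AffineConnection n M) (b : Frame n x) (b' : Frame n x')
    (hy : y ∈ (chartAt (EuclideanSpace ℝ (Fin n)) x).source)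
    (hy' : y ∈ (chartAt (EuclideanSpace ℝ (Fin n)) x').source) (i j l : Fin n) :
    Rm D (fun z => frameExt b' z i) (fun z => frameExt b' z j) (fun z => frameExt b' z l) y =
      ∑ c, (frameExt b y).toMatrix (frameExt b' y) c i •
      ∑ d, (frameExt b y).toMatrix (frameExt b' y) d j •
      ∑ e, (frameExt b y).toMatrix (frameExt b' y) e l •
      Rm D (fun z => frameExt b z c) (fun z => frameExt b z d) (fun z => frameExt b z e) y := by
  have hA := smF_toMatrix b b' hy hy'
  have he := smV_frameExt b hy
  have hsum : ∀ i, (fun z => frameExt b' z i) =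
      fun z => ∑ c, (frameExt b z).toMatrix (frameExt b' z) c i • frameExt b z c := fun i =>
    funext fun z => basis_apply_eq_sum _ _ _
  have hl : SmV (fun z => frameExt b' z l) y := smV_frameExt b' hy' l
  rw [hsum i, Rm_sum_left D _ (fun c => hA c i) he hl]
  refine Finset.sum_congr rfl fun c _ => ?_
  rw [hsum j, Rm_sum_middle D _ (fun c => hA c j) he hl]
  congr 1
  refine Finset.sum_congr rfl fun d _ => ?_
  rw [hsum l, Rm_sum_right D _ (fun c => hA c l) he (he c) (he d)]

theorem curvature_eq (D : AffineConnection n M) (b : Frame n x) (i j k l : Fin n) :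
    curvature D b i j k l = b.repr (Rm D (fun z => frameExt b z i) (fun z => frameExt b z j)
      (fun z => frameExt b z l) x) k := rfl

/-- By definition the left side uses the frame at `y` extended anew in the chart at `y`, while the
right side keeps the extension from `x`. The two agree at `y` only, which suffices because curvature
is tensorial. -/
theorem curvature_frameExt [T2Space M] (D : AffineConnection n M) (b : Frame n x)
    (hy : y ∈ (chartAt (EuclideanSpace ℝ (Fin n)) x).source) (i j k l : Fin n) :
    curvature D (frameExt b y) i j k l = (frameExt b y).repr (Rm D (fun z => frameExt b z i)
      (fun z => frameExt b z j) (fun z => frameExt b z l) y) k := by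
  rw [curvature_eq, Rm_frame D b (frameExt b y) hy (mem_chart_source _ y)]
  simp [Matrix.one_apply, ite_smul]

theorem smF_curvature [T2Space M] (D : AffineConnection n M) (b : Frame n x)
    (hy : y ∈ (chartAt (EuclideanSpace ℝ (Fin n)) x).source) (i j k l : Fin n) :
    SmF n (fun z => curvature D (frameExt b z) i j k l) y := by
  have he := smV_frameExt b hy
  refine (((he i).Rm D (he j) (he l)).repr b hy k).congr ?_
  filter_upwards [chart_source_mem hy] with z hz using curvature_frameExt D b hz i j k l

theorem smF_schouten [T2Space M] (D : AffineConnection n M) (b : Frame n x)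
    (hy : y ∈ (chartAt (EuclideanSpace ℝ (Fin n)) x).source) (i j : Fin n) :
    SmF n (fun z => schouten D (frameExt b z) i j) y := by
  have h : ∀ i j, SmF n (fun z => ricci D (frameExt b z) i j) y := fun i j =>
    SmF.sum fun k _ => smF_curvature D b hy k i k j
  simp only [schouten, div_eq_mul_inv]
  exact (((smF_const _).mul (h i j)).add (h j i)).mul (smF_const _)

theorem sum_reverse_four {ι : Type*} [Fintype ι] (f : ι → ι → ι → ι → ℝ) :
    ∑ i, ∑ c, ∑ d, ∑ e, f i c d e = ∑ e, ∑ d, ∑ c, ∑ i, f i c d e := by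
  have h3 : ∀ g : ι → ι → ι → ℝ, ∑ c, ∑ d, ∑ e, g c d e = ∑ e, ∑ d, ∑ c, g c d e := fun g =>
    calc ∑ c, ∑ d, ∑ e, g c d e = ∑ c, ∑ e, ∑ d, g c d e :=
          Finset.sum_congr rfl fun _ _ => Finset.sum_comm
      _ = ∑ e, ∑ c, ∑ d, g c d e := Finset.sum_comm
      _ = ∑ e, ∑ d, ∑ c, g c d e := Finset.sum_congr rfl fun _ _ => Finset.sum_comm
  rw [Finset.sum_congr rfl fun i _ => h3 (f i)]
  rw [Finset.sum_comm]
  refine Finset.sum_congr rfl fun e _ => ?_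
  rw [Finset.sum_comm]
  exact Finset.sum_congr rfl fun d _ => Finset.sum_comm

theorem ricci_frame [T2Space M] (D : AffineConnection n M) (b b' : Frame n x) :
    Matrix.of (ricci D b') = (b.toMatrix b').transpose * Matrix.of (ricci D b) * b.toMatrix b' := by
  have hx := mem_chart_source (EuclideanSpace ℝ (Fin n)) x
  ext j l
  simp only [Matrix.of_apply, ricci, curvature_eq, Rm_frame D b b' hx hx, Matrix.mul_apply,
    Matrix.transpose_apply, frameExt_self]
  simp only [map_sum, map_smul, Finsupp.coe_finsetSum, Finset.sum_apply, Finsupp.coe_smul,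
    Pi.smul_apply, smul_eq_mul]
  have h : ∀ v a, ∑ i, b.toMatrix b' a i * b'.repr v i = b.repr v a := fun v a =>
    congrFun (Basis.toMatrix_mulVec_repr b' b v) a
  -- The trace taken in `b` is expanded through `b'`, so that both sides become the same fourfold
  -- sum in a different order.
  have h2 : ∀ d e, ∑ k, b.repr (Rm D (fun z => frameExt b z k) (fun z => frameExt b z d)
      (fun z => frameExt b z e) x) k = ∑ k, ∑ i, b.toMatrix b' k i *
        b'.repr (Rm D (fun z => frameExt b z k) (fun z => frameExt b z d)
          (fun z => frameExt b z e) x) i := fun d e =>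
    Finset.sum_congr rfl fun k _ => (h _ k).symm
  simp only [h2]
  simp only [Finset.mul_sum, Finset.sum_mul]
  rw [sum_reverse_four]
  refine Finset.sum_congr rfl fun e _ => Finset.sum_congr rfl fun d _ => Finset.sum_congr rfl
    fun c _ => Finset.sum_congr rfl fun i _ => ?_
  ring

theorem schouten_frame [T2Space M] (D : AffineConnection n M) (b b' : Frame n x) :
    Matrix.of (schouten D b') =
      (b.toMatrix b').transpose * Matrix.of (schouten D b) * b.toMatrix b' := by
  have h : ∀ b : Frame n x, Matrix.of (schouten D b) = ((n : ℝ) ^ 2 - 1)⁻¹ •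
      ((n : ℝ) • Matrix.of (ricci D b) + (Matrix.of (ricci D b)).transpose) := by
    intro b
    ext i j
    simp [schouten, div_eq_inv_mul]
  rw [h, h, ricci_frame D b b']
  simp only [Matrix.mul_add, Matrix.add_mul, Matrix.mul_assoc, Matrix.transpose_mul,
    Matrix.transpose_transpose, Matrix.mul_smul, Matrix.smul_mul]

/-- Tracing the change of curvature gives `Ric' = Ric - n Q + Qᵀ`. In `n Ric + Ricᵀ` the transposed
terms cancel and `-(n² - 1) Q` remains, which explains the normalization of `P`. -/
theorem schouten_projectiveChange [T2Space M] (hn : 2 ≤ n) {D D' : AffineConnection n M}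
    {Υ : ∀ x : M, TangentSpace (𝓡 n) x →L[ℝ] ℝ} (h : IsProjectiveChange D D' Υ) (b : Frame n x)
    (i j : Fin n) :
    schouten D' b i j = schouten D b i j
      - (mvfderiv (𝓡 n) (fun y => Υ y (frameExt b y j)) x (b i)
        - Υ x (D.toCov (fun y => frameExt b y j) x (b i)) - Υ x (b i) * Υ x (b j)) := by
  have hx := mem_chart_source (EuclideanSpace ℝ (Fin n)) x
  have he := smV_frameExt b hx
  set Q : Fin n → Fin n → ℝ := fun i j => mvfderiv (𝓡 n) (fun y => Υ y (frameExt b y j)) x (b i)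
        - Υ x (D.toCov (fun y => frameExt b y j) x (b i)) - Υ x (b i) * Υ x (b j) with hQ
  have hR : ∀ j l, ricci D' b j l = ricci D b j l - n * Q j l + Q l j := by
    intro j l
    simp only [ricci, curvature_eq]
    simp only [Rm_projectiveChange h (he _) (he _) (he _) (fun _ _ => rfl), frameExt_self]
    simp only [map_add, map_sub, map_smul, Finsupp.coe_add, Finsupp.coe_sub, Finsupp.coe_smul,
      Pi.add_apply, Pi.sub_apply, Pi.smul_apply, smul_eq_mul, Basis.repr_self]
    simp only [Finset.sum_add_distrib, Finset.sum_sub_distrib, Finsupp.single_apply]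
    simp [hQ]
    ring
  have h2 : (2 : ℝ) ≤ n := by exact_mod_cast hn
  have h3 : (n : ℝ) ^ 2 - 1 ≠ 0 := by nlinarith
  simp only [schouten, hR]
  change _ = _ - Q i j
  field_simp
  ring

/-- The connection matrix of `D` in the direction `v` with respect to the local frame `e`. -/
def connMat (D : AffineConnection n M) (e : ∀ y : M, Frame n y) (y : M)
    (v : TangentSpace (𝓡 n) y) : Matrix (Fin n) (Fin n) ℝ :=
  Matrix.of fun i j => (e y).repr (D.toCov (fun z => e z j) y v) i

theorem connCoeff_eq (D : AffineConnection n M) (b : Frame n x) (c i j : Fin n) :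
    connCoeff D b c i j = connMat D (frameExt b) x (b c) i j := by
  simp [connCoeff, connMat]

/-- This is the Leibniz rule for `e'_j = ∑ A^c_j e_c`: `A Γ' = Γ A + dA`. -/
theorem connMat_frame [T2Space M] (D : AffineConnection n M) (b : Frame n x) (b' : Frame n x')
    (hy : y ∈ (chartAt (EuclideanSpace ℝ (Fin n)) x).source)
    (hy' : y ∈ (chartAt (EuclideanSpace ℝ (Fin n)) x').source) (v : TangentSpace (𝓡 n) y) :
    (frameExt b y).toMatrix (frameExt b' y) * connMat D (frameExt b') y v =
      connMat D (frameExt b) y v * (frameExt b y).toMatrix (frameExt b' y)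
      + Matrix.of fun i j =>
        mvfderiv (𝓡 n) (fun z => (frameExt b z).toMatrix (frameExt b' z) i j) y v := by
  have hA := smF_toMatrix b b' hy hy'
  have he := smV_frameExt b hy
  have hsum : ∀ i, (fun z => frameExt b' z i) =
      fun z => ∑ c, (frameExt b z).toMatrix (frameExt b' z) c i • frameExt b z c := fun i =>
    funext fun z => basis_apply_eq_sum _ _ _
  ext i j
  have h : ∑ k, (frameExt b y).toMatrix (frameExt b' y) i k *
      (frameExt b' y).repr (D.toCov (fun z => frameExt b' z j) y v) k =
      (frameExt b y).repr (D.toCov (fun z => frameExt b' z j) y v) i :=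
    congrFun (Basis.toMatrix_mulVec_repr (frameExt b' y) (frameExt b y) _) i
  simp only [Matrix.mul_apply, Matrix.add_apply, Matrix.of_apply, connMat, h]
  rw [hsum j, cov_sum D _ fun c _ => (he c).smul (hA c j)]
  simp only [_root_.sum_apply, cov_smul D (hA _ j) (he _), map_sum, map_add, map_smul,
    Finsupp.coe_finsetSum, Finset.sum_apply, Finsupp.coe_add, Pi.add_apply, Finsupp.coe_smul,
    Pi.smul_apply, smul_eq_mul, Basis.repr_self, Finset.sum_add_distrib, Finsupp.single_apply]
  simp [mul_comm]

theorem connMat_projectiveChange {D D' : AffineConnection n M}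
    {Υ : ∀ x : M, TangentSpace (𝓡 n) x →L[ℝ] ℝ} (h : IsProjectiveChange D D' Υ) (b : Frame n x)
    (hy : y ∈ (chartAt (EuclideanSpace ℝ (Fin n)) x).source) (v : TangentSpace (𝓡 n) y) :
    connMat D' (frameExt b) y v = connMat D (frameExt b) y v + Υ y v • 1
      + Matrix.of fun i j => (frameExt b y).repr v i * Υ y (frameExt b y j) := by
  ext i j
  simp only [connMat, Matrix.of_apply, Matrix.add_apply, h.cov_eq (smV_frameExt b hy j), map_add,
    map_smul, Finsupp.coe_add, Pi.add_apply, Finsupp.coe_smul, Pi.smul_apply, smul_eq_mul,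
    Basis.repr_self, Matrix.smul_apply, Matrix.one_apply, Finsupp.single_apply, eq_comm (a := j),
    mul_comm ((frameExt b y).repr v i)]

theorem smF_connMat [T2Space M] (D : AffineConnection n M) (b : Frame n x)
    (hy : y ∈ (chartAt (EuclideanSpace ℝ (Fin n)) x).source) (c i j : Fin n) :
    SmF n (fun z => connMat D (frameExt b) z (frameExt b z c) i j) y :=
  ((smV_frameExt b hy j).cov D (smV_frameExt b hy c)).repr b hy i

end FrameChange

/-! ### The group action and the derivation action on symmetric tractors. -/

section Action

variable {n : ℕ} (κ : Kind) (G G' A B S : TMat n)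

@[simp] theorem act_up : Kind.up.act G S = G * S * G.transpose := by
  simp [Kind.act, Matrix.mul_assoc]

@[simp] theorem act_down : Kind.down.act G S = (G⁻¹).transpose * S * G⁻¹ := by
  simp [Kind.act, Matrix.mul_assoc]

@[simp] theorem dact_up : Kind.up.dact A S = A * S + S * A.transpose := by
  simp [Kind.dact]

@[simp] theorem dact_down : Kind.down.dact A S = -(A.transpose * S + S * A) := by
  simp [Kind.dact]

theorem act_mul : κ.act (G' * G) S = κ.act G' (κ.act G S) := by
  cases κ <;> simp [Matrix.mul_assoc, Matrix.mul_inv_rev]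

theorem act_one : κ.act 1 S = S := by
  cases κ <;> simp

theorem act_isSymm {S : TMat n} (h : S.IsSymm) : (κ.act G S).IsSymm := by
  unfold Matrix.IsSymm at *
  cases κ <;> simp [h, Matrix.mul_assoc]

theorem dact_isSymm {S : TMat n} (h : S.IsSymm) : (κ.dact A S).IsSymm := by
  unfold Matrix.IsSymm at *
  cases κ <;> simp [h, add_comm]

theorem dact_add : κ.dact (A + B) S = κ.dact A S + κ.dact B S := by
  cases κ <;> simp [Matrix.add_mul, Matrix.mul_add] <;> abel

theorem dact_smul (r : ℝ) : κ.dact (r • A) S = r • κ.dact A S := by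
  cases κ <;> simp

theorem dact_sum {ι : Type*} (s : Finset ι) (A : ι → TMat n) :
    κ.dact (∑ i ∈ s, A i) S = ∑ i ∈ s, κ.dact (A i) S := by
  classical
  induction s using Finset.induction_on with
  | empty => cases κ <;> simp
  | insert a s ha ih => rw [Finset.sum_insert ha, Finset.sum_insert ha, dact_add, ih]

/-- Equivariance of the derivation action. -/
theorem dact_act (hG : IsUnit G.det) (h : B * G = G * A) :
    κ.dact B (κ.act G S) = κ.act G (κ.dact A S) := by
  cases κ with
  | up =>
    have h' : G.transpose * B.transpose = A.transpose * G.transpose := by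
      rw [← Matrix.transpose_mul, ← Matrix.transpose_mul, h]
    simp only [act_up, dact_up, Matrix.mul_add, Matrix.add_mul]
    rw [← Matrix.mul_assoc, ← Matrix.mul_assoc, h, Matrix.mul_assoc _ G.transpose, h']
    simp only [Matrix.mul_assoc]
  | down =>
    have h1 : G⁻¹ * B = A * G⁻¹ := by
      calc G⁻¹ * B = G⁻¹ * (B * G) * G⁻¹ := by
            rw [Matrix.mul_assoc, Matrix.mul_nonsing_inv_cancel_right _ _ hG]
        _ = A * G⁻¹ := by rw [h, Matrix.nonsing_inv_mul_cancel_left _ _ hG]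
    have h2 : B.transpose * (G⁻¹).transpose = (G⁻¹).transpose * A.transpose := by
      rw [← Matrix.transpose_mul, ← Matrix.transpose_mul, h1]
    simp only [act_down, dact_down, Matrix.mul_add, Matrix.add_mul, Matrix.mul_neg, Matrix.neg_mul]
    rw [← Matrix.mul_assoc, ← Matrix.mul_assoc, h2, Matrix.mul_assoc _ G⁻¹ B, h1]
    simp only [Matrix.mul_assoc]

end Action

/-! ### Transition matrices of tractors and their cocycle property. -/

section Transition

variable {n : ℕ} {M : Type*} [TopologicalSpace M] [ChartedSpace (EuclideanSpace ℝ (Fin n)) M]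
  [IsManifold (𝓡 n) ∞ M] {x : M} (b b' b'' : Frame n x) (u u' : TangentSpace (𝓡 n) x →L[ℝ] ℝ)

/-- The weight factors multiply because determinants do. In the lower left block the frame change
turns `u'(b'_j)` into `u'(b_k)`, so the two one-forms add. -/
theorem tractorTransition_mul :
    tractorTransition b' b'' u' * tractorTransition b b' u =
      tractorTransition b b'' (u + u') := by
  have h1 : b.toMatrix b'' = b.toMatrix b' * b'.toMatrix b'' :=
    (Basis.toMatrix_mul_toMatrix b b' b'').symm
  have h2 : b''.toMatrix b = b''.toMatrix b' * b'.toMatrix b :=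
    (Basis.toMatrix_mul_toMatrix b'' b' b).symm
  have h3 : ∀ k, ∑ j, u' (b' j) * b'.toMatrix b j k = u' (b k) := by
    intro k
    conv_rhs => rw [basis_apply_eq_sum b' b k, map_sum]
    exact Finset.sum_congr rfl fun j _ => by rw [map_smul, smul_eq_mul, mul_comm]
  unfold tractorTransition
  rw [Matrix.smul_mul, Matrix.mul_smul, smul_smul, Matrix.fromBlocks_multiply, h1, Matrix.det_mul,
    abs_mul, Real.mul_rpow (abs_nonneg _) (abs_nonneg _), mul_comm, h2]
  congr 2
  · simp
  · simp
  · ext i k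
    simp [Matrix.mul_apply, h3, add_comm]
  · simp

theorem tractorTransition_self : tractorTransition b b 0 = 1 := by
  unfold tractorTransition
  simp only [Basis.toMatrix_self, Matrix.det_one, abs_one, Real.one_rpow, one_smul]
  rw [← Matrix.fromBlocks_one]
  congr 1
  ext i j
  simp

theorem tractorTransition_mul_inv :
    tractorTransition b b' u * tractorTransition b' b (-u) = 1 := by
  rw [tractorTransition_mul]
  simp [tractorTransition_self]

theorem isUnit_det_tractorTransition : IsUnit (tractorTransition b b' u).det :=
  Matrix.isUnit_det_of_right_inverse (tractorTransition_mul_inv b b' u)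

theorem tractorTransition_inv : (tractorTransition b b' u)⁻¹ = tractorTransition b' b (-u) :=
  Matrix.inv_eq_right_inv (tractorTransition_mul_inv b b' u)

/-- Change of the components of a form under a change of tractor frames. -/
def moveForm (κ : Kind) {k : ℕ} (g : (Fin k → Fin n) → TMat n) (J : Fin k → Fin n) : TMat n :=
  ∑ L : Fin k → Fin n, (∏ s, b.toMatrix b' (L s) (J s)) • κ.act (tractorTransition b b' u) (g L)

theorem moveForm_trans (κ : Kind) {k : ℕ} (g : (Fin k → Fin n) → TMat n) :
    moveForm b' b'' u' κ (moveForm b b' u κ g) = moveForm b b'' (u + u') κ g := by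
  funext J
  simp only [moveForm, map_sum, map_smul, ← act_mul, tractorTransition_mul]
  simp only [Finset.smul_sum, smul_smul]
  rw [Finset.sum_comm]
  refine Finset.sum_congr rfl fun L _ => ?_
  rw [← Finset.sum_smul]
  congr 1
  simp only [← Finset.prod_mul_distrib, ← Basis.toMatrix_mul_toMatrix b b' b'', Matrix.mul_apply]
  rw [Fintype.prod_sum]
  exact Finset.sum_congr rfl fun K _ => Finset.prod_congr rfl fun s _ => mul_comm _ _

theorem prod_one_apply {k : ℕ} (L J : Fin k → Fin n) :
    ∏ s, (1 : Matrix (Fin n) (Fin n) ℝ) (L s) (J s) = if L = J then 1 else 0 := by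
  simp only [Matrix.one_apply]
  split_ifs with h
  · simp [h]
  · obtain ⟨s, hs⟩ := Function.ne_iff.1 h
    exact Finset.prod_eq_zero (Finset.mem_univ s) (by simp [hs])

theorem moveForm_self (κ : Kind) {k : ℕ} (g : (Fin k → Fin n) → TMat n) :
    moveForm b b 0 κ g = g := by
  funext J
  simp [moveForm, tractorTransition_self, act_one, prod_one_apply]

end Transition

/-! ### Tractor-valued forms and invariance of the codifferential. -/

section Forms

variable {n : ℕ} {M : Type*} [TopologicalSpace M] [ChartedSpace (EuclideanSpace ℝ (Fin n)) M]
  [IsManifold (𝓡 n) ∞ M] {x : M} {p : ProjectiveStructure n M} {κ : Kind} {k : ℕ}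

theorem ProjectiveStructure.exists_change (p : ProjectiveStructure n M) (D D' : p.conns) :
    ∃ Υ, IsProjectiveChange D.1 D'.1 Υ :=
  (p.mem_iff D.1 D.2 D'.1).1 D'.2

theorem form_change {φ : FormComp p k x} (hφ : φ ∈ form p κ k x) {f f' : TFrame p x}
    {Υ : ∀ y : M, TangentSpace (𝓡 n) y →L[ℝ] ℝ} (h : IsProjectiveChange f.1.1 f'.1.1 Υ) :
    φ f' = moveForm f.2 f'.2 (Υ x) κ (φ f) :=
  funext fun J => hφ.2.2 f f' Υ h J

theorem form_ext {φ ψ : FormComp p k x} (hφ : φ ∈ form p κ k x) (hψ : ψ ∈ form p κ k x)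
    (f : TFrame p x) (h : φ f = ψ f) : φ = ψ := by
  funext f'
  obtain ⟨Υ, hΥ⟩ := p.exists_change f.1 f'.1
  rw [form_change hφ hΥ, form_change hψ hΥ, h]

/-- The components of a form can be prescribed in one tractor frame. -/
theorem exists_form (f : TFrame p x) (g : (Fin k → Fin n) → TMat n) (hs : ∀ J, (g J).IsSymm)
    (ha : ∀ J (σ : Equiv.Perm (Fin k)), g (J ∘ σ) = ((Equiv.Perm.sign σ : ℤ) : ℝ) • g J) :
    ∃ φ ∈ form p κ k x, φ f = g := by
  choose Υ hΥ using fun f' : TFrame p x => p.exists_change f.1 f'.1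
  refine ⟨fun f' => moveForm f.2 f'.2 (Υ f' x) κ g, ⟨fun f' J => ?_, fun f' J σ => ?_,
    fun f₁ f₂ Υ' h J => ?_⟩, ?_⟩
  · unfold moveForm Matrix.IsSymm
    rw [Matrix.transpose_sum]
    exact Finset.sum_congr rfl fun L _ => ((act_isSymm κ _ (hs L)).smul _)
  · unfold moveForm
    rw [Finset.smul_sum]
    refine Fintype.sum_equiv (Equiv.arrowCongr σ (Equiv.refl _)) _ _ fun L => ?_
    have h1 : g L = ((Equiv.Perm.sign σ : ℤ) : ℝ) • g (L ∘ σ.symm) := by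
      rw [← ha]
      congr 1
      ext s
      simp
    have h2 : ∏ s, f.2.toMatrix f'.2 (L s) ((J ∘ σ) s) =
        ∏ s, f.2.toMatrix f'.2 ((L ∘ σ.symm) s) (J s) :=
      Fintype.prod_equiv σ _ _ fun s => by simp
    have h3 : Equiv.arrowCongr σ (Equiv.refl _) L = L ∘ σ.symm := by
      ext s
      simp
    rw [h3, h2]
    conv_lhs => rw [h1]
    rw [map_smul, smul_comm]
  -- The components are transported from `f` to every frame. Since `Υ` is unique at `x`, the two
  -- routes to `f₂` use the same one-form, and the cocycle property makes them agree.
  · have h1 := (hΥ f₂).unique ((hΥ f₁).trans h) (x := x)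
    change moveForm f.2 f₂.2 (Υ f₂ x) κ g J = moveForm f₁.2 f₂.2 (Υ' x) κ _ J
    rw [h1, moveForm_trans]
  · have h1 := (hΥ f).unique (IsProjectiveChange.refl f.1.1) (x := x)
    change moveForm f.2 f.2 (Υ f x) κ g = g
    rw [h1, moveForm_self]

/-- Invariance of `X^B Z_A^c`: conjugation by a tractor transition only changes the index `c`, in
the way opposite to a form index. Contraction with a form index is therefore independent of the
tractor frame. -/
theorem tractorNil_mul_transition (b b' : Frame n x) (u : TangentSpace (𝓡 n) x →L[ℝ] ℝ)
    (d : Fin n) :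
    (∑ c, b.toMatrix b' d c • tractorNil c) * tractorTransition b b' u =
      tractorTransition b b' u * tractorNil d := by
  have h := Basis.toMatrix_mul_toMatrix b b' b
  rw [Basis.toMatrix_self] at h
  have h' : ∀ j, ∑ c, b.toMatrix b' d c * b'.toMatrix b c j =
      (1 : Matrix (Fin n) (Fin n) ℝ) d j := fun j => by rw [← h, Matrix.mul_apply]
  have h1 : (∑ c, b.toMatrix b' d c • tractorNil c : TMat n) =
      Matrix.fromBlocks 0 0 (Matrix.of fun _ c => b.toMatrix b' d c) 0 := by
    ext i j
    rcases i with i | i <;> rcases j with j | j <;>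
      simp [tractorNil, Matrix.sum_apply, Matrix.single_apply]
  have h2 : (tractorNil d : TMat n) =
      Matrix.fromBlocks 0 0 (Matrix.of fun _ c => (1 : Matrix (Fin n) (Fin n) ℝ) d c) 0 := by
    ext i j
    rcases i with i | i <;> rcases j with j | j <;>
      simp [tractorNil, Matrix.single_apply, Matrix.one_apply]
  unfold tractorTransition
  rw [h1, h2, Matrix.mul_smul, Matrix.smul_mul, Matrix.fromBlocks_multiply,
    Matrix.fromBlocks_multiply]
  congr 2
  · simp
  · simp
  · ext i j
    simp [Matrix.mul_apply, h']
  · simp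

theorem codiff_moveForm (b b' : Frame n x) (u : TangentSpace (𝓡 n) x →L[ℝ] ℝ)
    (g : (Fin (k + 1) → Fin n) → TMat n) (J : Fin k → Fin n) :
    ∑ c, κ.dact (tractorNil c) (moveForm b b' u κ g (Fin.cons c J)) =
      moveForm b b' u κ (fun J => ∑ c, κ.dact (tractorNil c) (g (Fin.cons c J))) J := by
  have hN := fun d S => dact_act κ _ _ _ S (isUnit_det_tractorTransition b b' u)
    (tractorNil_mul_transition b b' u d)
  simp only [dact_sum, dact_smul] at hN
  simp only [moveForm, map_sum, map_smul, ← hN]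
  simp only [Finset.smul_sum, smul_smul]
  rw [Finset.sum_comm]
  rw [← (Fin.consEquiv fun _ : Fin (k + 1) => Fin n).sum_comp, Fintype.sum_prod_type_right]
  refine Finset.sum_congr rfl fun L _ => Finset.sum_congr rfl fun d _ =>
    Finset.sum_congr rfl fun c _ => ?_
  simp [Fin.consEquiv, Fin.prod_univ_succ, mul_comm]

theorem codiff_mem {φ : FormComp p (k + 1) x} (hφ : φ ∈ form p κ (k + 1) x) :
    codiff p κ k x φ ∈ form p κ k x := by
  refine ⟨fun f J => ?_, fun f J σ => ?_, fun f f' Υ h J => ?_⟩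
  · change (∑ c, κ.dact (tractorNil c) (φ f (Fin.cons c J))).IsSymm
    unfold Matrix.IsSymm
    rw [Matrix.transpose_sum]
    exact Finset.sum_congr rfl fun c _ => dact_isSymm κ _ (hφ.1 f _)
  · change ∑ c, κ.dact (tractorNil c) (φ f (Fin.cons c (J ∘ σ))) =
      _ • ∑ c, κ.dact (tractorNil c) (φ f (Fin.cons c J))
    rw [Finset.smul_sum]
    refine Finset.sum_congr rfl fun c _ => ?_
    -- A permutation of the remaining indices extends to all of them by fixing the contracted one,
    -- with unchanged sign.
    have h1 : (Fin.cons c (J ∘ σ) : Fin (k + 1) → Fin n) =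
        Fin.cons c J ∘ (Equiv.Perm.decomposeFin.symm (0, σ)) := by
      funext s
      refine Fin.cases ?_ (fun s => ?_) s <;> simp
    rw [h1, hφ.2.1, map_smul]
    simp
  · change ∑ c, κ.dact (tractorNil c) (φ f' (Fin.cons c J)) = moveForm f.2 f'.2 (Υ x) κ _ J
    rw [form_change hφ h, codiff_moveForm]
    rfl

end Forms

/-! ### The codifferential slot by slot. -/

section Entries

variable {n k : ℕ} (g : (Fin (k + 1) → Fin n) → TMat n) (J : Fin k → Fin n)

/-- The image of `X^B Z_A^c` is the line of `X`, so the action feeds each slot only into the next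
one down and nothing reaches the top. The slot computations of `∂*` below all go through these six
entries. -/
theorem nil_up_top (a c : Fin n) :
    (∑ i, Kind.up.dact (tractorNil i) (g (Fin.cons i J))) (Sum.inl a) (Sum.inl c) = 0 := by
  simp [tractorNil, Matrix.sum_apply, Matrix.mul_apply]

theorem nil_up_mid (j : Fin n) :
    (∑ i, Kind.up.dact (tractorNil i) (g (Fin.cons i J))) (Sum.inl j) (Sum.inr ()) =
      ∑ i, g (Fin.cons i J) (Sum.inl j) (Sum.inl i) := by
  simp [tractorNil, Matrix.sum_apply, Matrix.mul_apply, Matrix.single_apply]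

theorem nil_up_bot :
    (∑ i, Kind.up.dact (tractorNil i) (g (Fin.cons i J))) (Sum.inr ()) (Sum.inr ()) =
      ∑ i, (g (Fin.cons i J) (Sum.inl i) (Sum.inr ())
        + g (Fin.cons i J) (Sum.inr ()) (Sum.inl i)) := by
  simp [tractorNil, Matrix.sum_apply, Matrix.mul_apply, Matrix.single_apply]

theorem nil_down_top :
    (∑ i, Kind.down.dact (tractorNil i) (g (Fin.cons i J))) (Sum.inr ()) (Sum.inr ()) = 0 := by
  simp [tractorNil, Matrix.sum_apply, Matrix.mul_apply]

theorem nil_down_mid (j : Fin n) :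
    (∑ i, Kind.down.dact (tractorNil i) (g (Fin.cons i J))) (Sum.inl j) (Sum.inr ()) =
      - g (Fin.cons j J) (Sum.inr ()) (Sum.inr ()) := by
  simp [tractorNil, Matrix.sum_apply, Matrix.mul_apply, Matrix.single_apply]

theorem nil_down_bot (a c : Fin n) :
    (∑ i, Kind.down.dact (tractorNil i) (g (Fin.cons i J))) (Sum.inl a) (Sum.inl c) =
      - (g (Fin.cons a J) (Sum.inr ()) (Sum.inl c) + g (Fin.cons c J) (Sum.inl a) (Sum.inr ())) := by
  simp [tractorNil, Matrix.sum_apply, Matrix.mul_apply, Matrix.single_apply,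
    Finset.sum_add_distrib]

end Entries

/-! ### Invariance of the top slot. -/

section Slots

variable {n : ℕ} {M : Type*} [TopologicalSpace M] [ChartedSpace (EuclideanSpace ℝ (Fin n)) M]
  [IsManifold (𝓡 n) ∞ M] {x : M} {p : ProjectiveStructure n M} {k : ℕ}

theorem abs_det_toMatrix_pos (b b' : Frame n x) : 0 < |(b.toMatrix b').det| := by
  have h := congrArg Matrix.det (Basis.toMatrix_mul_toMatrix b b' b)
  rw [Matrix.det_mul, Basis.toMatrix_self, Matrix.det_one] at h
  exact abs_pos.2 (left_ne_zero_of_mul_eq_one h)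

theorem abs_det_toMatrix_symm (b b' : Frame n x) :
    |(b'.toMatrix b).det| = |(b.toMatrix b').det|⁻¹ := by
  have h := congrArg Matrix.det (Basis.toMatrix_mul_toMatrix b b' b)
  rw [Matrix.det_mul, Basis.toMatrix_self, Matrix.det_one] at h
  rw [← abs_inv]
  congr 1
  exact eq_inv_of_mul_eq_one_right h

/-- The transition matrix has zero upper right block, so the one-form `u` never enters the top slot.
The two weight factors combine to the exponent of `E(-2)`. -/
theorem act_up_apply_top (b b' : Frame n x) (u : TangentSpace (𝓡 n) x →L[ℝ] ℝ) (S : TMat n)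
    (i j : Fin n) :
    Kind.up.act (tractorTransition b b' u) S (Sum.inl i) (Sum.inl j) =
      |(b.toMatrix b').det| ^ ((2 : ℝ) / (n + 1)) *
        ∑ k, ∑ l, b'.toMatrix b i k * b'.toMatrix b j l * S (Sum.inl k) (Sum.inl l) := by
  have h : |(b.toMatrix b').det| ^ ((2 : ℝ) / (n + 1)) =
      |(b.toMatrix b').det| ^ ((1 : ℝ) / (n + 1)) * |(b.toMatrix b').det| ^ ((1 : ℝ) / (n + 1)) := by
    rw [← Real.rpow_add (abs_det_toMatrix_pos b b')]
    congr 1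
    ring
  rw [h, act_up, Matrix.mul_assoc]
  simp only [tractorTransition, Matrix.mul_apply, Matrix.smul_apply, Matrix.transpose_apply,
    Fintype.sum_sum_type, smul_eq_mul]
  simp [Finset.mul_sum]
  refine Finset.sum_congr rfl fun k _ => Finset.sum_congr rfl fun l _ => ?_
  ring

/-- On the dual side the inverse matrix acts. It has the same block shape with the frames exchanged,
so again `u` drops out, and the weight is `2`. -/
theorem act_down_apply_top (b b' : Frame n x) (u : TangentSpace (𝓡 n) x →L[ℝ] ℝ) (S : TMat n) :
    Kind.down.act (tractorTransition b b' u) S (Sum.inr ()) (Sum.inr ()) =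
      |(b.toMatrix b').det| ^ (-(2 : ℝ) / (n + 1)) * S (Sum.inr ()) (Sum.inr ()) := by
  have h : |(b.toMatrix b').det| ^ (-(2 : ℝ) / (n + 1)) =
      |(b'.toMatrix b).det| ^ ((1 : ℝ) / (n + 1)) * |(b'.toMatrix b).det| ^ ((1 : ℝ) / (n + 1)) := by
    rw [abs_det_toMatrix_symm b b', Real.inv_rpow (abs_nonneg _), ← Real.rpow_neg (abs_nonneg _),
      ← Real.rpow_add (abs_det_toMatrix_pos b b')]
    congr 1
    ring
  rw [h, act_down, tractorTransition_inv, Matrix.mul_assoc]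
  simp only [tractorTransition, Matrix.mul_apply, Matrix.smul_apply, Matrix.transpose_apply,
    Fintype.sum_sum_type, smul_eq_mul]
  simp
  ring

theorem wTensor_ext {j l : ℕ} {w : ℝ} {F G : Frame n x → Comp n j l} (hF : F ∈ wTensor j l w x)
    (hG : G ∈ wTensor j l w x) (b : Frame n x) (h : F b = G b) : F = G := by
  funext b' I J
  rw [hF b b' I J, hG b b' I J, h]

theorem sum_fin_two (f : (Fin 2 → Fin n) → ℝ) : ∑ K, f K = ∑ i, ∑ j, f ![i, j] := by
  rw [← (finTwoArrowEquiv (Fin n)).symm.sum_comp, Fintype.sum_prod_type]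
  rfl

theorem up_top_mem {φ : FormComp p k x} (hφ : φ ∈ form p .up k x) (D : p.conns) :
    (fun b I J => φ (D, b) J (Sum.inl (I 0)) (Sum.inl (I 1)) : Frame n x → Comp n 2 k) ∈
      wTensor 2 k (-2) x := by
  intro b b' I J
  have h := form_change hφ (f := (D, b)) (f' := (D, b')) (IsProjectiveChange.refl D.1)
  simp only [h, moveForm, Matrix.sum_apply, Matrix.smul_apply, act_up_apply_top, smul_eq_mul,
    neg_neg]
  rw [Finset.sum_comm]
  rw [Finset.mul_sum]
  refine Finset.sum_congr rfl fun L _ => ?_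
  rw [sum_fin_two]
  simp only [Finset.mul_sum]
  refine Finset.sum_congr rfl fun i _ => Finset.sum_congr rfl fun j _ => ?_
  simp
  ring

theorem moveForm_same (κ : Kind) (b : Frame n x) (u : TangentSpace (𝓡 n) x →L[ℝ] ℝ)
    (g : (Fin k → Fin n) → TMat n) (J : Fin k → Fin n) :
    moveForm b b u κ g J = κ.act (tractorTransition b b u) (g J) := by
  simp only [moveForm, Basis.toMatrix_self, prod_one_apply]
  simp

theorem up_top_indep {φ : FormComp p k x} (hφ : φ ∈ form p .up k x) (D D' : p.conns)
    (b : Frame n x) (J : Fin k → Fin n) (i j : Fin n) :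
    φ (D', b) J (Sum.inl i) (Sum.inl j) = φ (D, b) J (Sum.inl i) (Sum.inl j) := by
  obtain ⟨Υ, hΥ⟩ := p.exists_change D D'
  rw [form_change hφ (f := (D, b)) (f' := (D', b)) hΥ]
  rw [moveForm_same, act_up_apply_top]
  simp [Matrix.one_apply]

theorem down_top_mem {φ : FormComp p k x} (hφ : φ ∈ form p .down k x) (D : p.conns) :
    (fun b _ J => φ (D, b) J (Sum.inr ()) (Sum.inr ()) : Frame n x → Comp n 0 k) ∈
      wTensor 0 k 2 x := by
  intro b b' I J
  have h := form_change hφ (f := (D, b)) (f' := (D, b')) (IsProjectiveChange.refl D.1)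
  simp only [h, moveForm, Matrix.sum_apply, Matrix.smul_apply, act_down_apply_top, smul_eq_mul]
  simp only [Finset.univ_unique, Finset.sum_singleton, Finset.mul_sum, Finset.univ_eq_empty,
    Finset.prod_empty]
  refine Finset.sum_congr rfl fun L _ => ?_
  ring

theorem down_top_indep {φ : FormComp p k x} (hφ : φ ∈ form p .down k x) (D D' : p.conns)
    (b : Frame n x) (J : Fin k → Fin n) :
    φ (D', b) J (Sum.inr ()) (Sum.inr ()) = φ (D, b) J (Sum.inr ()) (Sum.inr ()) := by
  obtain ⟨Υ, hΥ⟩ := p.exists_change D D'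
  rw [form_change hφ (f := (D, b)) (f' := (D', b)) hΥ]
  rw [moveForm_same, act_down_apply_top]
  simp

end Slots

/-! ### Quotients by the kernel of a surjection. -/

section Quotients

theorem exists_quotient_equiv {V W : Type*} [AddCommGroup V] [Module ℝ V] [AddCommGroup W]
    [Module ℝ W] (I : Submodule ℝ V) (T : V →ₗ[ℝ] W) (hT : Function.Surjective T)
    (hI : ∀ v, v ∈ I ↔ T v = 0) : ∃ e : (V ⧸ I) ≃ₗ[ℝ] W, ∀ v, e (I.mkQ v) = T v := by
  have h : I = LinearMap.ker T := by
    ext v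
    rw [hI, LinearMap.mem_ker]
  subst h
  exact ⟨T.quotKerEquivOfSurjective hT, fun v => rfl⟩

end Quotients

/-! ### The homology bundles in degrees zero and one. -/

section Homology

variable {n k : ℕ} {M : Type*} [TopologicalSpace M] [ChartedSpace (EuclideanSpace ℝ (Fin n)) M]
  [IsManifold (𝓡 n) ∞ M]

/-- An arbitrary frame. -/
def someFrame (x : M) : Frame n x := (EuclideanSpace.basisFun (Fin n) ℝ).toBasis

/-- An arbitrary connection in the class. -/
def ProjectiveStructure.someConn (p : ProjectiveStructure n M) : p.conns :=
  ⟨p.nonempty.choose, p.nonempty.choose_spec⟩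

variable (p : ProjectiveStructure n M) (x : M)

/-- Symmetric matrices of tractor components, given by their slots. -/
def slots (ζ : Fin n → Fin n → ℝ) (l : Fin n → ℝ) (r : ℝ) : TMat n :=
  Matrix.fromBlocks (Matrix.of ζ) (Matrix.of fun a _ => l a) (Matrix.of fun _ a => l a)
    (Matrix.of fun _ _ => r)

theorem slots_isSymm {ζ : Fin n → Fin n → ℝ} (h : ∀ a c, ζ a c = ζ c a) (l : Fin n → ℝ) (r : ℝ) :
    (slots ζ l r).IsSymm := by
  refine Matrix.IsSymm.ext fun i j => ?_
  rcases i with i | i <;> rcases j with j | j <;> simp [slots, h]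

@[simp] theorem slots_inl_inl (ζ : Fin n → Fin n → ℝ) (l : Fin n → ℝ) (r : ℝ) (a c : Fin n) :
    slots ζ l r (Sum.inl a) (Sum.inl c) = ζ a c := rfl
@[simp] theorem slots_inl_inr (ζ : Fin n → Fin n → ℝ) (l : Fin n → ℝ) (r : ℝ) (a : Fin n)
    (u : Unit) : slots ζ l r (Sum.inl a) (Sum.inr u) = l a := rfl
@[simp] theorem slots_inr_inl (ζ : Fin n → Fin n → ℝ) (l : Fin n → ℝ) (r : ℝ) (a : Fin n)
    (u : Unit) : slots ζ l r (Sum.inr u) (Sum.inl a) = l a := rfl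
@[simp] theorem slots_inr_inr (ζ : Fin n → Fin n → ℝ) (l : Fin n → ℝ) (r : ℝ) (u v : Unit) :
    slots ζ l r (Sum.inr u) (Sum.inr v) = r := rfl

theorem ext_slots {S T : TMat n} (hS : S.IsSymm) (hT : T.IsSymm)
    (h1 : ∀ a c, S (Sum.inl a) (Sum.inl c) = T (Sum.inl a) (Sum.inl c))
    (h2 : ∀ a, S (Sum.inl a) (Sum.inr ()) = T (Sum.inl a) (Sum.inr ()))
    (h3 : S (Sum.inr ()) (Sum.inr ()) = T (Sum.inr ()) (Sum.inr ())) : S = T := by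
  ext i j
  rcases i with i | ⟨⟩ <;> rcases j with j | ⟨⟩
  · exact h1 i j
  · exact h2 i
  · rw [hS.apply, hT.apply]; exact h2 j
  · exact h3

theorem alternating_of_subsingleton [Subsingleton (Fin k)] (g : (Fin k → Fin n) → TMat n)
    (J : Fin k → Fin n) (σ : Equiv.Perm (Fin k)) :
    g (J ∘ σ) = ((Equiv.Perm.sign σ : ℤ) : ℝ) • g J := by
  rw [Subsingleton.elim σ 1]
  simp

theorem exists_form_of_subsingleton {p : ProjectiveStructure n M} {x : M} {κ : Kind}
    [Subsingleton (Fin k)] (f : TFrame p x) (g : (Fin k → Fin n) → TMat n)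
    (hs : ∀ J, (g J).IsSymm) : ∃ φ ∈ form p κ k x, φ f = g :=
  exists_form f g hs (alternating_of_subsingleton g)

theorem alternating_of_swap (g : (Fin 2 → Fin n) → TMat n)
    (h : ∀ J, g ![J 1, J 0] = - g J) (J : Fin 2 → Fin n) (σ : Equiv.Perm (Fin 2)) :
    g (J ∘ σ) = ((Equiv.Perm.sign σ : ℤ) : ℝ) • g J := by
  have hσ : σ = 1 ∨ σ = Equiv.swap 0 1 := by revert σ; decide
  rcases hσ with rfl | rfl
  · simp
  · have h1 : J ∘ (Equiv.swap 0 1 : Equiv.Perm (Fin 2)) = ![J 1, J 0] := by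
      funext i
      fin_cases i <;> simp
    have h2 : Equiv.Perm.sign (Equiv.swap (0 : Fin 2) 1) = -1 := Equiv.Perm.sign_swap (by decide)
    rw [h1, h, h2]
    simp

theorem codiff_apply (κ : Kind) (k : ℕ) (φ : FormComp p (k + 1) x) (f : TFrame p x)
    (J : Fin k → Fin n) :
    codiff p κ k x φ f J = ∑ c, κ.dact (tractorNil c) (φ f (Fin.cons c J)) := rfl

theorem exists_homology_zero_up (hn : 2 ≤ n) : ∃ Φ : Homology p .up 0 x ≃ₗ[ℝ] symBivector n x,
    ∀ (H : codiffKer p .up 0 x) (D : p.conns) (b : Frame n x) (a c : Fin n),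
      (Φ (proj p .up 0 x H)).1 b ![a, c] ![] = H.1 (D, b) ![] (Sum.inl a) (Sum.inl c) := by
  let D₀ := p.someConn
  let b₀ : Frame n x := someFrame x
  let T : codiffKer p .up 0 x →ₗ[ℝ] symBivector n x :=
    { toFun := fun H => ⟨fun b I J => H.1 (D₀, b) J (Sum.inl (I 0)) (Sum.inl (I 1)),
        up_top_mem H.2 D₀, fun b a c => (H.2.1 (D₀, b) ![]).apply _ _⟩
      map_add' := fun _ _ => rfl
      map_smul' := fun _ _ => rfl }
  have hsurj : Function.Surjective T := by
    intro F
    obtain ⟨φ, hφ, h⟩ := exists_form_of_subsingleton (κ := .up) (k := 0) (D₀, b₀)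
      (fun _ => slots (fun a c => F.1 b₀ ![a, c] ![]) 0 0)
      (fun _ => slots_isSymm (fun a c => F.2.2 b₀ a c) 0 0)
    refine ⟨⟨φ, hφ⟩, Subtype.ext (wTensor_ext (up_top_mem hφ D₀) F.2.1 b₀ ?_)⟩
    funext I J
    have hI : ![I 0, I 1] = I := by funext i; fin_cases i <;> rfl
    change φ (D₀, b₀) J (Sum.inl (I 0)) (Sum.inl (I 1)) = _
    rw [h]
    change F.1 b₀ ![I 0, I 1] ![] = F.1 b₀ I J
    rw [hI, Subsingleton.elim J ![]]
  have hker : ∀ H, H ∈ (codiffIm p .up 0 x).submoduleOf (codiffKer p .up 0 x) ↔ T H = 0 := by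
    intro H
    change H.1 ∈ codiffIm p .up 0 x ↔ _
    constructor
    · rintro ⟨φ, -, hφ⟩
      refine Subtype.ext (funext fun b => funext fun I => funext fun J => ?_)
      change H.1 (D₀, b) J _ _ = 0
      rw [← hφ]
      exact nil_up_top _ _ _ _
    · intro hH
      have hn' : (n : ℝ) ≠ 0 := by positivity
      have hn1 : (n : ℝ) + 1 ≠ 0 := by positivity
      have htop : ∀ a c, H.1 (D₀, b₀) ![] (Sum.inl a) (Sum.inl c) = 0 := fun a c =>
        congrFun (congrFun (congrFun (congrArg Subtype.val hH) b₀) ![a, c]) ![]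
      -- A preimage under `∂*`. The trace of `δ_K^a l^c + δ_K^c l^a` over `K = c` is `(n+1) l^a`,
      -- hence the division by `n+1`. The trace of `δ_K^a r` is `n r`, and it enters the bottom slot
      -- from both off-diagonal blocks, hence `2n`.
      obtain ⟨φ, hφ, h⟩ := exists_form_of_subsingleton (κ := .up) (k := 1) (D₀, b₀)
        (fun K => slots (fun a c =>
          ((if K 0 = a then H.1 (D₀, b₀) ![] (Sum.inl c) (Sum.inr ()) else 0)
          + (if K 0 = c then H.1 (D₀, b₀) ![] (Sum.inl a) (Sum.inr ()) else 0)) / (n + 1))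
          (fun a => (if K 0 = a then H.1 (D₀, b₀) ![] (Sum.inr ()) (Sum.inr ()) else 0) / (2 * n))
          0) (fun _ => slots_isSymm (fun a c => by rw [add_comm]) _ _)
       
      refine ⟨φ, hφ, form_ext (codiff_mem hφ) H.2 (D₀, b₀) (funext fun J => ?_)⟩
      rw [Subsingleton.elim J ![]]
      refine ext_slots ((codiff_mem hφ).1 _ _) (H.2.1 _ _) (fun a c => ?_) (fun a => ?_) ?_
      · rw [htop, codiff_apply]
        exact nil_up_top _ _ _ _
      · rw [codiff_apply, nil_up_mid]
        simp only [h, slots_inl_inl, Fin.cons_zero, ← Finset.sum_div, Finset.sum_add_distrib]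
        simp
        field_simp
        ring
      · rw [codiff_apply, nil_up_bot]
        simp only [h, slots_inl_inr, slots_inr_inl, Fin.cons_zero]
        simp
        field_simp
        ring
  obtain ⟨e, he⟩ := exists_quotient_equiv
    ((codiffIm p .up 0 x).submoduleOf (codiffKer p .up 0 x)) T hsurj hker
  refine ⟨e, fun H D b a c => ?_⟩
  change (e (Submodule.mkQ _ H)).1 b ![a, c] ![] = _
  rw [he]
  exact up_top_indep H.2 D D₀ b ![] a c

theorem exists_homology_zero_down :
    ∃ Ψ : Homology p .down 0 x ≃ₗ[ℝ] wTensor (n := n) 0 0 2 x,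
    ∀ (H : codiffKer p .down 0 x) (D : p.conns) (b : Frame n x),
      (Ψ (proj p .down 0 x H)).1 b ![] ![] = H.1 (D, b) ![] (Sum.inr ()) (Sum.inr ()) := by
  let D₀ := p.someConn
  let b₀ : Frame n x := someFrame x
  let T : codiffKer p .down 0 x →ₗ[ℝ] wTensor (n := n) 0 0 2 x :=
    { toFun := fun H => ⟨fun b I J => H.1 (D₀, b) J (Sum.inr ()) (Sum.inr ()),
        down_top_mem H.2 D₀⟩
      map_add' := fun _ _ => rfl
      map_smul' := fun _ _ => rfl }
  have hsurj : Function.Surjective T := by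
    intro F
    obtain ⟨φ, hφ, h⟩ := exists_form_of_subsingleton (κ := .down) (k := 0) (D₀, b₀)
      (fun _ => slots 0 0 (F.1 b₀ ![] ![]))
      (fun _ => slots_isSymm (fun a c => rfl) 0 _)
    refine ⟨⟨φ, hφ⟩, Subtype.ext (wTensor_ext (down_top_mem hφ D₀) F.2 b₀ ?_)⟩
    funext I J
    change φ (D₀, b₀) J (Sum.inr ()) (Sum.inr ()) = _
    rw [h]
    change F.1 b₀ ![] ![] = F.1 b₀ I J
    rw [Subsingleton.elim J ![], Subsingleton.elim I ![]]
  have hker : ∀ H, H ∈ (codiffIm p .down 0 x).submoduleOf (codiffKer p .down 0 x) ↔ T H = 0 := by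
    intro H
    change H.1 ∈ codiffIm p .down 0 x ↔ _
    constructor
    · rintro ⟨φ, -, hφ⟩
      refine Subtype.ext (funext fun b => funext fun I => funext fun J => ?_)
      change H.1 (D₀, b) J _ _ = 0
      rw [← hφ]
      exact nil_down_top _ _
    · intro hH
      have htop : H.1 (D₀, b₀) ![] (Sum.inr ()) (Sum.inr ()) = 0 :=
        congrFun (congrFun (congrFun (congrArg Subtype.val hH) b₀) ![]) ![]
      -- Here `∂*` involves no trace: it turns the form index into a tractor index with a sign. The
      -- division by two compensates the symmetrization in the bottom slot.
      obtain ⟨φ, hφ, h⟩ := exists_form_of_subsingleton (κ := .down) (k := 1) (D₀, b₀)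
        (fun K => slots 0 (fun a => - H.1 (D₀, b₀) ![] (Sum.inl (K 0)) (Sum.inl a) / 2)
          (- H.1 (D₀, b₀) ![] (Sum.inl (K 0)) (Sum.inr ())))
          (fun _ => slots_isSymm (fun a c => rfl) _ _)
      refine ⟨φ, hφ, form_ext (codiff_mem hφ) H.2 (D₀, b₀) (funext fun J => ?_)⟩
      rw [Subsingleton.elim J ![]]
      refine ext_slots ((codiff_mem hφ).1 _ _) (H.2.1 _ _) (fun a c => ?_) (fun a => ?_) ?_
      · rw [codiff_apply, nil_down_bot]
        simp only [h, slots_inl_inr, slots_inr_inl, Fin.cons_zero]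
        rw [(H.2.1 (D₀, b₀) ![]).apply (Sum.inl a) (Sum.inl c)]
        ring
      · rw [codiff_apply, nil_down_mid]
        simp [h]
      · rw [htop, codiff_apply]
        exact nil_down_top _ _
  obtain ⟨e, he⟩ := exists_quotient_equiv
    ((codiffIm p .down 0 x).submoduleOf (codiffKer p .down 0 x)) T hsurj hker
  refine ⟨e, fun H D b => ?_⟩
  change (e (Submodule.mkQ _ H)).1 b ![] ![] = _
  rw [he]
  exact down_top_indep H.2 D D₀ b ![]

/-- For a one-form, the middle slot of `∂*φ = 0` is the vanishing trace of the top slot, and the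
bottom slot is twice the trace of the middle one. If the top slot is zero, the remaining data are a
trace-free `l` and an arbitrary `r`, and both are reached from two-forms. -/
theorem exists_homology_one_up (hn : 2 ≤ n) :
    ∃ Φ : Homology p .up 1 x ≃ₗ[ℝ] tfSymBivectorForm n x,
    ∀ (φ : codiffKer p .up 1 x) (D : p.conns) (b : Frame n x) (a d c : Fin n),
      (Φ (proj p .up 1 x φ)).1 b ![a, d] ![c] = φ.1 (D, b) ![c] (Sum.inl a) (Sum.inl d) := by
  let D₀ := p.someConn
  let b₀ : Frame n x := someFrame x
  have htr : ∀ φ ∈ codiffKer p .up 1 x, ∀ (f : TFrame p x) a,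
      ∑ c, φ f ![c] (Sum.inl a) (Sum.inl c) = 0 := by
    intro φ hφ f a
    have h : codiff p .up 0 x φ = 0 := hφ.2
    have := congrFun (congrFun (congrFun (congrFun h f) ![]) (Sum.inl a)) (Sum.inr ())
    rw [codiff_apply, nil_up_mid] at this
    exact this
  let T : codiffKer p .up 1 x →ₗ[ℝ] tfSymBivectorForm n x :=
    { toFun := fun H => ⟨fun b I J => H.1 (D₀, b) J (Sum.inl (I 0)) (Sum.inl (I 1)),
        up_top_mem H.2.1 D₀, fun b a d c => (H.2.1.1 (D₀, b) ![c]).apply _ _,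
        fun b a => htr H.1 H.2 (D₀, b) a⟩
      map_add' := fun _ _ => rfl
      map_smul' := fun _ _ => rfl }
  have hsurj : Function.Surjective T := by
    intro F
    obtain ⟨φ, hφ, h⟩ := exists_form_of_subsingleton (κ := .up) (k := 1) (D₀, b₀)
      (fun K => slots (fun a d => F.1 b₀ ![a, d] ![K 0]) 0 0)
      (fun K => slots_isSymm (fun a d => F.2.2.1 b₀ a d (K 0)) 0 0)
    have hker : codiff p .up 0 x φ = 0 := by
      refine form_ext (codiff_mem hφ) (zero_mem _) (D₀, b₀) (funext fun J => ?_)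
      refine ext_slots ((codiff_mem hφ).1 _ _) Matrix.isSymm_zero (fun a c => ?_) (fun a => ?_) ?_
      · rw [codiff_apply]
        exact nil_up_top _ _ _ _
      · rw [codiff_apply, nil_up_mid]
        simp only [h, slots_inl_inl, Fin.cons_zero]
        exact F.2.2.2 b₀ a
      · rw [codiff_apply, nil_up_bot]
        simp [h]
    refine ⟨⟨φ, hφ, LinearMap.mem_ker.2 hker⟩, Subtype.ext (wTensor_ext (up_top_mem hφ D₀) F.2.1 b₀ ?_)⟩
    funext I J
    have hI : ![I 0, I 1] = I := by funext i; fin_cases i <;> rfl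
    have hJ : ![J 0] = J := by funext i; fin_cases i; rfl
    change φ (D₀, b₀) J (Sum.inl (I 0)) (Sum.inl (I 1)) = _
    rw [h]
    change F.1 b₀ ![I 0, I 1] ![J 0] = F.1 b₀ I J
    rw [hI, hJ]
  have hker : ∀ H, H ∈ (codiffIm p .up 1 x).submoduleOf (codiffKer p .up 1 x) ↔ T H = 0 := by
    intro H
    change H.1 ∈ codiffIm p .up 1 x ↔ _
    constructor
    · rintro ⟨φ, -, hφ⟩
      refine Subtype.ext (funext fun b => funext fun I => funext fun J => ?_)
      change H.1 (D₀, b) J _ _ = 0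
      rw [← hφ]
      exact nil_up_top _ _ _ _
    · intro hH
      have hn2 : (2 : ℝ) ≤ n := by exact_mod_cast hn
      have hn' : (n : ℝ) ≠ 0 := by positivity
      have hn1 : (n : ℝ) - 1 ≠ 0 := by linarith
      have htop : ∀ a d c, H.1 (D₀, b₀) ![c] (Sum.inl a) (Sum.inl d) = 0 := fun a d c =>
        congrFun (congrFun (congrFun (congrArg Subtype.val hH) b₀) ![a, d]) ![c]
      set l : Fin n → Fin n → ℝ := fun d j => H.1 (D₀, b₀) ![d] (Sum.inl j) (Sum.inr ()) with hl
      set r : Fin n → ℝ := fun d => H.1 (D₀, b₀) ![d] (Sum.inr ()) (Sum.inr ()) with hr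
      have hltr : ∑ c, l c c = 0 := by
        have h : codiff p .up 0 x H.1 = 0 := H.2.2
        have := congrFun (congrFun (congrFun (congrFun h (D₀, b₀)) ![]) (Sum.inr ())) (Sum.inr ())
        rw [codiff_apply, nil_up_bot] at this
        have h2 : ∀ c, H.1 (D₀, b₀) (Fin.cons c ![]) (Sum.inr ()) (Sum.inl c) = l c c := fun c =>
          (H.2.1.1 (D₀, b₀) ![c]).apply _ _
        simp only [h2] at this
        change ∑ c, (l c c + l c c) = 0 at this
        rw [Finset.sum_add_distrib] at this
        linarith
      -- A two-form with prescribed codifferential: symmetrize `δ ⊗ l` in the tractor indices, make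
      -- it skew in the form indices, and do the latter with `δ ⊗ r`. The contraction of the first
      -- yields `n l`, as `l` is trace-free. That of the second is `(n-1) r`, counted twice in the
      -- bottom slot, and `n - 1 ≠ 0`.
      let g : (Fin 2 → Fin n) → TMat n := fun K => slots (fun e j =>
          ((if K 0 = e then l (K 1) j else 0) + (if K 0 = j then l (K 1) e else 0)
          - (if K 1 = e then l (K 0) j else 0) - (if K 1 = j then l (K 0) e else 0)) / n)
          (fun j => ((if K 0 = j then r (K 1) else 0) - (if K 1 = j then r (K 0) else 0))
            / (2 * (n - 1))) 0
      have hsymm : ∀ K, (g K).IsSymm := fun K => slots_isSymm (fun a c => by ring) _ _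
      have hswap : ∀ J, g ![J 1, J 0] = - g J := fun J => by
        refine ext_slots (hsymm _) (hsymm _).neg (fun a c => ?_) (fun a => ?_) ?_
        · simp [g]
          ring
        · simp [g]
          ring
        · simp [g]
      obtain ⟨φ, hφ, h⟩ := exists_form (κ := .up) (k := 2) (D₀, b₀) g hsymm
        (alternating_of_swap g hswap)
      refine ⟨φ, hφ, form_ext (codiff_mem hφ) H.2.1 (D₀, b₀) (funext fun J => ?_)⟩
      obtain ⟨d, rfl⟩ : ∃ d, J = ![d] := ⟨J 0, by funext i; fin_cases i; rfl⟩
      refine ext_slots ((codiff_mem hφ).1 _ _) (H.2.1.1 _ _) (fun a c => ?_) (fun a => ?_) ?_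
      · rw [htop, codiff_apply]
        exact nil_up_top _ _ _ _
      · rw [codiff_apply, nil_up_mid]
        simp only [h, g, slots_inl_inl, Fin.cons_zero, ← Finset.sum_div]
        change (∑ c, ((if c = a then l d c else 0) + (if True then l d a else 0)
          - (if d = a then l c c else 0) - (if d = c then l c a else 0))) / n = l d a
        simp only [Finset.sum_add_distrib, Finset.sum_sub_distrib]
        have h4 : ∑ c, (if d = a then l c c else 0) = 0 := by
          split_ifs
          · exact hltr
          · simp
        rw [h4]
        simp
        field_simp
      · rw [codiff_apply, nil_up_bot]
        simp only [h, g, slots_inl_inr, slots_inr_inl, Fin.cons_zero]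
        change ∑ c, (((if True then r d else 0) - (if d = c then r c else 0)) / (2 * ((n : ℝ) - 1))
          + ((if True then r d else 0) - (if d = c then r c else 0)) / (2 * ((n : ℝ) - 1))) = r d
        simp only [Finset.sum_add_distrib, ← Finset.sum_div, Finset.sum_sub_distrib]
        simp
        field_simp
        ring
  obtain ⟨e, he⟩ := exists_quotient_equiv
    ((codiffIm p .up 1 x).submoduleOf (codiffKer p .up 1 x)) T hsurj hker
  refine ⟨e, fun H D b a d c => ?_⟩
  change (e (Submodule.mkQ _ H)).1 b ![a, d] ![c] = _
  rw [he]
  exact up_top_indep H.2.1 D D₀ b ![c] a d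

end Homology

/-! ### Derivatives of matrix-valued functions and gauge covariance. -/

section MatrixDerivative

variable {n : ℕ} {M : Type*} [TopologicalSpace M] [ChartedSpace (EuclideanSpace ℝ (Fin n)) M]
  [IsManifold (𝓡 n) ∞ M] {x : M} {v : TangentSpace (𝓡 n) x} {ι κ l : Type*}

variable (n) in
/-- Entrywise differentiability of a matrix-valued function. -/
def MatDiff (S : M → Matrix ι κ ℝ) (x : M) : Prop :=
  ∀ i j, MDifferentiableAt (𝓡 n) 𝓘(ℝ, ℝ) (fun y => S y i j) x

/-- The entrywise derivative of a matrix-valued function. -/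
def dMat (S : M → Matrix ι κ ℝ) (x : M) (v : TangentSpace (𝓡 n) x) : Matrix ι κ ℝ :=
  Matrix.of fun i j => mvfderiv (𝓡 n) (fun y => S y i j) x v

theorem dMat_congr {S T : M → Matrix ι κ ℝ} (h : S =ᶠ[𝓝 x] T) : dMat S x v = dMat T x v := by
  ext i j
  have h' : (fun y => S y i j) =ᶠ[𝓝 x] fun y => T y i j := h.mono fun y hy => by simp only [hy]
  simp only [dMat, Matrix.of_apply, mvfderiv_congr h']

theorem mdiff_congr {f g : M → ℝ} (hf : MDifferentiableAt (𝓡 n) 𝓘(ℝ, ℝ) f x)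
    (h : g =ᶠ[𝓝 x] f) : MDifferentiableAt (𝓡 n) 𝓘(ℝ, ℝ) g x :=
  hf.congr_of_eventuallyEq h

theorem mdiff_mul {f g : M → ℝ} (hf : MDifferentiableAt (𝓡 n) 𝓘(ℝ, ℝ) f x)
    (hg : MDifferentiableAt (𝓡 n) 𝓘(ℝ, ℝ) g x) :
    MDifferentiableAt (𝓡 n) 𝓘(ℝ, ℝ) (fun y => f y * g y) x :=
  hf.mul hg

theorem mdiff_sum {s : Finset ι} {f : ι → M → ℝ}
    (hf : ∀ i ∈ s, MDifferentiableAt (𝓡 n) 𝓘(ℝ, ℝ) (f i) x) :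
    MDifferentiableAt (𝓡 n) 𝓘(ℝ, ℝ) (fun z => ∑ i ∈ s, f i z) x := by
  classical
  induction s using Finset.induction_on with
  | empty => simpa using mdifferentiableAt_const
  | insert a s ha ih =>
    simp only [Finset.sum_insert ha]
    exact (hf a (Finset.mem_insert_self _ _)).add
      (ih fun i hi => hf i (Finset.mem_insert_of_mem hi))

theorem mvfderiv_prod_apply [DecidableEq ι] (s : Finset ι) {f : ι → M → ℝ}
    (hf : ∀ i ∈ s, MDifferentiableAt (𝓡 n) 𝓘(ℝ, ℝ) (f i) x) :
    MDifferentiableAt (𝓡 n) 𝓘(ℝ, ℝ) (fun z => ∏ i ∈ s, f i z) x ∧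
    mvfderiv (𝓡 n) (fun z => ∏ i ∈ s, f i z) x v =
      ∑ i ∈ s, (∏ j ∈ s.erase i, f j x) * mvfderiv (𝓡 n) (f i) x v := by
  induction s using Finset.induction_on with
  | empty =>
    simp only [Finset.prod_empty, Finset.sum_empty, mvfderiv_const]
    exact ⟨mdifferentiableAt_const, rfl⟩
  | insert a s ha ih =>
    have h1 := hf a (Finset.mem_insert_self _ _)
    obtain ⟨h2, h3⟩ := ih fun i hi => hf i (Finset.mem_insert_of_mem hi)
    simp only [Finset.prod_insert ha]
    refine ⟨h1.mul h2, ?_⟩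
    rw [mvfderiv_mul_apply h1 h2, h3, Finset.sum_insert ha, Finset.erase_insert ha,
      mul_comm (∏ j ∈ s, f j x), Finset.mul_sum]
    congr 1
    refine Finset.sum_congr rfl fun i hi => ?_
    have hia : a ≠ i := fun h => ha (h ▸ hi)
    rw [Finset.erase_insert_of_ne hia, Finset.prod_insert (fun h => ha (Finset.mem_of_mem_erase h)),
      mul_assoc]

theorem MatDiff.mul [Fintype κ] {S : M → Matrix ι κ ℝ} {T : M → Matrix κ l ℝ}
    (hS : MatDiff n S x) (hT : MatDiff n T x) : MatDiff n (fun y => S y * T y) x := fun i j => by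
  simp only [Matrix.mul_apply]
  exact mdiff_sum fun k _ => mdiff_mul (hS i k) (hT k j)

theorem MatDiff.transpose {S : M → Matrix ι κ ℝ} (hS : MatDiff n S x) :
    MatDiff n (fun y => (S y).transpose) x := fun i j => hS j i

theorem dMat_transpose (S : M → Matrix ι κ ℝ) :
    dMat (fun y => (S y).transpose) x v = (dMat S x v).transpose := rfl

theorem dMat_mul [Fintype κ] {S : M → Matrix ι κ ℝ} {T : M → Matrix κ l ℝ}
    (hS : MatDiff n S x) (hT : MatDiff n T x) :
    dMat (fun y => S y * T y) x v = dMat S x v * T x + S x * dMat T x v := by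
  ext i j
  simp only [dMat, Matrix.of_apply, Matrix.mul_apply, Matrix.add_apply]
  rw [mvfderiv_sum_apply _ fun k _ => mdiff_mul (hS i k) (hT k j), ← Finset.sum_add_distrib]
  exact Finset.sum_congr rfl fun k _ => mvfderiv_mul_apply (hS i k) (hT k j) v

theorem dMat_const (S : Matrix ι κ ℝ) : dMat (fun _ : M => S) x v = 0 := by
  ext i j
  simp [dMat, mvfderiv_const]

/-- The derivative of the determinant at the identity matrix is the trace. -/
theorem mvfderiv_det [Fintype ι] [DecidableEq ι] {S : M → Matrix ι ι ℝ} (hS : MatDiff n S x)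
    (h1 : S x = 1) : MDifferentiableAt (𝓡 n) 𝓘(ℝ, ℝ) (fun y => (S y).det) x ∧
      mvfderiv (𝓡 n) (fun y => (S y).det) x v = (dMat S x v).trace := by
  simp only [Matrix.det_apply']
  have hp := fun σ : Equiv.Perm ι => mvfderiv_prod_apply (v := v) Finset.univ
    (f := fun i y => S y (σ i) i) fun i _ => hS (σ i) i
  have hd := fun σ : Equiv.Perm ι =>
    mdiff_mul (mdifferentiableAt_const (c := ((Equiv.Perm.sign σ : ℤ) : ℝ))) (hp σ).1
  refine ⟨mdiff_sum fun σ _ => hd σ, ?_⟩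
  rw [mvfderiv_sum_apply _ fun σ _ => hd σ]
  rw [Finset.sum_eq_single 1]
  · rw [mvfderiv_mul_apply mdifferentiableAt_const (hp 1).1, (hp 1).2]
    simp [h1, mvfderiv_const, Matrix.trace, dMat]
  · intro σ _ hσ
    rw [mvfderiv_mul_apply mdifferentiableAt_const (hp σ).1, (hp σ).2, mvfderiv_const]
    -- A nontrivial permutation moves at least two indices, so after one factor is removed an
    -- off-diagonal entry of the identity matrix is still present.
    have : ∀ i, ∏ j ∈ Finset.univ.erase i, S x (σ j) j = 0 := by
      intro i
      obtain ⟨j, hj⟩ : ∃ j, σ j ≠ j := by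
        by_contra! hc
        exact hσ (Equiv.ext hc)
      by_cases hji : j = i
      · refine Finset.prod_eq_zero (i := σ j) (Finset.mem_erase.2 ⟨hji ▸ hj, Finset.mem_univ _⟩) ?_
        rw [h1, Matrix.one_apply_ne fun h => hj (σ.injective h)]
      · refine Finset.prod_eq_zero (i := j) (Finset.mem_erase.2 ⟨hji, Finset.mem_univ _⟩) ?_
        rw [h1, Matrix.one_apply_ne hj]
    simp [this]
  · simp

theorem mvfderiv_abs_rpow {f : M → ℝ} (hf : MDifferentiableAt (𝓡 n) 𝓘(ℝ, ℝ) f x) (h1 : f x = 1)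
    (r : ℝ) : MDifferentiableAt (𝓡 n) 𝓘(ℝ, ℝ) (fun y => |f y| ^ r) x ∧
      mvfderiv (𝓡 n) (fun y => |f y| ^ r) x v = r * mvfderiv (𝓡 n) f x v := by
  have hpos : ∀ᶠ y in 𝓝 x, 0 < f y :=
    hf.continuousAt.eventually (by rw [h1]; exact lt_mem_nhds one_pos)
  have he : (fun y => |f y| ^ r) =ᶠ[𝓝 x] fun y => f y ^ r :=
    hpos.mono fun y hy => by simp only [abs_of_pos hy]
  have hd : HasDerivAt (fun t : ℝ => t ^ r) r (f x) := by
    have := Real.hasDerivAt_rpow_const (x := f x) (p := r) (Or.inl (by rw [h1]; exact one_ne_zero))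
    simpa [h1] using this
  have hm : MDifferentiableAt 𝓘(ℝ, ℝ) 𝓘(ℝ, ℝ) (fun t : ℝ => t ^ r) (f x) :=
    hd.differentiableAt.mdifferentiableAt
  refine ⟨mdiff_congr (hm.comp x hf) he, ?_⟩
  rw [mvfderiv_congr he]
  have := mvfderiv_comp_apply x hm hf v
  change mvfderiv (𝓡 n) ((fun t : ℝ => t ^ r) ∘ f) x v = _
  rw [this]
  have h3 : mvfderiv 𝓘(ℝ, ℝ) (fun t : ℝ => t ^ r) (f x) = fderiv ℝ (fun t : ℝ => t ^ r) (f x) :=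
    mfderiv_eq_fderiv
  rw [h3, hd.hasFDerivAt.fderiv]
  change mvfderiv (𝓡 n) f x v * r = _
  rw [mul_comm]

/-- Covariance of the covariant derivative under a change of gauge. -/
theorem dact_gauge (κ : Kind) {S S' G : M → TMat n} (hS : MatDiff n S x) (hS' : MatDiff n S' x)
    (hG : MatDiff n G x) (hu : ∀ᶠ y in 𝓝 x, IsUnit (G y).det)
    (h : ∀ᶠ y in 𝓝 x, S' y = κ.act (G y) (S y)) {A A' : TMat n}
    (hd : dMat G x v = G x * A - A' * G x) :
    dMat S' x v + κ.dact A' (S' x) = κ.act (G x) (dMat S x v + κ.dact A (S x)) := by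
  have hdt : (dMat G x v).transpose = A.transpose * (G x).transpose
      - (G x).transpose * A'.transpose := by
    rw [hd]
    simp
  cases κ with
  | up =>
    simp only [act_up] at h
    rw [dMat_congr h, h.self_of_nhds, dMat_mul (hG.mul hS) hG.transpose, dMat_mul hG hS,
      dMat_transpose, hdt, hd, act_up, dact_up, dact_up]
    noncomm_ring
  | down =>
    -- In the dual case the inverse relation `S = Gᵀ S' G` is differentiated, so that no derivative
    -- of `G⁻¹` is needed.
    have h' : ∀ᶠ y in 𝓝 x, S y = (G y).transpose * S' y * G y := by
      filter_upwards [h, hu] with y hy hy'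
      rw [hy, act_down]
      have h1 := Matrix.nonsing_inv_mul _ hy'
      have h2 : (G y).transpose * (G y)⁻¹.transpose = 1 := by
        rw [← Matrix.transpose_mul, h1, Matrix.transpose_one]
      calc S y = ((G y).transpose * (G y)⁻¹.transpose) * S y * ((G y)⁻¹ * G y) := by
            rw [h1, h2, one_mul, mul_one]
        _ = _ := by simp only [Matrix.mul_assoc]
    have key : dMat S x v + Kind.down.dact A (S x) =
        (G x).transpose * (dMat S' x v + Kind.down.dact A' (S' x)) * G x := by
      rw [dMat_congr h', h'.self_of_nhds, dMat_mul (hG.transpose.mul hS') hG,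
        dMat_mul hG.transpose hS', dMat_transpose, hdt, hd, dact_down, dact_down]
      noncomm_ring
    rw [key, act_down]
    have h1 := Matrix.mul_nonsing_inv _ hu.self_of_nhds
    have h2 : (G x)⁻¹.transpose * (G x).transpose = 1 := by
      rw [← Matrix.transpose_mul, h1, Matrix.transpose_one]
    set W := dMat S' x v + Kind.down.dact A' (S' x)
    calc W = ((G x)⁻¹.transpose * (G x).transpose) * W * (G x * (G x)⁻¹) := by
          rw [h1, h2, one_mul, mul_one]
      _ = _ := by simp only [Matrix.mul_assoc]

end MatrixDerivative

/-! ### Covariance of the tractor connection under changes of frame and connection. -/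

section TractorConnection

variable {n : ℕ} {M : Type*} [TopologicalSpace M] [ChartedSpace (EuclideanSpace ℝ (Fin n)) M]
  [IsManifold (𝓡 n) ∞ M] {x y : M} {p : ProjectiveStructure n M} {κ : Kind}

/-- The matrix of the tractor connection in the direction `v` with respect to the local frame
`e`. -/
def tractorConn (D : AffineConnection n M) (e : ∀ y : M, Frame n y) (y : M)
    (v : TangentSpace (𝓡 n) y) : TMat n :=
  Matrix.fromBlocks (connMat D e y v) (Matrix.of fun i _ => (e y).repr v i)
      (Matrix.of fun _ j => -∑ c, (e y).repr v c * schouten D (e y) c j) 0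
    - ((1 : ℝ) / (n + 1) * (connMat D e y v).trace) • (1 : TMat n)

theorem tractorConnMatrix_eq (D : AffineConnection n M) (b : Frame n x) (c : Fin n) :
    tractorConnMatrix D b c = tractorConn D (frameExt b) x (b c) := by
  have h : (connMat D (frameExt b) x (b c)) = Matrix.of fun i j => connCoeff D b c i j := by
    ext i j
    rw [Matrix.of_apply, connCoeff_eq]
  simp only [tractorConn, tractorConnMatrix, h, frameExt_self, Basis.repr_self,
    Finsupp.single_apply, Matrix.trace, Matrix.diag_apply, Matrix.of_apply]
  congr 2
  congr 1
  · ext i j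
    simp [eq_comm]
  · ext i j
    simp

theorem connMat_sum (D : AffineConnection n M) (e : ∀ y : M, Frame n y) (y : M)
    {ι : Type*} (s : Finset ι) (a : ι → ℝ) (v : ι → TangentSpace (𝓡 n) y) :
    connMat D e y (∑ i ∈ s, a i • v i) = ∑ i ∈ s, a i • connMat D e y (v i) := by
  ext i j
  simp [connMat, Matrix.sum_apply, Finsupp.coe_finsetSum]

theorem tractorConn_sum (D : AffineConnection n M) (e : ∀ y : M, Frame n y) (y : M)
    {ι : Type*} (s : Finset ι) (a : ι → ℝ) (v : ι → TangentSpace (𝓡 n) y) :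
    tractorConn D e y (∑ i ∈ s, a i • v i) = ∑ i ∈ s, a i • tractorConn D e y (v i) := by
  simp only [tractorConn, connMat_sum, smul_sub, Finset.sum_sub_distrib, smul_smul,
    Matrix.trace_sum, Matrix.trace_smul, Finset.mul_sum, Finset.sum_smul]
  congr 1
  · ext i j
    rcases i with i | i <;> rcases j with j | j <;>
      simp [Matrix.sum_apply, Finsupp.coe_finsetSum, Finset.sum_mul, Finset.mul_sum, mul_assoc]
    exact Finset.sum_comm
  · refine Finset.sum_congr rfl fun i _ => ?_
    congr 1
    simp
    ring

/-- The covariant derivative of a section in the direction `v`, computed in the local frame `e`. -/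
def tractorDeriv (p : ProjectiveStructure n M) (κ : Kind) (H : ∀ x : M, FormComp p 0 x)
    (D : p.conns) (e : ∀ y : M, Frame n y) (y : M) (v : TangentSpace (𝓡 n) y) : TMat n :=
  dMat (fun z => H z (D, e z) ![]) y v + κ.dact (tractorConn D.1 e y v) (H y (D, e y) ![])

theorem tractorD_eq (H : ∀ x : M, FormComp p 0 x) (D : p.conns) (b : Frame n x)
    (J : Fin 1 → Fin n) :
    tractorD p κ H x (D, b) J = tractorDeriv p κ H D (frameExt b) x (b (J 0)) := by
  simp only [tractorD, tractorDeriv, tractorConnMatrix_eq, frameExt_self]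
  rfl

theorem tractorDeriv_sum (H : ∀ x : M, FormComp p 0 x) (D : p.conns) (e : ∀ y : M, Frame n y)
    (y : M) {ι : Type*} (s : Finset ι) (a : ι → ℝ) (v : ι → TangentSpace (𝓡 n) y) :
    tractorDeriv p κ H D e y (∑ i ∈ s, a i • v i) = ∑ i ∈ s, a i • tractorDeriv p κ H D e y (v i) := by
  simp only [tractorDeriv, tractorConn_sum, dact_sum, dact_smul, smul_add, Finset.sum_add_distrib]
  congr 1
  ext i j
  simp [dMat, Matrix.sum_apply]

theorem IsSmoothFormSection.smF {k : ℕ} {φ : ∀ x : M, FormComp p k x}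
    (h : IsSmoothFormSection p κ k φ) (D : p.conns) (b : Frame n x)
    (hy : y ∈ (chartAt (EuclideanSpace ℝ (Fin n)) x).source) (J : Fin k → Fin n) (A B : TIdx n) :
    SmF n (fun z => φ z (D, frameExt b z) J A B) y :=
  (chart_source_mem hy).mono fun _ hz => (h.2 x D b J A B).contMDiffAt
    ((chartAt (EuclideanSpace ℝ (Fin n)) x).open_source.mem_nhds hz)

theorem smF_iff_contMDiffOn {f : M → ℝ} :
    (∀ y ∈ (chartAt (EuclideanSpace ℝ (Fin n)) x).source, SmF n f y) ↔
      ContMDiffOn (𝓡 n) 𝓘(ℝ, ℝ) ∞ f (chartAt (EuclideanSpace ℝ (Fin n)) x).source := by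
  refine ⟨fun h y hy => (h y hy).contMDiffAt.contMDiffWithinAt, fun h y hy => ?_⟩
  exact (chart_source_mem hy).mono fun _ hz => h.contMDiffAt
    ((chartAt (EuclideanSpace ℝ (Fin n)) x).open_source.mem_nhds hz)

variable {H : ∀ x : M, FormComp p 0 x}

theorem IsSmoothFormSection.matDiff (h : IsSmoothFormSection p κ 0 H) (D : p.conns) (b : Frame n x)
    (hy : y ∈ (chartAt (EuclideanSpace ℝ (Fin n)) x).source) :
    MatDiff n (fun z => H z (D, frameExt b z) ![]) y :=
  fun A B => (h.smF D b hy ![] A B).mdiff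

theorem moveForm_zero {x : M} (b b' : Frame n x) (u : TangentSpace (𝓡 n) x →L[ℝ] ℝ)
    (g : (Fin 0 → Fin n) → TMat n) :
    moveForm b b' u κ g ![] = κ.act (tractorTransition b b' u) (g ![]) := by
  simp only [moveForm, Finset.univ_unique, Finset.sum_singleton, Finset.univ_eq_empty,
    Finset.prod_empty, one_smul]
  rfl

theorem zero_form_change {H : FormComp p 0 x} (h : H ∈ form p κ 0 x) {f f' : TFrame p x}
    {Υ : ∀ y : M, TangentSpace (𝓡 n) y →L[ℝ] ℝ} (hΥ : IsProjectiveChange f.1.1 f'.1.1 Υ) :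
    H f' ![] = κ.act (tractorTransition f.2 f'.2 (Υ x)) (H f ![]) := by
  rw [form_change h hΥ, moveForm_zero]

theorem zero_form_frame {H : FormComp p 0 x} (h : H ∈ form p κ 0 x) (D : p.conns)
    (b b' : Frame n x) :
    H (D, b') ![] = κ.act (tractorTransition b b' 0) (H (D, b) ![]) :=
  zero_form_change h (f := (D, b)) (f' := (D, b')) (Υ := fun _ => 0) (IsProjectiveChange.refl D.1)

theorem zero_form_conn {H : FormComp p 0 x} (h : H ∈ form p κ 0 x) {D D' : p.conns}
    {Υ : ∀ y : M, TangentSpace (𝓡 n) y →L[ℝ] ℝ} (hΥ : IsProjectiveChange D.1 D'.1 Υ)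
    (b : Frame n x) :
    H (D', b) ![] = κ.act (tractorTransition b b (Υ x)) (H (D, b) ![]) :=
  zero_form_change h (f := (D, b)) (f' := (D', b)) hΥ

/-- This differentiates a tractor transition at a point where the two frames agree. The determinant
factor contributes the trace of `dA` divided by `n+1`, which is what the weight term of the
connection requires. -/
theorem dMat_smul_fromBlocks {v : TangentSpace (𝓡 n) y} {A B : M → Matrix (Fin n) (Fin n) ℝ}
    (hAd : MatDiff n A y) (hBd : MatDiff n B y) (hA1 : A y = 1) (hB1 : B y = 1) (G : M → TMat n)
    (hG : ∀ z, G z = |(A z).det| ^ ((1 : ℝ) / (n + 1)) • Matrix.fromBlocks (B z) 0 0 1) :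
    MatDiff n G y ∧ dMat G y v = ((1 : ℝ) / (n + 1) * (dMat A y v).trace) • (1 : TMat n) +
      Matrix.fromBlocks (dMat B y v) 0 0 0 := by
  obtain rfl : G = _ := funext hG
  obtain ⟨hdet, hdet'⟩ := mvfderiv_det (v := v) hAd hA1
  obtain ⟨hpow, hpow'⟩ := mvfderiv_abs_rpow (v := v) hdet (by rw [hA1, Matrix.det_one])
    ((1 : ℝ) / (n + 1))
  rw [hdet'] at hpow'
  have hdet1 : |(A y).det| ^ ((1 : ℝ) / (n + 1)) = 1 := by
    rw [hA1, Matrix.det_one, abs_one, Real.one_rpow]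
  constructor
  · intro i j
    rcases i with i | i <;> rcases j with j | j
    · exact mdiff_mul hpow (hBd i j)
    · exact mdiff_mul hpow mdifferentiableAt_const
    · exact mdiff_mul hpow mdifferentiableAt_const
    · exact mdiff_mul hpow mdifferentiableAt_const
  · ext i j
    rcases i with i | i <;> rcases j with j | j
    · refine (mvfderiv_mul_apply hpow (hBd i j) v).trans ?_
      rw [hpow', hdet1, hB1]
      simp [dMat, Matrix.one_apply]
    · refine (mvfderiv_mul_apply (g := fun _ => (0 : ℝ)) hpow mdifferentiableAt_const v).trans ?_
      simp [mvfderiv_const]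
    · refine (mvfderiv_mul_apply (g := fun _ => (0 : ℝ)) hpow mdifferentiableAt_const v).trans ?_
      simp [mvfderiv_const]
    · refine (mvfderiv_mul_apply (g := fun _ => (1 : ℝ)) hpow mdifferentiableAt_const v).trans ?_
      rw [mvfderiv_const, hpow']
      simp

/-- The tractor derivative does not depend on the extension of a frame at `y`. -/
theorem tractorDeriv_frameExt [T2Space M] (h : IsSmoothFormSection p κ 0 H) (D : p.conns)
    (b : Frame n x) (hy : y ∈ (chartAt (EuclideanSpace ℝ (Fin n)) x).source)
    (v : TangentSpace (𝓡 n) y) :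
    tractorDeriv p κ H D (frameExt (frameExt b y)) y v =
      tractorDeriv p κ H D (frameExt b) y v := by
  -- The frame extended anew from `y` agrees with the old one at `y` but not to first order. The
  -- transition `G` is thus the identity at `y` with a nonzero derivative, which `hconn` and the
  -- change of the trace must absorb.
  set b' := frameExt b y with hb'
  have hy' := mem_chart_source (EuclideanSpace ℝ (Fin n)) y
  set G : M → TMat n := fun z => tractorTransition (frameExt b z) (frameExt b' z) 0 with hG
  set A : M → Matrix (Fin n) (Fin n) ℝ := fun z => (frameExt b z).toMatrix (frameExt b' z) with hA
  set B : M → Matrix (Fin n) (Fin n) ℝ := fun z => (frameExt b' z).toMatrix (frameExt b z) with hB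
  have hAd : MatDiff n A y := fun i j => (smF_toMatrix b b' hy hy' i j).mdiff
  have hBd : MatDiff n B y := fun i j => (smF_toMatrix b' b hy' hy i j).mdiff
  have hA1 : A y = 1 := by simp [hA, hb']
  have hB1 : B y = 1 := by simp [hB, hb']
  have hAB : ∀ z, A z * B z = 1 := fun z => by
    simp only [hA, hB, Basis.toMatrix_mul_toMatrix, Basis.toMatrix_self]
  have hdB : dMat B y v = - dMat A y v := by
    have h1 : dMat (fun z => A z * B z) y v = 0 := by
      simp only [hAB]
      exact dMat_const _
    rw [dMat_mul hAd hBd, hA1, hB1, mul_one, one_mul] at h1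
    exact eq_neg_of_add_eq_zero_right h1
  have hG1 : G y = 1 := by
    simp only [hG, hb', frameExt_self]
    exact tractorTransition_self _
  obtain ⟨hGd, hdG⟩ := dMat_smul_fromBlocks (v := v) hAd hBd hA1 hB1 G fun z => by
    simp only [hG, tractorTransition, _root_.zero_apply, neg_zero]
    rfl
  rw [hdB] at hdG
  have hconn : connMat D.1 (frameExt b') y v = connMat D.1 (frameExt b) y v + dMat A y v := by
    have := connMat_frame D.1 b b' hy hy' v
    change A y * _ = _ * A y + dMat A y v at this
    rwa [hA1, one_mul, mul_one] at this
  have hbb : frameExt b' y = frameExt b y := by rw [hb', frameExt_self]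
  have hu : ∀ z, IsUnit (G z).det := fun z => isUnit_det_tractorTransition _ _ _
  have hHG : ∀ z, H z (D, frameExt b' z) ![] = κ.act (G z) (H z (D, frameExt b z) ![]) :=
    fun z => zero_form_frame (h.1 z) D _ _
  have key := dact_gauge κ (h.matDiff D b hy) (h.matDiff D b' hy') hGd
    (Eventually.of_forall hu) (Eventually.of_forall hHG)
    (v := v) (A := tractorConn D.1 (frameExt b) y v) (A' := tractorConn D.1 (frameExt b') y v) (by
      rw [hdG, hG1, one_mul, mul_one]
      simp only [tractorConn, hconn, hbb, Matrix.trace_add, mul_add, add_smul]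
      rw [sub_sub_sub_comm, sub_eq_add_neg (Matrix.fromBlocks _ _ _ _), Matrix.fromBlocks_neg,
        Matrix.fromBlocks_add]
      simp only [add_neg_cancel, neg_zero, add_zero, neg_add, add_neg_cancel_left]
      abel)
  unfold tractorDeriv
  rw [key]
  change κ.act (G y) _ = _
  rw [hG1, act_one]

/-- Covariance of the tractor derivative under a constant change of frame. -/
theorem tractorDeriv_frame [T2Space M] (h : IsSmoothFormSection p κ 0 H) (D : p.conns)
    (b b' : Frame n x) (v : TangentSpace (𝓡 n) x) :
    tractorDeriv p κ H D (frameExt b') x v =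
      κ.act (tractorTransition b b' 0) (tractorDeriv p κ H D (frameExt b) x v) := by
  have hx := mem_chart_source (EuclideanSpace ℝ (Fin n)) x
  set A := b.toMatrix b' with hA
  set B := b'.toMatrix b with hB
  have hBA : B * A = 1 := by rw [hA, hB, Basis.toMatrix_mul_toMatrix, Basis.toMatrix_self]
  have hAB : A * B = 1 := by rw [hA, hB, Basis.toMatrix_mul_toMatrix, Basis.toMatrix_self]
  set G := tractorTransition b b' (0 : TangentSpace (𝓡 n) x →L[ℝ] ℝ) with hG
  have hGz : ∀ z, tractorTransition (frameExt b z) (frameExt b' z) 0 = G := fun z => by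
    simp [hG, tractorTransition, frameExt_toMatrix]
  have hconn : A * connMat D.1 (frameExt b') x v = connMat D.1 (frameExt b) x v * A := by
    have := connMat_frame D.1 b b' hx hx v
    simp only [frameExt_toMatrix, mvfderiv_const] at this
    rw [this, ← hA]
    have h0 : (Matrix.of fun i j => (0 : TangentSpace (𝓡 n) x →L[ℝ] ℝ) v :
      Matrix (Fin n) (Fin n) ℝ) = 0 := rfl
    rw [h0, add_zero]
  have hconn' : B * connMat D.1 (frameExt b) x v = connMat D.1 (frameExt b') x v * B := by
    calc B * connMat D.1 (frameExt b) x v = B * (connMat D.1 (frameExt b) x v * A) * B := by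
          rw [Matrix.mul_assoc B, Matrix.mul_assoc _ A, hAB, mul_one]
      _ = _ := by rw [← hconn, ← Matrix.mul_assoc, hBA, one_mul]
  have htr : (connMat D.1 (frameExt b') x v).trace = (connMat D.1 (frameExt b) x v).trace := by
    calc _ = (B * (A * connMat D.1 (frameExt b') x v)).trace := by
          rw [← Matrix.mul_assoc, hBA, one_mul]
      _ = _ := by rw [hconn, Matrix.trace_mul_comm, Matrix.mul_assoc, hAB, mul_one]
  have hrepr : ∀ i, ∑ j, B i j * b.repr v j = b'.repr v i := fun i =>
    congrFun (Basis.toMatrix_mulVec_repr b b' v) i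
  have hrepr' : ∀ i, ∑ j, A i j * b'.repr v j = b.repr v i := fun i =>
    congrFun (Basis.toMatrix_mulVec_repr b' b v) i
  have hP : Matrix.of (schouten D.1 b') * B = A.transpose * Matrix.of (schouten D.1 b) := by
    rw [schouten_frame D.1 b b', ← hA, Matrix.mul_assoc, hAB, mul_one]
  have hP' : ∀ j, ∑ k, (∑ c, b'.repr v c * schouten D.1 b' c k) * B k j =
      ∑ c, b.repr v c * schouten D.1 b c j := by
    intro j
    calc _ = ∑ c, b'.repr v c * (Matrix.of (schouten D.1 b') * B) c j := by
          simp only [Matrix.mul_apply, Matrix.of_apply, Finset.mul_sum, Finset.sum_mul, mul_assoc]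
          exact Finset.sum_comm
      _ = ∑ c, ∑ k, b'.repr v c * (A k c * schouten D.1 b k j) := by
          rw [hP]
          simp only [Matrix.mul_apply, Matrix.of_apply, Finset.mul_sum, Matrix.transpose_apply]
      _ = _ := by
          rw [Finset.sum_comm]
          refine Finset.sum_congr rfl fun k _ => ?_
          rw [← hrepr', Finset.sum_mul]
          exact Finset.sum_congr rfl fun c _ => by ring
  have hcomm : G * tractorConn D.1 (frameExt b) x v = tractorConn D.1 (frameExt b') x v * G := by
    simp only [tractorConn, htr, Matrix.mul_sub, Matrix.sub_mul, Matrix.mul_smul, Matrix.smul_mul,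
      mul_one, one_mul, frameExt_self]
    congr 1
    simp only [hG, tractorTransition, Matrix.mul_smul, Matrix.smul_mul]
    congr 1
    rw [← hB]
    ext i j
    rcases i with i | i <;> rcases j with j | j
    · simpa [Matrix.fromBlocks_multiply, Matrix.mul_apply] using congrFun (congrFun hconn' i) j
    · simpa [Matrix.fromBlocks_multiply, Matrix.mul_apply] using hrepr i
    · simpa [Matrix.fromBlocks_multiply, Matrix.mul_apply] using (hP' j).symm
    · simp [Matrix.mul_apply]
  have hu : IsUnit G.det := isUnit_det_tractorTransition _ _ _
  have hHG : ∀ z, H z (D, frameExt b' z) ![] = κ.act G (H z (D, frameExt b z) ![]) := fun z => by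
    rw [← hGz z]
    exact zero_form_frame (h.1 z) D _ _
  have key := dact_gauge κ (h.matDiff D b hx) (h.matDiff D b' hx) (G := fun _ => G)
    (fun _ _ => mdifferentiableAt_const)
    (Eventually.of_forall fun _ => hu) (Eventually.of_forall hHG)
    (v := v) (A := tractorConn D.1 (frameExt b) x v) (A' := tractorConn D.1 (frameExt b') x v) (by
      rw [dMat_const, hcomm, sub_self])
  exact key

/-- Covariance of the tractor derivative under a change of the connection. -/
theorem tractorDeriv_change [T2Space M] (hn : 2 ≤ n) (h : IsSmoothFormSection p κ 0 H)
    {D D' : p.conns} {Υ : ∀ y : M, TangentSpace (𝓡 n) y →L[ℝ] ℝ}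
    (hΥ : IsProjectiveChange D.1 D'.1 Υ) (b : Frame n x) (c : Fin n) :
    tractorDeriv p κ H D' (frameExt b) x (b c) =
      κ.act (tractorTransition b b (Υ x)) (tractorDeriv p κ H D (frameExt b) x (b c)) := by
  have hx := mem_chart_source (EuclideanSpace ℝ (Fin n)) x
  set G : M → TMat n := fun z => tractorTransition (frameExt b z) (frameExt b z) (Υ z) with hG
  have hGz : ∀ z, G z = Matrix.fromBlocks 1 0 (Matrix.of fun _ j => - Υ z (frameExt b z j)) 1 := by
    intro z
    simp [hG, tractorTransition]
  have hUd : ∀ j, MDifferentiableAt (𝓡 n) 𝓘(ℝ, ℝ) (fun z => - Υ z (frameExt b z j)) x :=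
    fun j => (hΥ.smF (smV_frameExt b hx j)).neg.mdiff
  have hGd : MatDiff n G x := by
    rw [funext hGz]
    intro i j
    rcases i with i | i <;> rcases j with j | j
    · exact mdifferentiableAt_const
    · exact mdifferentiableAt_const
    · exact hUd j
    · exact mdifferentiableAt_const
  have hdG : dMat G x (b c) = Matrix.fromBlocks 0 0 (Matrix.of fun _ j =>
      - mvfderiv (𝓡 n) (fun z => Υ z (frameExt b z j)) x (b c)) 0 := by
    rw [funext hGz]
    ext i j
    rcases i with i | i <;> rcases j with j | j
    · simp [dMat, mvfderiv_const]
    · simp [dMat, mvfderiv_const]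
    · simp only [dMat, Matrix.of_apply, Matrix.fromBlocks_apply₂₁]
      exact mvfderiv_neg_apply _
    · simp [dMat, mvfderiv_const]
  have hconn := connMat_projectiveChange hΥ b hx (b c)
  have hcov : ∀ j, ∑ k, Υ x (b k) * connMat D.1 (frameExt b) x (b c) k j =
      Υ x (D.1.toCov (fun y => frameExt b y j) x (b c)) := by
    intro j
    conv_rhs => rw [← Basis.sum_repr b (D.1.toCov (fun y => frameExt b y j) x (b c))]
    simp only [connMat, map_sum, map_smul, smul_eq_mul, frameExt_self, Matrix.of_apply]
    exact Finset.sum_congr rfl fun k _ => mul_comm _ _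
  have hn1 : (n : ℝ) + 1 ≠ 0 := by positivity
  -- The trace of the connection matrix changes by `(n+1) Υ(e_c)`, so the weight term changes by
  -- `Υ(e_c)` and cancels the scalar part `Υ(e_c) • 1` of the projective change.
  have htr : (1 : ℝ) / (n + 1) * (connMat D'.1 (frameExt b) x (b c)).trace =
      1 / (n + 1) * (connMat D.1 (frameExt b) x (b c)).trace + Υ x (b c) := by
    rw [hconn, Matrix.trace_add, Matrix.trace_add, Matrix.trace_smul, Matrix.trace_one]
    simp only [frameExt_self, Matrix.trace, Matrix.diag_apply, Matrix.of_apply, Basis.repr_self,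
      Finsupp.single_apply]
    simp
    field_simp
    ring
  have hu : ∀ z, IsUnit (G z).det := fun z => isUnit_det_tractorTransition _ _ _
  have hHG : ∀ z, H z (D', frameExt b z) ![] = κ.act (G z) (H z (D, frameExt b z) ![]) :=
    fun z => zero_form_conn (h.1 z) hΥ _
  -- The gauge condition is checked by blocks. In the lower left one, the derivative of `Υ(e_j)`,
  -- the term `Υ ∘ Γ` and the product `Υ Υ` are compensated by the change of the Schouten tensor.
  have key := dact_gauge κ (h.matDiff D b hx) (h.matDiff D' b hx) hGd
    (Eventually.of_forall hu) (Eventually.of_forall hHG)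
    (v := b c) (A := tractorConn D.1 (frameExt b) x (b c))
    (A' := tractorConn D'.1 (frameExt b) x (b c)) (by
      rw [hdG, hGz]
      simp only [tractorConn]
      rw [htr]
      simp only [hconn, frameExt_self, Basis.repr_self]
      ext i j
      rcases i with i | i <;> rcases j with j | j
      · simp [Matrix.fromBlocks_multiply, Matrix.mul_apply, Matrix.add_apply, Matrix.mul_sub,
          Matrix.sub_mul, Finsupp.single_apply]
        ring
      · simp [Matrix.fromBlocks_multiply, Matrix.mul_sub, Matrix.sub_mul, Finsupp.single_apply]
      · simp [Matrix.fromBlocks_multiply, Matrix.mul_apply, Matrix.mul_sub,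
          Matrix.sub_mul, Finsupp.single_apply, hcov, schouten_projectiveChange hn hΥ]
        ring
      · simp [Matrix.fromBlocks_multiply, Matrix.mul_apply, Matrix.mul_sub, Matrix.sub_mul,
          Finsupp.single_apply]
        ring)
  unfold tractorDeriv
  rw [key]
  change κ.act (G x) _ = _
  simp only [hG, frameExt_self]

end TractorConnection

/-! ### Smooth sections, and stability under the tractor connection and the codifferential. -/

section SmoothSections

variable {n : ℕ} {M : Type*} [TopologicalSpace M] [ChartedSpace (EuclideanSpace ℝ (Fin n)) M]
  [IsManifold (𝓡 n) ∞ M] {x y : M} {p : ProjectiveStructure n M} {κ : Kind}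
  {H : ∀ x : M, FormComp p 0 x}

/-- The tractor connection maps sections of the bundle to one-forms with values in the bundle. -/
theorem tractorD_mem [T2Space M] (hn : 2 ≤ n) (h : IsSmoothFormSection p κ 0 H) (x : M) :
    tractorD p κ H x ∈ form p κ 1 x := by
  refine ⟨fun f J => ?_, fun f J σ => alternating_of_subsingleton (tractorD p κ H x f) J σ,
    fun f f' Υ hΥ J => ?_⟩
  · have hs : ∀ z f, (H z f ![]).IsSymm := fun z f => (h.1 z).1 f ![]
    refine Matrix.IsSymm.add ?_ (dact_isSymm κ _ (hs x f))
    refine Matrix.IsSymm.ext fun i j => ?_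
    simp only [Matrix.of_apply]
    congr 2
    funext z
    exact (hs z _).apply i j
  · obtain ⟨D, b⟩ := f
    obtain ⟨D', b'⟩ := f'
    simp only [tractorD_eq]
    -- A general change of tractor frame is a change of connection in a fixed frame followed by a
    -- change of frame for a fixed connection.
    have hT : tractorTransition b b' (Υ x) =
        tractorTransition b b' 0 * tractorTransition b b (Υ x) := by
      rw [tractorTransition_mul, add_zero]
    rw [tractorDeriv_frame h D' b b' (b' (J 0)), basis_apply_eq_sum b b' (J 0), tractorDeriv_sum,
      map_sum]
    rw [← (Equiv.funUnique (Fin 1) (Fin n)).symm.sum_comp]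
    refine Finset.sum_congr rfl fun i _ => ?_
    rw [map_smul, tractorDeriv_change hn h hΥ b i, ← act_mul, ← hT]
    simp

variable (n) in
/-- Entrywise smoothness of a matrix-valued function near a point. -/
def SmMat {ι κ : Type*} (S : M → Matrix ι κ ℝ) (x : M) : Prop :=
  ∀ i j, SmF n (fun y => S y i j) x

theorem SmMat.mul {ι κ l : Type*} [Fintype κ] {S : M → Matrix ι κ ℝ} {T : M → Matrix κ l ℝ}
    (hS : SmMat n S x) (hT : SmMat n T x) : SmMat n (fun y => S y * T y) x := fun i j => by
  simp only [Matrix.mul_apply]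
  exact SmF.sum fun k _ => (hS i k).mul (hT k j)

theorem SmMat.add {ι κ : Type*} {S T : M → Matrix ι κ ℝ}
    (hS : SmMat n S x) (hT : SmMat n T x) : SmMat n (fun y => S y + T y) x := fun i j =>
  (hS i j).add (hT i j)

theorem SmMat.neg {ι κ : Type*} {S : M → Matrix ι κ ℝ}
    (hS : SmMat n S x) : SmMat n (fun y => - S y) x := fun i j => (hS i j).neg

theorem SmMat.transpose {ι κ : Type*} {S : M → Matrix ι κ ℝ}
    (hS : SmMat n S x) : SmMat n (fun y => (S y).transpose) x := fun i j => hS j i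

theorem SmMat.dact {A S : M → TMat n} (κ : Kind) (hA : SmMat n A x) (hS : SmMat n S x) :
    SmMat n (fun y => κ.dact (A y) (S y)) x := by
  cases κ with
  | up =>
    simp only [dact_up]
    exact (hA.mul hS).add (hS.mul hA.transpose)
  | down =>
    simp only [dact_down]
    exact ((hA.transpose.mul hS).add (hS.mul hA)).neg

theorem smMat_tractorConn [T2Space M] (D : AffineConnection n M) (b : Frame n x)
    (hy : y ∈ (chartAt (EuclideanSpace ℝ (Fin n)) x).source) (c : Fin n) :
    SmMat n (fun z => tractorConn D (frameExt b) z (frameExt b z c)) y := by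
  have hΓ := smF_connMat D b hy c
  have hP := smF_schouten D b hy
  have htr : SmF n (fun z => (1 : ℝ) / (n + 1) *
      (connMat D (frameExt b) z (frameExt b z c)).trace) y :=
    (smF_const _).mul (SmF.sum fun i _ => hΓ i i)
  intro i j
  refine SmF.sub ?_ (htr.mul (smF_const _))
  rcases i with i | i <;> rcases j with j | j
  · exact hΓ i j
  · simp only [Matrix.fromBlocks_apply₁₂, Matrix.of_apply, Basis.repr_self]
    exact smF_const _
  · simp only [Matrix.fromBlocks_apply₂₁, Matrix.of_apply, Basis.repr_self]
    exact (SmF.sum fun c _ => (smF_const _).mul (hP c j)).neg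
  · exact smF_const _

theorem tractorD_frameExt [T2Space M] (h : IsSmoothFormSection p κ 0 H) (D : p.conns)
    (b : Frame n x) (hy : y ∈ (chartAt (EuclideanSpace ℝ (Fin n)) x).source) (J : Fin 1 → Fin n) :
    tractorD p κ H y (D, frameExt b y) J =
      tractorDeriv p κ H D (frameExt b) y (frameExt b y (J 0)) := by
  rw [tractorD_eq, tractorDeriv_frameExt h D b hy]

/-- The tractor connection preserves smoothness. -/
theorem IsSmoothFormSection.tractorD [T2Space M] (hn : 2 ≤ n) (h : IsSmoothFormSection p κ 0 H) :
    IsSmoothFormSection p κ 1 (tractorD p κ H) := by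
  refine ⟨fun x => tractorD_mem hn h x, fun x D b J A B => ?_⟩
  rw [← smF_iff_contMDiffOn]
  intro y hy
  have h1 : SmMat n (fun z => tractorDeriv p κ H D (frameExt b) z (frameExt b z (J 0))) y := by
    refine SmMat.add (fun i j => ?_)
      (SmMat.dact κ (smMat_tractorConn D.1 b hy (J 0)) fun i j => h.smF D b hy ![] i j)
    exact (h.smF D b hy ![] i j).mvfderiv D.1 (smV_frameExt b hy (J 0))
  refine (h1 A B).congr ?_
  filter_upwards [chart_source_mem hy] with z hz
  rw [tractorD_frameExt h D b hz]

theorem IsSmoothFormSection.codiff {k : ℕ} {φ : ∀ x : M, FormComp p (k + 1) x}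
    (h : IsSmoothFormSection p κ (k + 1) φ) :
    IsSmoothFormSection p κ k (fun x => codiff p κ k x (φ x)) := by
  refine ⟨fun x => codiff_mem (h.1 x), fun x D b J A B => ?_⟩
  rw [← smF_iff_contMDiffOn]
  intro y hy
  simp only [codiff_apply, Matrix.sum_apply]
  exact SmF.sum fun c _ => SmMat.dact κ (A := fun _ => tractorNil c) (fun i j => smF_const _)
    (fun i j => h.smF D b hy (Fin.cons c J) i j) A B

theorem IsSmoothFormSection.sub_smul {k : ℕ} {φ ψ : ∀ x : M, FormComp p k x}
    (h : IsSmoothFormSection p κ k φ) (h' : IsSmoothFormSection p κ k ψ) (r : ℝ) :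
    IsSmoothFormSection p κ k (fun x => φ x - r • ψ x) := by
  refine ⟨fun x => sub_mem (h.1 x) (Submodule.smul_mem _ r (h'.1 x)), fun x D b J A B => ?_⟩
  exact (h.2 x D b J A B).sub (contMDiffOn_const.mul (h'.2 x D b J A B))

variable [T2Space M]

/-- Extension of a field of components given with respect to one connection in the class to all
tractor frames. -/
theorem exists_section (D₀ : p.conns) (S : ∀ x : M, Frame n x → TMat n)
    (hs : ∀ x b, (S x b).IsSymm)
    (hS : ∀ x b b', S x b' = κ.act (tractorTransition b b' 0) (S x b))
    (hsm : ∀ (x : M) (b : Frame n x), ∀ y ∈ (chartAt (EuclideanSpace ℝ (Fin n)) x).source,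
      SmMat n (fun z => S z (frameExt b z)) y) :
    ∃ H : ∀ x : M, FormComp p 0 x, IsSmoothFormSection p κ 0 H ∧
      ∀ x b, H x (D₀, b) ![] = S x b := by
  choose Υ hΥ using fun D : p.conns => p.exists_change D₀ D
  refine ⟨fun x f _ => κ.act (tractorTransition f.2 f.2 (Υ f.1 x)) (S x f.2),
    ⟨fun x => ⟨fun f J => act_isSymm κ _ (hs x _), fun f J σ => ?_, fun f f' Υ' h J => ?_⟩,
      fun x D b J A B => ?_⟩, fun x b => ?_⟩
  · exact alternating_of_subsingleton
      (fun _ => κ.act (tractorTransition f.2 f.2 (Υ f.1 x)) (S x f.2)) J σ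
  · have hu : Υ f'.1 x = Υ f.1 x + Υ' x := (hΥ f'.1).unique ((hΥ f.1).trans h)
    obtain rfl : J = ![] := Subsingleton.elim _ _
    have := moveForm_zero (κ := κ) f.2 f'.2 (Υ' x)
      (fun _ => κ.act (tractorTransition f.2 f.2 (Υ f.1 x)) (S x f.2))
    refine Eq.trans ?_ this.symm
    change κ.act (tractorTransition f'.2 f'.2 (Υ f'.1 x)) (S x f'.2) = _
    rw [hS x f.2 f'.2, ← act_mul, ← act_mul, tractorTransition_mul, tractorTransition_mul, hu,
      zero_add]
  · rw [← smF_iff_contMDiffOn]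
    intro y hy
    have hT : ∀ u : ∀ z : M, TangentSpace (𝓡 n) z →L[ℝ] ℝ,
        (∀ j, SmF n (fun z => u z (frameExt b z j)) y) →
        SmMat n (fun z => tractorTransition (frameExt b z) (frameExt b z) (u z)) y := by
      intro u hu i j
      simp only [tractorTransition, Basis.toMatrix_self, Matrix.det_one, abs_one, Real.one_rpow,
        one_smul]
      rcases i with i | i <;> rcases j with j | j
      · exact smF_const _
      · exact smF_const _
      · exact (hu j).neg
      · exact smF_const _
    have h1 := hT (Υ D) fun j => (hΥ D).smF (smV_frameExt b hy j)
    have h2 := hT (fun z => - Υ D z) fun j => ((hΥ D).smF (smV_frameExt b hy j)).neg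
    cases κ with
    | up =>
      simp only [act_up]
      exact ((h1.mul (hsm x b y hy)).mul h1.transpose) A B
    | down =>
      simp only [act_down, tractorTransition_inv]
      exact ((h2.transpose.mul (hsm x b y hy)).mul h2) A B
  · have hu : Υ D₀ x = 0 := (hΥ D₀).unique (IsProjectiveChange.refl D₀.1)
    simp only [hu, tractorTransition_self, act_one]

end SmoothSections

/-! ### The tractor derivative slot by slot. -/

section SlotFormulas

variable {n : ℕ} {M : Type*} [TopologicalSpace M] [ChartedSpace (EuclideanSpace ℝ (Fin n)) M]
  [IsManifold (𝓡 n) ∞ M] {x y : M} {p : ProjectiveStructure n M} {κ : Kind}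
  {H : ∀ x : M, FormComp p 0 x}

/-- The covariant derivative in components with respect to a local frame `e`, in the direction of
the `c`-th member of the frame. -/
def covE (D : AffineConnection n M) {k l : ℕ} (w : ℝ) (F : ∀ x : M, Frame n x → Comp n k l)
    (e : ∀ y : M, Frame n y) (y : M) (c : Fin n) : Comp n k l := fun I J =>
  mvfderiv (𝓡 n) (fun z => F z (e z) I J) y (e y c)
    + ∑ r, ∑ d, connMat D e y (e y c) (I r) d * F y (e y) (Function.update I r d) J
    - ∑ s, ∑ d, connMat D e y (e y c) d (J s) * F y (e y) I (Function.update J s d)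
    + w / (n + 1) * (connMat D e y (e y c)).trace * F y (e y) I J

theorem covD_eq (D : AffineConnection n M) {k l : ℕ} (w : ℝ)
    (F : ∀ x : M, Frame n x → Comp n k l) (b : Frame n x) (I : Fin k → Fin n)
    (J : Fin (l + 1) → Fin n) :
    covD D w F x b I J = covE D w F (frameExt b) x (J 0) I (Fin.tail J) := by
  simp only [covD, covE, connCoeff_eq, frameExt_self, Matrix.trace, Matrix.diag_apply]

/-- The slots of a section of `S²𝒯`, resp. `S²𝒯*`, as fields of components. -/
def upTop (H : ∀ x : M, FormComp p 0 x) (D : p.conns) : ∀ x : M, Frame n x → Comp n 2 0 :=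
  fun x b I _ => H x (D, b) ![] (Sum.inl (I 0)) (Sum.inl (I 1))

/-- Another slot of a section, as a field of components. -/
def upMid (H : ∀ x : M, FormComp p 0 x) (D : p.conns) : ∀ x : M, Frame n x → Comp n 1 0 :=
  fun x b I _ => H x (D, b) ![] (Sum.inl (I 0)) (Sum.inr ())

/-- Another slot of a section, as a field of components. -/
def downTop (H : ∀ x : M, FormComp p 0 x) (D : p.conns) : ∀ x : M, Frame n x → Comp n 0 0 :=
  fun x b _ _ => H x (D, b) ![] (Sum.inr ()) (Sum.inr ())

/-- Another slot of a section, as a field of components. -/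
def downMid (H : ∀ x : M, FormComp p 0 x) (D : p.conns) : ∀ x : M, Frame n x → Comp n 0 1 :=
  fun x b _ J => H x (D, b) ![] (Sum.inl (J 0)) (Sum.inr ())

variable (D : p.conns) (e : ∀ y : M, Frame n y) (y : M) (c : Fin n)

theorem form_swap {k : ℕ} {φ : FormComp p k x} (h : φ ∈ form p κ k x) (f : TFrame p x)
    (J : Fin k → Fin n) (i : Fin n) :
    φ f J (Sum.inr ()) (Sum.inl i) = φ f J (Sum.inl i) (Sum.inr ()) :=
  (h.1 f J).apply _ _

/-- The scalar part of the connection matrix acts on both tractor indices and supplies the density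
term of weight `-2`; the block `δ_c` couples to the next slot. Only the top and middle slots of the
derivative are computed, since `∂*` does not see the bottom one. -/
theorem tractorDeriv_up_top (h : H y ∈ form p .up 0 y) (a d : Fin n) :
    tractorDeriv p .up H D e y (e y c) (Sum.inl a) (Sum.inl d) =
      covE D.1 (-2) (upTop H D) e y c ![a, d] ![]
      + (if a = c then H y (D, e y) ![] (Sum.inl d) (Sum.inr ()) else 0)
      + (if d = c then H y (D, e y) ![] (Sum.inl a) (Sum.inr ()) else 0) := by
  simp only [tractorDeriv, dact_up, Matrix.add_apply, Matrix.mul_apply, Matrix.transpose_apply,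
    Fintype.sum_sum_type, tractorConn, Matrix.sub_apply, sub_mul, mul_sub, Finset.sum_sub_distrib]
  simp [form_swap h, Matrix.one_apply, Finsupp.single_apply, covE, upTop, Fin.sum_univ_two, dMat,
    eq_comm (a := c), mul_comm (H y (D, e y) ![] _ _)]
  ring

theorem tractorDeriv_up_mid (a : Fin n) :
    tractorDeriv p .up H D e y (e y c) (Sum.inl a) (Sum.inr ()) =
      covE D.1 (-2) (upMid H D) e y c ![a] ![]
      - ∑ d, schouten D.1 (e y) c d * H y (D, e y) ![] (Sum.inl a) (Sum.inl d)
      + (if a = c then H y (D, e y) ![] (Sum.inr ()) (Sum.inr ()) else 0) := by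
  simp only [tractorDeriv, dact_up, Matrix.add_apply, Matrix.mul_apply, Matrix.transpose_apply,
    Fintype.sum_sum_type, tractorConn, Matrix.sub_apply, sub_mul, mul_sub, Finset.sum_sub_distrib]
  simp [Matrix.one_apply, Finsupp.single_apply, covE, upMid, dMat,
    eq_comm (a := c), mul_comm (H y (D, e y) ![] _ _)]
  ring

theorem tractorDeriv_down_top (h : H y ∈ form p .down 0 y) :
    tractorDeriv p .down H D e y (e y c) (Sum.inr ()) (Sum.inr ()) =
      covE D.1 2 (downTop H D) e y c ![] ![]
      - 2 * H y (D, e y) ![] (Sum.inl c) (Sum.inr ()) := by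
  simp only [tractorDeriv, dact_down, Matrix.add_apply, Matrix.mul_apply, Matrix.transpose_apply,
    Fintype.sum_sum_type, tractorConn, Matrix.sub_apply, sub_mul, mul_sub, Finset.sum_sub_distrib,
    Matrix.neg_apply]
  simp [form_swap h, Finsupp.single_apply, covE, downTop, dMat]
  ring

theorem tractorDeriv_down_mid (a : Fin n) :
    tractorDeriv p .down H D e y (e y c) (Sum.inl a) (Sum.inr ()) =
      covE D.1 2 (downMid H D) e y c ![] ![a]
      + schouten D.1 (e y) c a * H y (D, e y) ![] (Sum.inr ()) (Sum.inr ())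
      - H y (D, e y) ![] (Sum.inl a) (Sum.inl c) := by
  simp only [tractorDeriv, dact_down, Matrix.add_apply, Matrix.mul_apply, Matrix.transpose_apply,
    Fintype.sum_sum_type, tractorConn, Matrix.sub_apply, sub_mul, mul_sub, Finset.sum_sub_distrib,
    Matrix.neg_apply]
  simp [Matrix.one_apply, Finsupp.single_apply, covE, downMid, dMat,
    eq_comm (a := c), mul_comm (H y (D, e y) ![] _ _)]
  ring

end SlotFormulas

/-! ### The triangular operator `∂* d^∇`: uniqueness and existence of the splitting. -/

section Splitting

variable {n : ℕ} {M : Type*} [TopologicalSpace M] [ChartedSpace (EuclideanSpace ℝ (Fin n)) M]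
  [IsManifold (𝓡 n) ∞ M] {x y : M} {p : ProjectiveStructure n M} {κ : Kind}
  {H H' : ∀ x : M, FormComp p 0 x}

theorem tractorD_cons (D : p.conns) (b : Frame n x) (i : Fin n) :
    tractorD p κ H x (D, b) (Fin.cons i ![]) =
      tractorDeriv p κ H D (frameExt b) x (frameExt b x i) := by
  rw [tractorD_eq, frameExt_self]
  rfl

theorem covD_vec_zero (D : AffineConnection n M) {k : ℕ} (w : ℝ)
    (F : ∀ x : M, Frame n x → Comp n k 0) (b : Frame n x) (I : Fin k → Fin n) (c : Fin n) :
    covD D w F x b I ![c] = covE D w F (frameExt b) x c I ![] := by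
  rw [covD_eq, Subsingleton.elim (Fin.tail ![c]) ![]]
  rfl

theorem covD_vec_one (D : AffineConnection n M) {k : ℕ} (w : ℝ)
    (F : ∀ x : M, Frame n x → Comp n k 1) (b : Frame n x) (I : Fin k → Fin n) (c d : Fin n) :
    covD D w F x b I ![c, d] = covE D w F (frameExt b) x c I ![d] := by
  rw [covD_eq]
  rfl

/-- The composition of the tractor connection with `∂*`, on sections. -/
def codiffD (p : ProjectiveStructure n M) (κ : Kind) (H : ∀ x : M, FormComp p 0 x) (x : M) :
    FormComp p 0 x :=
  codiff p κ 0 x (tractorD p κ H x)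

theorem codiffD_apply (f : TFrame p x) :
    codiffD p κ H x f ![] = ∑ c, κ.dact (tractorNil c) (tractorD p κ H x f (Fin.cons c ![])) := rfl

section Slots

variable (D : p.conns) (b : Frame n x)

theorem codiff_up_top (a d : Fin n) :
    codiffD p .up H x (D, b) ![] (Sum.inl a) (Sum.inl d) = 0 := by
  rw [codiffD_apply]
  exact nil_up_top _ _ _ _

/-- The trace of `δ_c^a λ^b + δ_c^b λ^a` over `b = c` is `(n+1) λ^a`: this is the first diagonal
constant. -/
theorem codiff_up_mid (h : H x ∈ form p .up 0 x) (j : Fin n) :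
    codiffD p .up H x (D, b) ![] (Sum.inl j) (Sum.inr ()) =
      ∑ i, covD D.1 (-2) (upTop H D) x b ![j, i] ![i]
        + (n + 1) * H x (D, b) ![] (Sum.inl j) (Sum.inr ()) := by
  rw [codiffD_apply, nil_up_mid]
  simp only [tractorD_cons, tractorDeriv_up_top D _ _ _ h, covD_vec_zero]
  simp only [frameExt_self]
  simp only [Finset.sum_add_distrib]
  simp
  ring

/-- The factor `2` counts the two off-diagonal blocks, which agree because `d^∇ H` is symmetric, and
`n` is the trace of the identity. -/
theorem codiff_up_bot (hn : 2 ≤ n) [T2Space M] (h : IsSmoothFormSection p .up 0 H) :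
    codiffD p .up H x (D, b) ![] (Sum.inr ()) (Sum.inr ()) =
      2 * (∑ i, covD D.1 (-2) (upMid H D) x b ![i] ![i]
        - ∑ i, ∑ d, schouten D.1 b i d * H x (D, b) ![] (Sum.inl i) (Sum.inl d)
        + n * H x (D, b) ![] (Sum.inr ()) (Sum.inr ())) := by
  rw [codiffD_apply, nil_up_bot]
  simp only [form_swap (tractorD_mem hn h x)]
  simp only [tractorD_cons, tractorDeriv_up_mid, covD_vec_zero]
  simp only [frameExt_self]
  simp only [Finset.sum_add_distrib, Finset.sum_sub_distrib]
  simp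
  ring

theorem codiff_down_top :
    codiffD p .down H x (D, b) ![] (Sum.inr ()) (Sum.inr ()) = 0 := by
  rw [codiffD_apply]
  exact nil_down_top _ _

theorem codiff_down_mid (h : H x ∈ form p .down 0 x) (j : Fin n) :
    codiffD p .down H x (D, b) ![] (Sum.inl j) (Sum.inr ()) =
      2 * H x (D, b) ![] (Sum.inl j) (Sum.inr ()) - covD D.1 2 (downTop H D) x b ![] ![j] := by
  rw [codiffD_apply, nil_down_mid]
  simp only [tractorD_cons, tractorDeriv_down_top D _ _ _ h, covD_vec_zero]
  simp only [frameExt_self]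
  ring

/-- Only the symmetrized Hessian and the symmetrized Schouten tensor can appear, because the result
is a symmetric matrix. -/
theorem codiff_down_bot (hn : 2 ≤ n) [T2Space M] (h : IsSmoothFormSection p .down 0 H)
    (a d : Fin n) :
    codiffD p .down H x (D, b) ![] (Sum.inl a) (Sum.inl d) =
      2 * H x (D, b) ![] (Sum.inl a) (Sum.inl d)
        - (covD D.1 2 (downMid H D) x b ![] ![a, d] + covD D.1 2 (downMid H D) x b ![] ![d, a]
        + (schouten D.1 b a d + schouten D.1 b d a) * H x (D, b) ![] (Sum.inr ()) (Sum.inr ())) := by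
  rw [codiffD_apply, nil_down_bot]
  simp only [form_swap (tractorD_mem hn h x)]
  simp only [tractorD_cons, tractorDeriv_down_mid, covD_vec_one]
  simp only [frameExt_self]
  rw [((h.1 x).1 (D, b) ![]).apply (Sum.inl a) (Sum.inl d)]
  ring

end Slots

theorem section_ext (h : ∀ x, H x ∈ form p κ 0 x) (h' : ∀ x, H' x ∈ form p κ 0 x)
    (h1 : ∀ x D b a c, H x (D, b) ![] (Sum.inl a) (Sum.inl c) =
      H' x (D, b) ![] (Sum.inl a) (Sum.inl c))
    (h2 : ∀ x D b a, H x (D, b) ![] (Sum.inl a) (Sum.inr ()) =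
      H' x (D, b) ![] (Sum.inl a) (Sum.inr ()))
    (h3 : ∀ x D b, H x (D, b) ![] (Sum.inr ()) (Sum.inr ()) =
      H' x (D, b) ![] (Sum.inr ()) (Sum.inr ())) : H = H' := by
  funext x ⟨D, b⟩ J
  rw [Subsingleton.elim J ![]]
  exact ext_slots ((h x).1 _ _) ((h' x).1 _ _) (h1 x D b) (h2 x D b) (h3 x D b)

variable [T2Space M] (hn : 2 ≤ n)
include hn

/-- With equal top slots the middle equation, divided by `n+1`, forces equal middle slots. The
bottom equation then forces equal bottom slots. -/
theorem eq_of_codiff_up (h : IsSmoothFormSection p .up 0 H) (h' : IsSmoothFormSection p .up 0 H')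
    (hK : ∀ x, codiffD p .up H x = 0)
    (hK' : ∀ x, codiffD p .up H' x = 0)
    (ht : ∀ x D b a c, H x (D, b) ![] (Sum.inl a) (Sum.inl c) =
      H' x (D, b) ![] (Sum.inl a) (Sum.inl c)) : H = H' := by
  have hn1 : (n : ℝ) + 1 ≠ 0 := by positivity
  have hn0 : (n : ℝ) ≠ 0 := by positivity
  have hT : upTop H = upTop H' := by
    funext D x b I _
    exact ht x D b _ _
  have hm : ∀ x D b a, H x (D, b) ![] (Sum.inl a) (Sum.inr ()) =
      H' x (D, b) ![] (Sum.inl a) (Sum.inr ()) := by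
    intro x D b a
    have h1 := codiff_up_mid D b (h.1 x) a
    have h2 := codiff_up_mid D b (h'.1 x) a
    rw [hT] at h1
    rw [hK] at h1
    rw [hK'] at h2
    exact mul_left_cancel₀ hn1 (add_left_cancel (h1.symm.trans h2))
  have hM : upMid H = upMid H' := by
    funext D x b I _
    exact hm x D b _
  refine section_ext h.1 h'.1 ht hm fun x D b => ?_
  have h1 := codiff_up_bot D b hn h
  have h2 := codiff_up_bot D b hn h'
  rw [hK] at h1
  rw [hK'] at h2
  simp only [hM, ht] at h1
  exact mul_left_cancel₀ hn0 (add_left_cancel (mul_left_cancel₀ two_ne_zero (h1.symm.trans h2)))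

theorem eq_of_codiff_down (h : IsSmoothFormSection p .down 0 H)
    (h' : IsSmoothFormSection p .down 0 H')
    (hK : ∀ x, codiffD p .down H x = 0)
    (hK' : ∀ x, codiffD p .down H' x = 0)
    (ht : ∀ x D b, H x (D, b) ![] (Sum.inr ()) (Sum.inr ()) =
      H' x (D, b) ![] (Sum.inr ()) (Sum.inr ())) : H = H' := by
  have hT : downTop H = downTop H' := by
    funext D x b _ _
    exact ht x D b
  have hm : ∀ x D b a, H x (D, b) ![] (Sum.inl a) (Sum.inr ()) =
      H' x (D, b) ![] (Sum.inl a) (Sum.inr ()) := by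
    intro x D b a
    have h1 := codiff_down_mid D b (h.1 x) a
    have h2 := codiff_down_mid D b (h'.1 x) a
    rw [hT] at h1
    rw [hK] at h1
    rw [hK'] at h2
    exact mul_left_cancel₀ two_ne_zero (sub_left_injective (h1.symm.trans h2))
  have hM : downMid H = downMid H' := by
    funext D x b _ J
    exact hm x D b _
  refine section_ext h.1 h'.1 (fun x D b a c => ?_) hm ht
  have h1 := codiff_down_bot D b hn h a c
  have h2 := codiff_down_bot D b hn h' a c
  rw [hK] at h1
  rw [hK'] at h2
  simp only [hM, ht] at h1
  exact mul_left_cancel₀ two_ne_zero (sub_left_injective (h1.symm.trans h2))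

/-- Subtracting `1/(n+1)` of `∂* d^∇ H` leaves the top slot alone and makes the middle slot of the
new `∂* d^∇` vanish. Subtracting `1/(2n)` of the latter then changes only the bottom slot and
removes what is left. Each correction is itself a smooth section, so invariance of the result is
automatic. -/
theorem exists_codiff_up (h : IsSmoothFormSection p .up 0 H) :
    ∃ H', IsSmoothFormSection p .up 0 H' ∧
      (∀ x, codiffD p .up H' x = 0) ∧
      ∀ x D b a c, H' x (D, b) ![] (Sum.inl a) (Sum.inl c) =
        H x (D, b) ![] (Sum.inl a) (Sum.inl c) := by
  have hn1 : (n : ℝ) + 1 ≠ 0 := by positivity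
  have hn0 : (n : ℝ) ≠ 0 := by positivity
  have hKs : ∀ {H}, IsSmoothFormSection p .up 0 H → IsSmoothFormSection p .up 0 (codiffD p .up H) :=
    fun h => (h.tractorD hn).codiff
  obtain ⟨H₁, hH₁⟩ : ∃ H₁, H₁ = fun x => H x - (1 / ((n : ℝ) + 1)) • codiffD p .up H x := ⟨_, rfl⟩
  obtain ⟨H₂, hH₂⟩ : ∃ H₂, H₂ = fun x => H₁ x - (1 / (2 * (n : ℝ))) • codiffD p .up H₁ x := ⟨_, rfl⟩
  have s₁ : IsSmoothFormSection p .up 0 H₁ := hH₁ ▸ h.sub_smul (hKs h) _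
  have s₂ : IsSmoothFormSection p .up 0 H₂ := hH₂ ▸ s₁.sub_smul (hKs s₁) _
  have e₁ : ∀ x D b A B, H₁ x (D, b) ![] A B =
      H x (D, b) ![] A B - 1 / ((n : ℝ) + 1) * codiffD p .up H x (D, b) ![] A B := by
    intro x D b A B
    rw [hH₁]
    rfl
  have e₂ : ∀ x D b A B, H₂ x (D, b) ![] A B =
      H₁ x (D, b) ![] A B - 1 / (2 * (n : ℝ)) * codiffD p .up H₁ x (D, b) ![] A B := by
    intro x D b A B
    rw [hH₂]
    rfl
  have t₁ : ∀ x D b a c, H₁ x (D, b) ![] (Sum.inl a) (Sum.inl c) =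
      H x (D, b) ![] (Sum.inl a) (Sum.inl c) := fun x D b a c => by
    rw [e₁, codiff_up_top, mul_zero, sub_zero]
  have t₂ : ∀ x D b a c, H₂ x (D, b) ![] (Sum.inl a) (Sum.inl c) =
      H₁ x (D, b) ![] (Sum.inl a) (Sum.inl c) := fun x D b a c => by
    rw [e₂, codiff_up_top, mul_zero, sub_zero]
  have T₁ : upTop H₁ = upTop H := by
    funext D x b I _
    exact t₁ x D b _ _
  have T₂ : upTop H₂ = upTop H₁ := by
    funext D x b I _
    exact t₂ x D b _ _
  have m₁ : ∀ x D b a, codiffD p .up H₁ x (D, b) ![] (Sum.inl a) (Sum.inr ()) = 0 := fun x D b a => by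
    rw [codiff_up_mid D b (s₁.1 x), e₁, T₁]
    rw [codiff_up_mid D b (h.1 x)]
    field_simp
    ring
  have m₂ : ∀ x D b a, H₂ x (D, b) ![] (Sum.inl a) (Sum.inr ()) =
      H₁ x (D, b) ![] (Sum.inl a) (Sum.inr ()) := fun x D b a => by
    rw [e₂, m₁, mul_zero, sub_zero]
  have M₂ : upMid H₂ = upMid H₁ := by
    funext D x b I _
    exact m₂ x D b _
  refine ⟨H₂, s₂, fun x => ?_, fun x D b a c => by rw [t₂, t₁]⟩
  refine congrFun (section_ext (H := codiffD p .up H₂) (H' := fun x => 0) (hKs s₂).1 (fun _ => zero_mem _)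
    (fun x D b a c => codiff_up_top D b a c) (fun x D b a => ?_) fun x D b => ?_) x
  · refine Eq.trans ?_ (m₁ x D b a)
    rw [codiff_up_mid D b (s₁.1 x), codiff_up_mid D b (s₂.1 x), T₂, m₂]
  · refine Eq.trans ?_ (rfl : (0 : ℝ) = _)
    rw [codiff_up_bot D b hn s₂, e₂, M₂]
    rw [codiff_up_bot D b hn s₁]
    simp only [t₂]
    field_simp
    ring

/-- Both nonzero diagonal constants are `2`. Two corrections are still made, because the derivative
of the corrected middle slot enters the bottom equation. -/
theorem exists_codiff_down (h : IsSmoothFormSection p .down 0 H) :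
    ∃ H', IsSmoothFormSection p .down 0 H' ∧
      (∀ x, codiffD p .down H' x = 0) ∧
      ∀ x D b, H' x (D, b) ![] (Sum.inr ()) (Sum.inr ()) =
        H x (D, b) ![] (Sum.inr ()) (Sum.inr ()) := by
  have hKs : ∀ {H}, IsSmoothFormSection p .down 0 H → IsSmoothFormSection p .down 0 (codiffD p .down H) :=
    fun h => (h.tractorD hn).codiff
  obtain ⟨H₁, hH₁⟩ : ∃ H₁, H₁ = fun x => H x - (1 / 2 : ℝ) • codiffD p .down H x := ⟨_, rfl⟩
  obtain ⟨H₂, hH₂⟩ : ∃ H₂, H₂ = fun x => H₁ x - (1 / 2 : ℝ) • codiffD p .down H₁ x := ⟨_, rfl⟩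
  have s₁ : IsSmoothFormSection p .down 0 H₁ := hH₁ ▸ h.sub_smul (hKs h) _
  have s₂ : IsSmoothFormSection p .down 0 H₂ := hH₂ ▸ s₁.sub_smul (hKs s₁) _
  have e₁ : ∀ x D b A B, H₁ x (D, b) ![] A B =
      H x (D, b) ![] A B - 1 / 2 * codiffD p .down H x (D, b) ![] A B := by
    intro x D b A B
    rw [hH₁]
    rfl
  have e₂ : ∀ x D b A B, H₂ x (D, b) ![] A B =
      H₁ x (D, b) ![] A B - 1 / 2 * codiffD p .down H₁ x (D, b) ![] A B := by
    intro x D b A B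
    rw [hH₂]
    rfl
  have t₁ : ∀ x D b, H₁ x (D, b) ![] (Sum.inr ()) (Sum.inr ()) =
      H x (D, b) ![] (Sum.inr ()) (Sum.inr ()) := fun x D b => by
    rw [e₁, codiff_down_top, mul_zero, sub_zero]
  have t₂ : ∀ x D b, H₂ x (D, b) ![] (Sum.inr ()) (Sum.inr ()) =
      H₁ x (D, b) ![] (Sum.inr ()) (Sum.inr ()) := fun x D b => by
    rw [e₂, codiff_down_top, mul_zero, sub_zero]
  have T₁ : downTop H₁ = downTop H := by
    funext D x b _ _
    exact t₁ x D b
  have T₂ : downTop H₂ = downTop H₁ := by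
    funext D x b _ _
    exact t₂ x D b
  have m₁ : ∀ x D b a, codiffD p .down H₁ x (D, b) ![] (Sum.inl a) (Sum.inr ()) = 0 := fun x D b a => by
    rw [codiff_down_mid D b (s₁.1 x), e₁, T₁]
    rw [codiff_down_mid D b (h.1 x)]
    ring
  have m₂ : ∀ x D b a, H₂ x (D, b) ![] (Sum.inl a) (Sum.inr ()) =
      H₁ x (D, b) ![] (Sum.inl a) (Sum.inr ()) := fun x D b a => by
    rw [e₂, m₁, mul_zero, sub_zero]
  have M₂ : downMid H₂ = downMid H₁ := by
    funext D x b _ J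
    exact m₂ x D b _
  refine ⟨H₂, s₂, fun x => ?_, fun x D b => by rw [t₂, t₁]⟩
  refine congrFun (section_ext (H := codiffD p .down H₂) (H' := fun x => 0) (hKs s₂).1 (fun _ => zero_mem _)
    (fun x D b a c => ?_) (fun x D b a => ?_) fun x D b => codiff_down_top D b) x
  · refine Eq.trans ?_ (rfl : (0 : ℝ) = _)
    rw [codiff_down_bot D b hn s₂, e₂, M₂]
    rw [codiff_down_bot D b hn s₁, t₂]
    ring
  · refine Eq.trans ?_ (m₁ x D b a)
    rw [codiff_down_mid D b (s₁.1 x), codiff_down_mid D b (s₂.1 x), T₂, m₂]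

end Splitting

/-! ### The trace of the curvature and the skew part of the Schouten tensor. -/

section Trace

variable {n : ℕ} {M : Type*} [TopologicalSpace M] [ChartedSpace (EuclideanSpace ℝ (Fin n)) M]
  [IsManifold (𝓡 n) ∞ M] [T2Space M] {x : M} (D : AffineConnection n M) (b : Frame n x)

theorem mlieBracket_frameExt (a c : Fin n) :
    mlieBracket (𝓡 n) (fun z => frameExt b z a) (fun z => frameExt b z c) x =
      ∑ d, (connMat D (frameExt b) x (b a) d c - connMat D (frameExt b) x (b c) d a) • b d := by
  have he := smV_frameExt b (mem_chart_source (EuclideanSpace ℝ (Fin n)) x)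
  rw [mlieBracket_eq D (he a) (he c)]
  simp only [sub_smul, Finset.sum_sub_distrib, connMat, Matrix.of_apply, frameExt_self,
    Basis.sum_repr]

/-- The trace of the curvature is the curvature of the connection induced on `Λⁿ TM`. -/
theorem trace_curvature (a c : Fin n) :
    ∑ d, curvature D b a c d d =
      mvfderiv (𝓡 n) (fun z => (connMat D (frameExt b) z (frameExt b z c)).trace) x (b a)
      - mvfderiv (𝓡 n) (fun z => (connMat D (frameExt b) z (frameExt b z a)).trace) x (b c)
      - ∑ d, (connMat D (frameExt b) x (b a) d c - connMat D (frameExt b) x (b c) d a) *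
        (connMat D (frameExt b) x (b d)).trace := by
  have hx := mem_chart_source (EuclideanSpace ℝ (Fin n)) x
  have he := smV_frameExt b hx
  have hΓ := smF_connMat D b hx
  have hcov : ∀ i j k l, b.repr (D.toCov (fun y => D.toCov (fun z => frameExt b z l) y
      (frameExt b y j)) x (b i)) k =
      mvfderiv (𝓡 n) (fun z => connMat D (frameExt b) z (frameExt b z j) k l) x (b i) +
      (connMat D (frameExt b) x (b i) * connMat D (frameExt b) x (b j)) k l := by
    intro i j k l
    have hs : (fun y => D.toCov (fun z => frameExt b z l) y (frameExt b y j)) =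
        fun y => ∑ m, connMat D (frameExt b) y (frameExt b y j) m l • frameExt b y m := by
      funext y
      simp only [connMat, Matrix.of_apply, Basis.sum_repr]
    rw [hs, cov_sum D _ fun m _ => (he m).smul (hΓ j m l)]
    simp only [_root_.sum_apply, cov_smul D (hΓ j _ l) (he _), map_sum, map_add, map_smul,
      Finsupp.coe_finsetSum, Finset.sum_apply, Finsupp.coe_add, Pi.add_apply, Finsupp.coe_smul,
      Pi.smul_apply, smul_eq_mul, frameExt_self, Basis.repr_self, Finset.sum_add_distrib,
      Finsupp.single_apply, Matrix.mul_apply]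
    rw [add_comm]
    congr 1
    · simp
    · refine Finset.sum_congr rfl fun m _ => ?_
      simp only [connMat, Matrix.of_apply, frameExt_self, mul_comm]
  have hcurv : ∀ d, curvature D b a c d d =
      mvfderiv (𝓡 n) (fun z => connMat D (frameExt b) z (frameExt b z c) d d) x (b a)
      - mvfderiv (𝓡 n) (fun z => connMat D (frameExt b) z (frameExt b z a) d d) x (b c)
      + ((connMat D (frameExt b) x (b a) * connMat D (frameExt b) x (b c)) d d
      - (connMat D (frameExt b) x (b c) * connMat D (frameExt b) x (b a)) d d)
      - connMat D (frameExt b) x (∑ d, (connMat D (frameExt b) x (b a) d c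
        - connMat D (frameExt b) x (b c) d a) • b d) d d := by
    intro d
    simp only [curvature, mlieBracket_frameExt D b, map_sub, Finsupp.coe_sub, Pi.sub_apply,
      frameExt_self, hcov]
    simp only [connMat, Matrix.of_apply, frameExt_self]
    ring
  have htr : ∀ i j, mvfderiv (𝓡 n) (fun z => (connMat D (frameExt b) z (frameExt b z j)).trace) x
      (b i) = ∑ d, mvfderiv (𝓡 n) (fun z => connMat D (frameExt b) z (frameExt b z j) d d) x
      (b i) := fun i j => mvfderiv_sum_apply _ (fun d _ => (hΓ j d d).mdiff) _
  -- The quadratic terms form a commutator of connection matrices, which has zero trace.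
  have hcomm : ∑ d, ((connMat D (frameExt b) x (b a) * connMat D (frameExt b) x (b c)) d d
      - (connMat D (frameExt b) x (b c) * connMat D (frameExt b) x (b a)) d d) = 0 := by
    rw [Finset.sum_sub_distrib, sub_eq_zero]
    exact Matrix.trace_mul_comm _ _
  simp only [hcurv, Finset.sum_add_distrib, Finset.sum_sub_distrib, htr] at hcomm ⊢
  rw [hcomm, add_zero]
  congr 1
  change (connMat D (frameExt b) x _).trace = _
  rw [connMat_sum, Matrix.trace_sum]
  simp only [Matrix.trace_smul, smul_eq_mul]

/-- The contracted first Bianchi identity. -/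
theorem trace_curvature_eq_ricci (a c : Fin n) :
    ∑ d, curvature D b a c d d = ricci D b c a - ricci D b a c := by
  have he := smV_frameExt b (mem_chart_source (EuclideanSpace ℝ (Fin n)) x)
  have hB : ∀ d, curvature D b a c d d = curvature D b d c d a - curvature D b d a d c := by
    intro d
    have h := congrArg (fun w => b.repr w d) (Rm_bianchi D (he a) (he c) (he d))
    rw [Rm_swap D (X := fun z => frameExt b z c)] at h
    simp only [map_add, map_neg, Finsupp.coe_add, Finsupp.coe_neg, Pi.add_apply, Pi.neg_apply,
      map_zero, Finsupp.coe_zero, Pi.zero_apply] at h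
    simp only [curvature_eq]
    linarith
  simp only [hB, Finset.sum_sub_distrib, ricci]

/-- The skew part of `n Ric + Ricᵀ` is `n - 1` times that of `Ric`, and `(n-1)/(n²-1) = 1/(n+1)`. -/
theorem schouten_skew (hn : 2 ≤ n) (a c : Fin n) :
    schouten D b c a - schouten D b a c =
      1 / ((n : ℝ) + 1) * ∑ d, curvature D b a c d d := by
  have h2 : (2 : ℝ) ≤ n := by exact_mod_cast hn
  have h3 : (n : ℝ) ^ 2 - 1 ≠ 0 := by nlinarith
  have h4 : (n : ℝ) + 1 ≠ 0 := by positivity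
  rw [trace_curvature_eq_ricci]
  simp only [schouten]
  field_simp
  ring

end Trace

/-! ### The slots of the splitting operator in terms of `∇` and `P`. -/

section Formulas

variable {n : ℕ} {M : Type*} [TopologicalSpace M] [ChartedSpace (EuclideanSpace ℝ (Fin n)) M]
  [IsManifold (𝓡 n) ∞ M] [T2Space M] {x y : M} {p : ProjectiveStructure n M} {κ : Kind}
  {H : ∀ x : M, FormComp p 0 x}

theorem mvfderiv_const_mul_apply {f : M → ℝ} (hf : MDifferentiableAt (𝓡 n) 𝓘(ℝ, ℝ) f x) (r : ℝ)
    (v : TangentSpace (𝓡 n) x) :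
    mvfderiv (𝓡 n) (fun z => r * f z) x v = r * mvfderiv (𝓡 n) f x v := by
  rw [mvfderiv_mul_apply mdifferentiableAt_const hf, mvfderiv_const]
  simp

theorem covE_const_mul (D : AffineConnection n M) {k l : ℕ} (w r : ℝ)
    {F : ∀ x : M, Frame n x → Comp n k l} {e : ∀ y : M, Frame n y} (c : Fin n)
    {I : Fin k → Fin n} {J : Fin l → Fin n}
    (hF : MDifferentiableAt (𝓡 n) 𝓘(ℝ, ℝ) (fun z => F z (e z) I J) y) :
    covE D w (fun x b I J => r * F x b I J) e y c I J = r * covE D w F e y c I J := by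
  simp only [covE, mvfderiv_const_mul_apply hF, mul_add, mul_sub, Finset.mul_sum]
  congr 1
  · congr 1
    · congr 1
      exact Finset.sum_congr rfl fun _ _ => Finset.sum_congr rfl fun _ _ => by ring
    · exact Finset.sum_congr rfl fun _ _ => Finset.sum_congr rfl fun _ _ => by ring
  · ring

/-- Contraction of the last upper with the lower index commutes with the covariant derivative. -/
theorem covE_contract (D : AffineConnection n M) (w : ℝ)
    {F : ∀ x : M, Frame n x → Comp n 2 1} {e : ∀ y : M, Frame n y} (i a : Fin n)
    (hF : ∀ c, MDifferentiableAt (𝓡 n) 𝓘(ℝ, ℝ) (fun z => F z (e z) ![a, c] ![c]) y) :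
    covE D w (fun x b (I : Fin 1 → Fin n) (_ : Fin 0 → Fin n) => ∑ c, F x b ![I 0, c] ![c]) e y i
      ![a] ![] = ∑ c, covE D w F e y i ![a, c] ![c] := by
  have h0 : ∀ c d : Fin n, Function.update ![a, c] 0 d = ![d, c] := fun c d => by
    funext r; fin_cases r <;> simp
  have h1 : ∀ c d : Fin n, Function.update ![a, c] 1 d = ![a, d] := fun c d => by
    funext r; fin_cases r <;> simp
  have h2 : ∀ c d : Fin n, Function.update ![c] 0 d = ![d] := fun c d => by
    funext r; fin_cases r; simp
  simp only [covE, Fin.sum_univ_two, Fin.sum_univ_one, Matrix.cons_val_zero, Matrix.cons_val_one,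
    h0, h1, h2, Finset.univ_eq_empty, Finset.sum_empty, sub_zero, Function.update_self,
    mvfderiv_sum_apply _ fun c _ => hF c, Finset.sum_add_distrib, Finset.sum_sub_distrib,
    Finset.mul_sum]
  rw [Finset.sum_comm (f := fun d c => connMat D e y (e y i) a d * _)]
  rw [Finset.sum_comm (f := fun c d => connMat D e y (e y i) d c * _)]
  ring

theorem upTop_eq {ζ : ∀ x : M, Frame n x → Comp n 2 0} {D : p.conns}
    (h : ∀ x b a c, H x (D, b) ![] (Sum.inl a) (Sum.inl c) = ζ x b ![a, c] ![]) :
    upTop H D = ζ := by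
  funext x b I J
  have hI : ![I 0, I 1] = I := by funext i; fin_cases i <;> rfl
  refine (h x b _ _).trans ?_
  rw [hI, Subsingleton.elim J ![]]

theorem downTop_eq {τ : ∀ x : M, Frame n x → Comp n 0 0} {D : p.conns}
    (h : ∀ x b, H x (D, b) ![] (Sum.inr ()) (Sum.inr ()) = τ x b ![] ![]) :
    downTop H D = τ := by
  funext x b I J
  refine (h x b).trans ?_
  rw [Subsingleton.elim J ![], Subsingleton.elim I ![]]

variable (hn : 2 ≤ n)
include hn

/-- The top slot of `d^∇ H` is `∇ζ` plus terms linear in the middle slot. Smoothness of `∇ζ`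
therefore follows from that of `d^∇ H` and `H`. -/
theorem smF_covD_upTop (h : IsSmoothFormSection p .up 0 H) (D : p.conns) (b : Frame n x)
    (a d c : Fin n) :
    SmF n (fun z => covD D.1 (-2) (upTop H D) z (frameExt b z) ![a, d] ![c]) x := by
  have hx := mem_chart_source (EuclideanSpace ℝ (Fin n)) x
  have h1 := ((h.tractorD hn).smF D b hx (Fin.cons c ![]) (Sum.inl a) (Sum.inl d)).sub
    ((smF_const (n := n) (if a = c then (1 : ℝ) else 0)).mul
      (h.smF D b hx ![] (Sum.inl d) (Sum.inr ())))
  have h2 := h1.sub ((smF_const (n := n) (if d = c then (1 : ℝ) else 0)).mul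
      (h.smF D b hx ![] (Sum.inl a) (Sum.inr ())))
  refine h2.congr (Eventually.of_forall fun z => ?_)
  simp only [tractorD_cons, tractorDeriv_up_top D _ _ _ (h.1 z), covD_vec_zero]
  simp only [frameExt_self, ite_mul, one_mul, zero_mul]
  ring

/-- The middle equation gives `λ = -div ζ / (n+1)`. Inserted into `div λ - P·ζ + n ρ = 0`, this
yields `ρ`. -/
theorem up_slots (h : IsSmoothFormSection p .up 0 H) (hK : ∀ x, codiffD p .up H x = 0)
    {ζ : ∀ x : M, Frame n x → Comp n 2 0}
    (hζ : ∀ x D b a c, H x (D, b) ![] (Sum.inl a) (Sum.inl c) = ζ x b ![a, c] ![])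
    (D : p.conns) (x : M) (b : Frame n x) :
    (∀ a, H x (D, b) ![] (Sum.inl a) (Sum.inr ()) =
      -1 / (n + 1) * ∑ c, covD D.1 (-2) ζ x b ![a, c] ![c]) ∧
    H x (D, b) ![] (Sum.inr ()) (Sum.inr ()) =
      1 / n * ∑ a, ∑ c, schouten D.1 b c a * ζ x b ![a, c] ![] +
      1 / (n * (n + 1)) * ∑ a, ∑ c,
        covD D.1 (-2) (covD D.1 (-2) ζ) x b ![a, c] ![a, c] := by
  have hn1 : (n : ℝ) + 1 ≠ 0 := by positivity
  have hn0 : (n : ℝ) ≠ 0 := by positivity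
  have hT : upTop H D = ζ := upTop_eq fun x => hζ x D
  have hm : ∀ x b a, H x (D, b) ![] (Sum.inl a) (Sum.inr ()) =
      -1 / (n + 1) * ∑ c, covD D.1 (-2) ζ x b ![a, c] ![c] := by
    intro x b a
    have h1 := codiff_up_mid D b (h.1 x) a
    rw [hK, hT] at h1
    have h2 : (0 : ℝ) = _ := h1
    field_simp
    linarith
  refine ⟨hm x b, ?_⟩
  have hM : upMid H D = fun x b I J => -1 / (n + 1) *
      (fun x b (I : Fin 1 → Fin n) (_ : Fin 0 → Fin n) =>
        ∑ c, covD D.1 (-2) ζ x b ![I 0, c] ![c]) x b I J := by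
    funext x b I J
    exact hm x b (I 0)
  have hd : ∀ a c d, MDifferentiableAt (𝓡 n) 𝓘(ℝ, ℝ)
      (fun z => covD D.1 (-2) ζ z (frameExt b z) ![a, c] ![d]) x := fun a c d => by
    rw [← hT]
    exact (smF_covD_upTop hn h D b a c d).mdiff
  have hdiv : ∀ i, covD D.1 (-2) (upMid H D) x b ![i] ![i] =
      -1 / (n + 1) * ∑ c, covD D.1 (-2) (covD D.1 (-2) ζ) x b ![i, c] ![i, c] := by
    intro i
    rw [hM, covD_vec_zero, covE_const_mul _ _ _ _ (mdiff_sum fun c _ => hd _ _ _),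
      covE_contract _ _ _ _ fun c => hd _ _ _]
    simp only [covD_vec_one]
  have h1 := codiff_up_bot D b hn h
  rw [hK] at h1
  simp only [hdiv, hζ] at h1
  have h2 : (0 : ℝ) = _ := h1
  rw [← Finset.mul_sum, Finset.sum_comm (f := fun i d => schouten D.1 b i d * _)] at h2
  have hs : ∀ a c, ζ x b ![c, a] ![] = ζ x b ![a, c] ![] := fun a c => by
    rw [← hζ x D b, ← hζ x D b]
    exact ((h.1 x).1 (D, b) ![]).apply _ _
  simp only [hs] at h2
  field_simp at h2 ⊢
  linarith

/-- In `covD` each point has its own extension of the frame, so a second derivative requires a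
comparison with a single local frame. This is inherited from `tractorDeriv_frameExt`, as the
algebraic terms agree. -/
theorem covD_downTop_frameExt (h : IsSmoothFormSection p .down 0 H) (D : p.conns)
    (b : Frame n x) (hy : y ∈ (chartAt (EuclideanSpace ℝ (Fin n)) x).source) (c : Fin n) :
    covD D.1 2 (downTop H D) y (frameExt b y) ![] ![c] =
      covE D.1 2 (downTop H D) (frameExt b) y c ![] ![] := by
  have h1 := congrFun (congrFun (tractorDeriv_frameExt h D b hy (frameExt b y c)) (Sum.inr ()))
    (Sum.inr ())
  have h2 := tractorDeriv_down_top D (frameExt (frameExt b y)) y c (h.1 y)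
  rw [frameExt_self, h1, tractorDeriv_down_top D (frameExt b) y c (h.1 y)] at h2
  rw [covD_vec_zero]
  exact (sub_left_injective h2).symm

/-- On densities of weight `2` the connection form is `2/(n+1)` times the trace of `Γ`, so the
commutator is `2/(n+1)` times the curvature of `Λⁿ TM`. Torsion-freeness makes the `Γ` terms of the
Hessian match the bracket of the frame fields. -/
theorem covD_comm (h : IsSmoothFormSection p .down 0 H) (D : p.conns) (b : Frame n x)
    (a c : Fin n) :
    covD D.1 2 (covD D.1 2 (downTop H D)) x b ![] ![a, c]
      - covD D.1 2 (covD D.1 2 (downTop H D)) x b ![] ![c, a] =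
      2 / ((n : ℝ) + 1) * (∑ d, curvature D.1 b a c d d) *
        H x (D, b) ![] (Sum.inr ()) (Sum.inr ()) := by
  have hx := mem_chart_source (EuclideanSpace ℝ (Fin n)) x
  have he := smV_frameExt b hx
  set e := fun z => frameExt b z with hedef
  set f : M → ℝ := fun z => H z (D, frameExt b z) ![] (Sum.inr ()) (Sum.inr ()) with hf
  have hfs : SmF n f x := h.smF D b hx ![] _ _
  set θ : Fin n → M → ℝ := fun c z => (connMat D.1 (frameExt b) z (frameExt b z c)).trace with hθ
  have hθs : ∀ c, SmF n (θ c) x := fun c => SmF.sum fun i _ => smF_connMat D.1 b hx c i i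
  set k : ℝ := 2 / ((n : ℝ) + 1) with hk
  set g : Fin n → M → ℝ := fun c z => mvfderiv (𝓡 n) f z (frameExt b z c) + k * (θ c z * f z)
    with hg
  -- The formula for the first derivative is needed near `x`, not only at `x`, because it is
  -- differentiated below.
  have hcov : ∀ c, ∀ᶠ z in 𝓝 x,
      covD D.1 2 (downTop H D) z (frameExt b z) ![] ![c] = g c z := by
    intro c
    filter_upwards [chart_source_mem hx] with z hz
    rw [covD_downTop_frameExt hn h D b hz]
    simp [covE, downTop, hg, hk, hθ, hf, mul_assoc]
  have hcx : ∀ c, covD D.1 2 (downTop H D) x b ![] ![c] = g c x := fun c => by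
    have := (hcov c).self_of_nhds
    rwa [frameExt_self] at this
  have hdf : ∀ c, SmF n (fun z => mvfderiv (𝓡 n) f z (frameExt b z c)) x := fun c =>
    hfs.mvfderiv D.1 (he c)
  have hdg : ∀ a c, mvfderiv (𝓡 n) (g c) x (b a) =
      mvfderiv (𝓡 n) (fun z => mvfderiv (𝓡 n) f z (frameExt b z c)) x (b a)
      + k * (mvfderiv (𝓡 n) (θ c) x (b a) * f x + θ c x * mvfderiv (𝓡 n) f x (b a)) := by
    intro a c
    rw [hg]
    rw [mvfderiv_add_apply (hdf c).mdiff ((smF_const k).mul ((hθs c).mul hfs)).mdiff,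
      mvfderiv_const_mul_apply ((hθs c).mul hfs).mdiff,
      mvfderiv_mul_apply (hθs c).mdiff hfs.mdiff]
  have h2 : ∀ a c, covD D.1 2 (covD D.1 2 (downTop H D)) x b ![] ![a, c] =
      mvfderiv (𝓡 n) (g c) x (b a) - ∑ d, connMat D.1 (frameExt b) x (b a) d c * g d x
      + k * θ a x * g c x := by
    intro a c
    have hu : ∀ d, Function.update ![c] 0 d = ![d] := fun d => by
      funext r; fin_cases r; simp
    rw [covD_vec_one]
    simp only [covE, Fin.sum_univ_one, Finset.univ_eq_empty, Finset.sum_empty, add_zero,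
      Matrix.cons_val_zero, hu, frameExt_self, hcx, mvfderiv_congr (hcov c)]
    simp only [hθ, frameExt_self, hk]
  have hgx : ∀ c, g c x = mvfderiv (𝓡 n) f x (b c) + k * (θ c x * f x) := fun c => by
    simp only [hg, frameExt_self]
  have hcomm := mvfderiv_comm D.1 hfs (he a) (he c)
  rw [mlieBracket_frameExt D.1 b, map_sum] at hcomm
  simp only [frameExt_self, map_smul, smul_eq_mul, sub_mul, Finset.sum_sub_distrib] at hcomm
  have hfx : H x (D, b) ![] (Sum.inr ()) (Sum.inr ()) = f x := by simp only [hf, frameExt_self]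
  have hθx : ∀ d, (connMat D.1 (frameExt b) x (b d)).trace = θ d x := fun d => by
    simp only [hθ, frameExt_self]
  rw [trace_curvature, hfx]
  simp only [hθx]
  rw [h2, h2, hdg, hdg]
  simp only [hgx, mul_add, sub_mul, Finset.sum_add_distrib, Finset.sum_sub_distrib]
  have hsum : ∀ a c, ∑ d, connMat D.1 (frameExt b) x (b a) d c * (k * (θ d x * f x)) =
      k * f x * ∑ d, connMat D.1 (frameExt b) x (b a) d c * θ d x := fun a c => by
    rw [Finset.mul_sum]
    exact Finset.sum_congr rfl fun d _ => by ring
  rw [hsum, hsum]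
  linear_combination hcomm

/-- The equation determines the bottom slot as the symmetrization of `½∇∇τ + Pτ`. That expression is
already symmetric: the skew part of `½∇∇τ` from `covD_comm` is opposite to the skew part of `Pτ`
from `schouten_skew`. -/
theorem down_slots (h : IsSmoothFormSection p .down 0 H) (hK : ∀ x, codiffD p .down H x = 0)
    {τ : ∀ x : M, Frame n x → Comp n 0 0}
    (hτ : ∀ x D b, H x (D, b) ![] (Sum.inr ()) (Sum.inr ()) = τ x b ![] ![])
    (D : p.conns) (x : M) (b : Frame n x) :
    (∀ a, H x (D, b) ![] (Sum.inl a) (Sum.inr ()) = 1 / 2 * covD D.1 2 τ x b ![] ![a]) ∧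
    ∀ a c, H x (D, b) ![] (Sum.inl a) (Sum.inl c) =
      1 / 2 * covD D.1 2 (covD D.1 2 τ) x b ![] ![a, c] + schouten D.1 b a c * τ x b ![] ![] := by
  have hx := mem_chart_source (EuclideanSpace ℝ (Fin n)) x
  have hT : downTop H D = τ := downTop_eq fun x => hτ x D
  have hm : ∀ x b a, H x (D, b) ![] (Sum.inl a) (Sum.inr ()) =
      1 / 2 * covD D.1 2 τ x b ![] ![a] := by
    intro x b a
    have h1 := codiff_down_mid D b (h.1 x) a
    rw [hK, hT] at h1
    have h2 : (0 : ℝ) = _ := h1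
    linarith
  refine ⟨hm x b, fun a c => ?_⟩
  have hM : downMid H D = fun x b I J => 1 / 2 * covD D.1 2 τ x b I J := by
    funext x b I J
    have hJ : ![J 0] = J := by funext i; fin_cases i; rfl
    refine (hm x b (J 0)).trans ?_
    rw [hJ, Subsingleton.elim I ![]]
  have hd : ∀ c, MDifferentiableAt (𝓡 n) 𝓘(ℝ, ℝ)
      (fun z => covD D.1 2 τ z (frameExt b z) ![] ![c]) x := fun c => by
    refine mdiff_congr (((smF_const (n := n) 2).mul
      (h.smF D b hx ![] (Sum.inl c) (Sum.inr ()))).mdiff) (Eventually.of_forall fun z => ?_)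
    simp only [hm]
    ring
  have h1 := codiff_down_bot D b hn h a c
  rw [hK, hM, covD_vec_one, covD_vec_one, covE_const_mul _ _ _ _ (hd _),
    covE_const_mul _ _ _ _ (hd _), ← covD_vec_one, ← covD_vec_one, hτ] at h1
  have h2 : (0 : ℝ) = _ := h1
  have h3 := covD_comm hn h D b a c
  have h4 := schouten_skew D.1 b hn a c
  rw [hT, hτ] at h3
  have h5 : (schouten D.1 b c a - schouten D.1 b a c) * τ x b ![] ![] = _ :=
    congrArg (· * τ x b ![] ![]) h4
  have h6 : 2 / ((n : ℝ) + 1) = 2 * (1 / ((n : ℝ) + 1)) := by ring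
  rw [h6] at h3
  linear_combination (-1 / 2) * h2 + (-1 / 4) * h3 + (1 / 2) * h5

end Formulas

/-! ### Lifts of sections and the first BGG operator. -/

section BGG

variable {n : ℕ} {M : Type*} [TopologicalSpace M] [ChartedSpace (EuclideanSpace ℝ (Fin n)) M]
  [IsManifold (𝓡 n) ∞ M] {x : M} {p : ProjectiveStructure n M}

/-- For a fixed connection the transition is block diagonal, so `(ζ, 0, 0)` is compatible with all
changes of frame. -/
theorem act_up_slots (b b' : Frame n x) (ζ ζ' : Fin n → Fin n → ℝ)
    (hs : ∀ a c, ζ a c = ζ c a) (hs' : ∀ a c, ζ' a c = ζ' c a)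
    (h : ∀ i j, ζ' i j = |(b.toMatrix b').det| ^ ((2 : ℝ) / (n + 1)) *
        ∑ k, ∑ l, b'.toMatrix b i k * b'.toMatrix b j l * ζ k l) :
    slots ζ' 0 0 = Kind.up.act (tractorTransition b b' 0) (slots ζ 0 0) := by
  refine ext_slots (slots_isSymm hs' _ _) (act_isSymm _ _ (slots_isSymm hs _ _)) (fun i j => ?_)
    (fun i => ?_) ?_
  · rw [act_up_apply_top]
    exact h i j
  · simp [act_up, tractorTransition, Matrix.mul_apply]
  · simp [act_up, tractorTransition, Matrix.mul_apply]

theorem act_down_slots (b b' : Frame n x) (τ τ' : ℝ)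
    (h : τ' = |(b.toMatrix b').det| ^ (-(2 : ℝ) / (n + 1)) * τ) :
    slots 0 0 τ' = Kind.down.act (tractorTransition b b' 0) (slots 0 0 τ) := by
  refine ext_slots (slots_isSymm (fun _ _ => rfl) _ _)
    (act_isSymm _ _ (slots_isSymm (fun _ _ => rfl) _ _)) (fun i j => ?_) (fun i => ?_) ?_
  · rw [act_down, tractorTransition_inv]
    simp [tractorTransition, Matrix.mul_apply]
  · rw [act_down, tractorTransition_inv]
    simp [tractorTransition, Matrix.mul_apply]
  · rw [act_down_apply_top]
    exact h

variable [T2Space M]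

/-- The lift is `(ζ, 0, 0)` with respect to one reference connection. It is noncanonical and only
serves as the input of `exists_codiff_up`. -/
theorem exists_section_up (p : ProjectiveStructure n M) {ζ : ∀ x : M, Frame n x → Comp n 2 0}
    (hζ : ∀ x, ζ x ∈ symBivector n x) (hs : SmoothField ζ) :
    ∃ H, IsSmoothFormSection p .up 0 H ∧ ∀ x D b a c,
      H x (D, b) ![] (Sum.inl a) (Sum.inl c) = ζ x b ![a, c] ![] := by
  have hsymm := fun x => (hζ x).2
  obtain ⟨H, hH, h⟩ := exists_section (κ := .up) p.someConn
    (fun x b => slots (fun a c => ζ x b ![a, c] ![]) 0 0)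
    (fun x b => slots_isSymm (hsymm x b) 0 0)
    (fun x b b' => act_up_slots b b' _ _ (hsymm x b) (hsymm x b') fun i j => by
      rw [(hζ x).1 b b' ![i, j] ![], sum_fin_two, neg_neg]
      simp [Subsingleton.elim default ![]])
    (fun x b y hy i j => by
      rcases i with i | i <;> rcases j with j | j
      · exact smF_iff_contMDiffOn.2 (hs x b ![i, j] ![]) y hy
      · exact smF_const _
      · exact smF_const _
      · exact smF_const _)
  refine ⟨H, hH, fun x D b a c => ?_⟩
  rw [up_top_indep (hH.1 x) p.someConn D, h]
  rfl

theorem exists_section_down (p : ProjectiveStructure n M) {τ : ∀ x : M, Frame n x → Comp n 0 0}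
    (hτ : ∀ x, τ x ∈ wTensor (n := n) 0 0 2 x) (hs : SmoothField τ) :
    ∃ H, IsSmoothFormSection p .down 0 H ∧ ∀ x D b,
      H x (D, b) ![] (Sum.inr ()) (Sum.inr ()) = τ x b ![] ![] := by
  obtain ⟨H, hH, h⟩ := exists_section (κ := .down) p.someConn
    (fun x b => slots 0 0 (τ x b ![] ![]))
    (fun x b => slots_isSymm (fun _ _ => rfl) 0 _)
    (fun x b b' => act_down_slots b b' _ _ (by
      rw [hτ x b b' ![] ![]]
      simp [Subsingleton.elim default ![]]))
    (fun x b y hy i j => by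
      rcases i with i | i <;> rcases j with j | j
      · exact smF_const _
      · exact smF_const _
      · exact smF_const _
      · exact smF_iff_contMDiffOn.2 (hs x b ![] ![]) y hy)
  refine ⟨H, hH, fun x D b => ?_⟩
  rw [down_top_indep (hH.1 x) p.someConn D, h]
  rfl

theorem isSplitting_splittingOp {κ : Kind} {ρ : ∀ x : M, Homology p κ 0 x}
    (h : ∃ H, IsSplitting p κ ρ H) : IsSplitting p κ ρ (splittingOp p κ ρ) := by
  rw [splittingOp, dif_pos h]
  exact h.choose_spec

/-- The condition `Π_0(H) = ρ` in terms of the top slot. -/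
theorem proj_up_iff (Φ : Homology p .up 0 x ≃ₗ[ℝ] symBivector n x)
    (hΦ : ∀ (H : codiffKer p .up 0 x) (D : p.conns) (b : Frame n x) (a c : Fin n),
      (Φ (proj p .up 0 x H)).1 b ![a, c] ![] = H.1 (D, b) ![] (Sum.inl a) (Sum.inl c))
    (s : symBivector n x) (H : codiffKer p .up 0 x) :
    proj p .up 0 x H = Φ.symm s ↔
      ∀ D b a c, H.1 (D, b) ![] (Sum.inl a) (Sum.inl c) = s.1 b ![a, c] ![] := by
  rw [LinearEquiv.eq_symm_apply]
  constructor
  · intro h D b a c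
    rw [← hΦ, h]
  · intro h
    refine Subtype.ext (funext fun b => funext fun I => funext fun J => ?_)
    have hI : ![I 0, I 1] = I := by funext i; fin_cases i <;> rfl
    rw [Subsingleton.elim J ![], ← hI, hΦ H p.someConn, h]

theorem proj_down_iff (Ψ : Homology p .down 0 x ≃ₗ[ℝ] wTensor (n := n) 0 0 2 x)
    (hΨ : ∀ (H : codiffKer p .down 0 x) (D : p.conns) (b : Frame n x),
      (Ψ (proj p .down 0 x H)).1 b ![] ![] = H.1 (D, b) ![] (Sum.inr ()) (Sum.inr ()))
    (t : wTensor (n := n) 0 0 2 x) (H : codiffKer p .down 0 x) :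
    proj p .down 0 x H = Ψ.symm t ↔
      ∀ D b, H.1 (D, b) ![] (Sum.inr ()) (Sum.inr ()) = t.1 b ![] ![] := by
  rw [LinearEquiv.eq_symm_apply]
  constructor
  · intro h D b
    rw [← hΨ, h]
  · intro h
    refine Subtype.ext (funext fun b => funext fun I => funext fun J => ?_)
    rw [Subsingleton.elim J ![], Subsingleton.elim I ![], hΨ H p.someConn, h]

theorem isSplitting_up_iff {Φ : ∀ x, Homology p .up 0 x ≃ₗ[ℝ] symBivector n x}
    (hΦ : ∀ x (H : codiffKer p .up 0 x) (D : p.conns) (b : Frame n x) (a c : Fin n),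
      (Φ x (proj p .up 0 x H)).1 b ![a, c] ![] = H.1 (D, b) ![] (Sum.inl a) (Sum.inl c))
    (s : ∀ x, symBivector n x) (H : ∀ x : M, FormComp p 0 x) :
    IsSplitting p .up (fun x => (Φ x).symm (s x)) H ↔ IsSmoothFormSection p .up 0 H ∧
      (∀ x D b a c, H x (D, b) ![] (Sum.inl a) (Sum.inl c) = (s x).1 b ![a, c] ![]) ∧
      ∀ x, codiffD p .up H x = 0 := by
  refine and_congr_right fun hH => and_congr_left fun _ => forall_congr' fun x => ?_
  exact ⟨fun ⟨h, h'⟩ => (proj_up_iff (Φ x) (hΦ x) (s x) _).1 h',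
    fun h => ⟨hH.1 x, (proj_up_iff (Φ x) (hΦ x) (s x) _).2 h⟩⟩

theorem isSplitting_down_iff {Ψ : ∀ x, Homology p .down 0 x ≃ₗ[ℝ] wTensor (n := n) 0 0 2 x}
    (hΨ : ∀ x (H : codiffKer p .down 0 x) (D : p.conns) (b : Frame n x),
      (Ψ x (proj p .down 0 x H)).1 b ![] ![] = H.1 (D, b) ![] (Sum.inr ()) (Sum.inr ()))
    (t : ∀ x, wTensor (n := n) 0 0 2 x) (H : ∀ x : M, FormComp p 0 x) :
    IsSplitting p .down (fun x => (Ψ x).symm (t x)) H ↔ IsSmoothFormSection p .down 0 H ∧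
      (∀ x D b, H x (D, b) ![] (Sum.inr ()) (Sum.inr ()) = (t x).1 b ![] ![]) ∧
      ∀ x, codiffD p .down H x = 0 := by
  refine and_congr_right fun hH => and_congr_left fun _ => forall_congr' fun x => ?_
  exact ⟨fun ⟨h, h'⟩ => (proj_down_iff (Ψ x) (hΨ x) (t x) _).1 h',
    fun h => ⟨hH.1 x, (proj_down_iff (Ψ x) (hΨ x) (t x) _).2 h⟩⟩

/-- The top slot of `d^∇ L(ζ)` is the trace-free part of `∇ζ`. -/
theorem tractorD_top_eq_metrizabilityOp (hn : 2 ≤ n) {H : ∀ x : M, FormComp p 0 x}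
    (h : IsSmoothFormSection p .up 0 H) (hK : ∀ x, codiffD p .up H x = 0)
    {ζ : ∀ x : M, Frame n x → Comp n 2 0}
    (hζ : ∀ x D b a c, H x (D, b) ![] (Sum.inl a) (Sum.inl c) = ζ x b ![a, c] ![])
    (D : p.conns) (x : M) (b : Frame n x) (a d c : Fin n) :
    tractorD p .up H x (D, b) ![c] (Sum.inl a) (Sum.inl d) =
      metrizabilityOp D.1 ζ x b ![a, d] ![c] := by
  have hT : upTop H D = ζ := upTop_eq fun x => hζ x D
  have hD : ∀ a d c, tractorD p .up H x (D, b) ![c] (Sum.inl a) (Sum.inl d) =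
      covD D.1 (-2) ζ x b ![a, d] ![c]
      + (if a = c then H x (D, b) ![] (Sum.inl d) (Sum.inr ()) else 0)
      + (if d = c then H x (D, b) ![] (Sum.inl a) (Sum.inr ()) else 0) := by
    intro a d c
    have h1 := tractorD_cons (κ := .up) (H := H) D b c
    have h2 := tractorDeriv_up_top D (frameExt b) x c (h.1 x) a d
    rw [hT, ← covD_vec_zero, ← h1, frameExt_self] at h2
    exact h2
  -- Symmetry of `∇ζ` in its upper indices follows from that of `d^∇ H`, as the terms with the
  -- middle slot are symmetric. It identifies the two divergences in `metrizabilityOp`.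
  have hsymm : ∀ a d c, covD D.1 (-2) ζ x b ![d, a] ![c] = covD D.1 (-2) ζ x b ![a, d] ![c] := by
    intro a d c
    have h1 := hD a d c
    have h2 := hD d a c
    have h3 : tractorD p .up H x (D, b) ![c] (Sum.inl d) (Sum.inl a) =
        tractorD p .up H x (D, b) ![c] (Sum.inl a) (Sum.inl d) :=
      ((tractorD_mem hn h x).1 (D, b) ![c]).apply _ _
    linarith
  have hsum : ∑ e, covD D.1 (-2) ζ x b ![e, d] ![e] = ∑ e, covD D.1 (-2) ζ x b ![d, e] ![e] :=
    Finset.sum_congr rfl fun e _ => hsymm d e e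
  rw [hD]
  simp only [(up_slots hn h hK hζ D x b).1]
  simp only [metrizabilityOp, Matrix.cons_val_zero, Matrix.cons_val_one, eq_comm (a := c), hsum]
  split_ifs <;> ring

end BGG

end ProjTractor

end

/-! ### The main theorem. -/

open ProjTractor in
theorem proposition3p2 (n : ℕ) (hn : 2 ≤ n) (M : Type*) [TopologicalSpace M] [T2Space M]
    [SigmaCompactSpace M] [ChartedSpace (EuclideanSpace ℝ (Fin n)) M] [IsManifold (𝓡 n) ∞ M]
    (p : ProjectiveStructure n M) :
    -- `H_0(E^{(AB)}) = E^{(ab)}(-2)`, `H_1(E^{(AB)})` is the trace-free part of `E_c^{(ab)}(-2)`,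
    -- and `H_0(E_{(AB)}) = E(2)`, each by taking the slot indicated.
    ∃ (Φ₀ : ∀ x : M, Homology p .up 0 x ≃ₗ[ℝ] symBivector n x)
      (Φ₁ : ∀ x : M, Homology p .up 1 x ≃ₗ[ℝ] tfSymBivectorForm n x)
      (Ψ₀ : ∀ x : M, Homology p .down 0 x ≃ₗ[ℝ] wTensor (n := n) 0 0 2 x),
      (∀ (x : M) (H : codiffKer p .up 0 x) (D : p.conns) (b : Frame n x) (a c : Fin n),
        (Φ₀ x (proj p .up 0 x H)).1 b ![a, c] ![] = H.1 (D, b) ![] (Sum.inl a) (Sum.inl c)) ∧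
      (∀ (x : M) (φ : codiffKer p .up 1 x) (D : p.conns) (b : Frame n x) (a d c : Fin n),
        (Φ₁ x (proj p .up 1 x φ)).1 b ![a, d] ![c] =
          φ.1 (D, b) ![c] (Sum.inl a) (Sum.inl d)) ∧
      (∀ (x : M) (H : codiffKer p .down 0 x) (D : p.conns) (b : Frame n x),
        (Ψ₀ x (proj p .down 0 x H)).1 b ![] ![] = H.1 (D, b) ![] (Sum.inr ()) (Sum.inr ())) ∧
      -- the splitting operator and the first BGG operator of `E^{(AB)}`
      (∀ s : (∀ x : M, symBivector n x), SmoothField (fun x => (s x).1) →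
        let ζ : ∀ x : M, Frame n x → Comp n 2 0 := fun x => (s x).1
        let ρ : ∀ x : M, Homology p .up 0 x := fun x => (Φ₀ x).symm (s x)
        let L : ∀ x : M, FormComp p 0 x := splittingOp p .up ρ
        -- the splitting operator is well defined
        IsSplitting p .up ρ L ∧ (∀ H, IsSplitting p .up ρ H → H = L) ∧
        -- the slots of `L(ζ)`
        (∀ (D : p.conns) (x : M) (b : Frame n x),
          (∀ a c, L x (D, b) ![] (Sum.inl a) (Sum.inl c) = ζ x b ![a, c] ![]) ∧
          (∀ a, L x (D, b) ![] (Sum.inl a) (Sum.inr ()) =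
            -1 / (n + 1) * ∑ c, covD D.1 (-2) ζ x b ![a, c] ![c]) ∧
          L x (D, b) ![] (Sum.inr ()) (Sum.inr ()) =
            1 / n * ∑ a, ∑ c, schouten D.1 b c a * ζ x b ![a, c] ![] +
            1 / (n * (n + 1)) * ∑ a, ∑ c,
              covD D.1 (-2) (covD D.1 (-2) ζ) x b ![a, c] ![a, c]) ∧
        -- the first BGG operator is the metrizability operator
        (∀ x, tractorD p .up L x ∈ codiffKer p .up 1 x) ∧
        (∀ (D : p.conns) (x : M) (b : Frame n x) (a d c : Fin n),
          (Φ₁ x (bggOp p .up ρ x)).1 b ![a, d] ![c] =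
            metrizabilityOp D.1 ζ x b ![a, d] ![c]) ∧
        (∀ D : p.conns, (∀ x, bggOp p .up ρ x = 0) ↔
          ∀ x b a d c, metrizabilityOp D.1 ζ x b ![a, d] ![c] = 0) ∧
        -- projective invariance
        (∀ D D' : p.conns, metrizabilityOp D.1 ζ = metrizabilityOp D'.1 ζ)) ∧
      -- the splitting operator of `E_{(AB)}`
      (∀ t : (∀ x : M, wTensor (n := n) 0 0 2 x), SmoothField (fun x => (t x).1) →
        let τ : ∀ x : M, Frame n x → Comp n 0 0 := fun x => (t x).1
        let ρ : ∀ x : M, Homology p .down 0 x := fun x => (Ψ₀ x).symm (t x)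
        let L : ∀ x : M, FormComp p 0 x := splittingOp p .down ρ
        IsSplitting p .down ρ L ∧ (∀ H, IsSplitting p .down ρ H → H = L) ∧
        ∀ (D : p.conns) (x : M) (b : Frame n x),
          L x (D, b) ![] (Sum.inr ()) (Sum.inr ()) = τ x b ![] ![] ∧
          (∀ a, L x (D, b) ![] (Sum.inl a) (Sum.inr ()) = 1 / 2 * covD D.1 2 τ x b ![] ![a]) ∧
          ∀ a c, L x (D, b) ![] (Sum.inl a) (Sum.inl c) =
            1 / 2 * covD D.1 2 (covD D.1 2 τ) x b ![] ![a, c] +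
              schouten D.1 b a c * τ x b ![] ![]) := by
  choose Φ₀ hΦ₀ using fun x : M => exists_homology_zero_up p x hn
  choose Φ₁ hΦ₁ using fun x : M => exists_homology_one_up p x hn
  choose Ψ₀ hΨ₀ using fun x : M => exists_homology_zero_down p x
  refine ⟨Φ₀, Φ₁, Ψ₀, hΦ₀, hΦ₁, hΨ₀, fun s hs => ?_, fun t ht => ?_⟩
  · intro ζ ρ L
    have hiff := isSplitting_up_iff (p := p) hΦ₀ s
    have hex : ∃ H, IsSplitting p .up ρ H := by
      obtain ⟨H, hH, hHs⟩ := exists_section_up p (fun x => (s x).2) hs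
      obtain ⟨H', hH', hK, ht⟩ := exists_codiff_up hn hH
      exact ⟨H', (hiff H').2 ⟨hH', fun x D b a c => (ht x D b a c).trans (hHs x D b a c), hK⟩⟩
    have hL : IsSplitting p .up ρ L := isSplitting_splittingOp hex
    obtain ⟨hLs, hLt, hLK⟩ := (hiff L).1 hL
    have hker : ∀ x, tractorD p .up L x ∈ codiffKer p .up 1 x := fun x =>
      ⟨tractorD_mem hn hLs x, LinearMap.mem_ker.2 (hLK x)⟩
    have htop : ∀ (D : p.conns) (x : M) (b : Frame n x) (a d c : Fin n),
        tractorD p .up L x (D, b) ![c] (Sum.inl a) (Sum.inl d) =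
          metrizabilityOp D.1 ζ x b ![a, d] ![c] :=
      tractorD_top_eq_metrizabilityOp hn hLs hLK hLt
    -- Since `d^∇ L(ζ)` is in the kernel of `∂*`, the default value in the definition of `bggOp`
    -- never occurs.
    have hbgg : ∀ x, bggOp p .up ρ x = proj p .up 1 x ⟨tractorD p .up L x, hker x⟩ := fun x =>
      dif_pos (hker x)
    have hΘ : ∀ (D : p.conns) (x : M) (b : Frame n x) (a d c : Fin n),
        (Φ₁ x (bggOp p .up ρ x)).1 b ![a, d] ![c] = metrizabilityOp D.1 ζ x b ![a, d] ![c] := by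
      intro D x b a d c
      rw [hbgg, hΦ₁ x _ D]
      exact htop D x b a d c
    have hvec : ∀ I : Fin 2 → Fin n, I = ![I 0, I 1] := fun I => by
      funext i; fin_cases i <;> rfl
    have hvec' : ∀ J : Fin 1 → Fin n, J = ![J 0] := fun J => by funext i; fin_cases i; rfl
    refine ⟨hL, fun H hH => ?_, fun D x b => ⟨hLt x D b, up_slots hn hLs hLK hLt D x b⟩, hker, hΘ,
      fun D => ⟨fun h x b a d c => ?_, fun h x => ?_⟩, fun D D' => ?_⟩
    · obtain ⟨h1, h2, h3⟩ := (hiff H).1 hH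
      exact eq_of_codiff_up hn h1 hLs h3 hLK fun x D b a c => by rw [h2, hLt]
    · rw [← hΘ, h, map_zero]
      rfl
    · rw [← (Φ₁ x).map_eq_zero_iff]
      refine Subtype.ext (funext fun b => funext fun I => funext fun J => ?_)
      rw [hvec I, hvec' J, hΘ D, h]
      rfl
    -- For either connection the operator equals `Φ₁` of the BGG operator, which involves no choice
    -- of connection.
    · funext x b I J
      rw [hvec I, hvec' J, ← hΘ, ← hΘ]
  · intro τ ρ L
    have hiff := isSplitting_down_iff (p := p) hΨ₀ t
    have hex : ∃ H, IsSplitting p .down ρ H := by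
      obtain ⟨H, hH, hHs⟩ := exists_section_down p (fun x => (t x).2) ht
      obtain ⟨H', hH', hK, ht⟩ := exists_codiff_down hn hH
      exact ⟨H', (hiff H').2 ⟨hH', fun x D b => (ht x D b).trans (hHs x D b), hK⟩⟩
    have hL : IsSplitting p .down ρ L := isSplitting_splittingOp hex
    obtain ⟨hLs, hLt, hLK⟩ := (hiff L).1 hL
    refine ⟨hL, fun H hH => ?_, fun D x b => ⟨hLt x D b, down_slots hn hLs hLK hLt D x b⟩⟩
    obtain ⟨h1, h2, h3⟩ := (hiff H).1 hH
    exact eq_of_codiff_down hn h1 hLs h3 hLK fun x D b => by rw [h2, hLt]
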